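/- **Setup.** Let $k$ be a field of characteristic $0$. Fix a set of variables; each variable $x$ has a dual variable $\partial_x$. A *diagram* is a finite graph with internal vertices of prescribed kinds (each kind has a finite valency and a positive half-integral degree, and there are only finitely many kinds of any bounded degree), and with finitely many univalent *legs* labeled by variables or dual variables. Diagrams are taken up to isomorphism; the internal degree of a diagram is the sum of the degrees of its internal vertices. A *strut* is a component consisting of one edge that joins two legs. There are no vertexless circle components, so struts are the only connected diagrams of degree $0$. We consider possibly infinite formal $k$-linear combinations of diagrams, modulo an arbitrary set of *internal relations*: each is a linear combination of strutless diagrams of equal degree with the same numbered legs, set equal to $0$ wherever it occurs inside larger diagrams. Products and exponentials are with respect to disjoint union. Gluing two legs removes them and fuses their edges. A *function* is a combination of diagrams without dual labels. For a combination $D$ and a function $f$, $D\triangleright f$ is the sum of all ways of gluing all dual legs of $D$ to some or all legs of $f$, each $\partial_x$-leg being glued to an $x$-leg. Let $X$ be a finite set of variables. A combination is *$X$-substantial* if its diagrams contain no strut both of whose ends are labeled by members of $X$ or their duals. A *non-degenerate Gaussian* with respect to $X$ is a combination $G=P\cdot\exp(Q/2)$, where $P$ is an $X$-substantial function and $Q=\sum_{x,y\in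 X}l_{xy}\,(x\!-\!y)$ is a sum of struts with a symmetric invertible matrix $(l_{xy})$ over $k$. With $(l^{xy})$ the inverse matrix and $Q^{-1}=\sum_{x,y\in X}l^{xy}(\partial_x\!-\!\partial_y)$, its *formal Gaussian integral* is $$\int^{FG}G\,dX=\big\langle \exp(-Q^{-1}/2),\,P\big\rangle_X ,$$ the sum of all ways of gluing all $\partial_x$-legs of $\exp(-Q^{-1}/2)$ to all $x$-legs of $P$, for all $x\in X$. Let $z\in X$. A *differential operator with respect to $z$ of order $l$* is a combination $D$ of diagrams each of which has exactly $l$ legs labeled $\partial_z$, all its other legs being labeled by (non-dual) variables, $z$ or others. Its *divergence* $\operatorname{div}_zD$ is the sum of all ways of gluing all $\partial_z$-legs of each diagram of $D$ to some or all $z$-legs of that same diagram ($0$ if there are fewer $z$-legs than $\partial_z$-legs). **Proposition.** Let $G$ be a non-degenerate Gaussian with respect to $X$, let $z\in X$, and let $D$ be an $X$-substantial differential operator with respect to $z$ of order $l\ge 0$. Then $D\triangleright G$ and $(\operatorname{div}_zD)\cdot G$ are non-degenerate Gaussians with respect to $X$, and, for every way of writing each of them in the form $P\cdot\exp(Q/2)$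 above, $$\int^{FG}D\triangleright G\,dX=(-1)^l\int^{FG}(\operatorname{div}_zD)\,G\,dX .$$ -/

import Mathlib

/-!  Diagrams, formal infinite sums of diagrams, gluing, and formal Gaussian integration. -/

noncomputable section

namespace FormalDiagram

/-- The kinds of internal vertices of which diagrams are built. Degrees are counted in half units:
`deg v` is twice the internal degree of a vertex of kind `v`. Struts will be the only connected
diagrams without internal vertices, hence the only ones of internal degree `0`, and in every
degree there are only finitely many strutless diagrams (over a finite set of labels). -/
structure VertexKinds where
  Kind : Type
  arity : Kind → ℕ
  deg : Kind → ℕ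
  deg_pos : ∀ v, 0 < deg v
  finite_deg_le : ∀ j, {v | deg v ≤ j}.Finite

/-- The flags (vertex ends of edges) at a family of vertices: pairs `(v, i)`, `i < arity v`. -/
def Flags (𝒱 : VertexKinds) {V : Type} (kind : V → 𝒱.Kind) : Type :=
  {p : V × ℕ // p.2 < 𝒱.arity (kind p.1)}

/-- A diagram with legs labeled by `L`: finitely many internal vertices, finitely many legs
(outward univalent ends), and edges, that is, a perfect matching `mate` of the set of all flags
and legs. A strut is an edge that joins two legs. -/
structure Diagram (𝒱 : VertexKinds) (L : Type*) where
  Vert : Type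
  Leg : Type
  finite_vert : Finite Vert
  finite_leg : Finite Leg
  kind : Vert → 𝒱.Kind
  label : Leg → L
  mate : Flags 𝒱 kind ⊕ Leg → Flags 𝒱 kind ⊕ Leg
  mate_mate : ∀ e, mate (mate e) = e
  mate_ne : ∀ e, mate e ≠ e

/-- The map of flags induced by a kind-preserving map of vertices. -/
def Flags.map {𝒱 : VertexKinds} {V W : Type} {kV : V → 𝒱.Kind} {kW : W → 𝒱.Kind}
    (f : V → W) (h : ∀ v, kW (f v) = kV v) (p : Flags 𝒱 kV) : Flags 𝒱 kW :=
  ⟨(f p.1.1, p.1.2), by rw [h]; exact p.2⟩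

instance Flags.finite {𝒱 : VertexKinds} {V : Type} [Finite V] (kind : V → 𝒱.Kind) :
    Finite (Flags 𝒱 kind) := by
  refine Finite.of_injective
    (fun p : Flags 𝒱 kind => (⟨p.1.1, ⟨p.1.2, p.2⟩⟩ : Σ v, Fin (𝒱.arity (kind v)))) ?_
  rintro ⟨⟨v, i⟩, hi⟩ ⟨⟨w, j⟩, hj⟩ h
  simp only [Sigma.mk.injEq] at h
  obtain ⟨rfl, h⟩ := h
  simp only [heq_eq_eq, Fin.mk.injEq] at h
  subst h
  rfl

namespace Diagram

variable {𝒱 : VertexKinds} {L : Type*}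

/-- Twice the internal degree of a diagram. -/
def degree (Γ : Diagram 𝒱 L) : ℕ := ∑ᶠ v, 𝒱.deg (Γ.kind v)

/-- Isomorphism of diagrams. Legs with equal labels may be permuted. -/
structure Iso (Γ Δ : Diagram 𝒱 L) where
  vert : Γ.Vert ≃ Δ.Vert
  leg : Γ.Leg ≃ Δ.Leg
  kind_eq : ∀ v, Δ.kind (vert v) = Γ.kind v
  label_eq : ∀ s, Δ.label (leg s) = Γ.label s
  mate_eq : ∀ e, Δ.mate (Sum.map (Flags.map vert kind_eq) leg e) =
    Sum.map (Flags.map vert kind_eq) leg (Γ.mate e)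

def Iso.refl (Γ : Diagram 𝒱 L) : Iso Γ Γ where
  vert := Equiv.refl _
  leg := Equiv.refl _
  kind_eq _ := rfl
  label_eq _ := rfl
  mate_eq e := by
    have h : (Sum.map (Flags.map (𝒱 := 𝒱) (kV := Γ.kind) (kW := Γ.kind)
        (Equiv.refl Γ.Vert) (fun _ => rfl)) (Equiv.refl Γ.Leg)) = id := by
      funext e; rcases e with e | e <;> rfl
    rw [h]; rfl

def Iso.symm {Γ Δ : Diagram 𝒱 L} (f : Iso Γ Δ) : Iso Δ Γ where
  vert := f.vert.symm
  leg := f.leg.symm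
  kind_eq v := by rw [← f.kind_eq, Equiv.apply_symm_apply]
  label_eq s := by rw [← f.label_eq, Equiv.apply_symm_apply]
  mate_eq e := by
    have hk : ∀ v, Γ.kind (f.vert.symm v) = Δ.kind v := fun v => by
      rw [← f.kind_eq, Equiv.apply_symm_apply]
    have h1 : ∀ e, Sum.map (Flags.map f.vert f.kind_eq) f.leg
        (Sum.map (Flags.map f.vert.symm hk) f.leg.symm e) = e := by
      rintro (⟨⟨v, i⟩, hi⟩ | s)
      · exact congrArg Sum.inl (Subtype.ext (Prod.ext (f.vert.apply_symm_apply v) rfl))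
      · simp
    have h2 : ∀ e, Sum.map (Flags.map f.vert.symm hk) f.leg.symm
        (Sum.map (Flags.map f.vert f.kind_eq) f.leg e) = e := by
      rintro (⟨⟨v, i⟩, hi⟩ | s)
      · exact congrArg Sum.inl (Subtype.ext (Prod.ext (f.vert.symm_apply_apply v) rfl))
      · simp
    have h3 := f.mate_eq (Sum.map (Flags.map f.vert.symm hk) f.leg.symm e)
    rw [h1] at h3
    rw [h3, h2]

def Iso.trans {Γ Δ Θ : Diagram 𝒱 L} (f : Iso Γ Δ) (ψ : Iso Δ Θ) : Iso Γ Θ where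
  vert := f.vert.trans ψ.vert
  leg := f.leg.trans ψ.leg
  kind_eq v := by simp [ψ.kind_eq, f.kind_eq]
  label_eq s := by simp [ψ.label_eq, f.label_eq]
  mate_eq e := by
    have h : ∀ (e : Flags 𝒱 Γ.kind ⊕ Γ.Leg) (hk : ∀ v,
        Θ.kind ((f.vert.trans ψ.vert) v) = Γ.kind v),
        Sum.map (Flags.map (f.vert.trans ψ.vert) hk) (f.leg.trans ψ.leg) e =
        Sum.map (Flags.map ψ.vert ψ.kind_eq) ψ.leg
          (Sum.map (Flags.map f.vert f.kind_eq) f.leg e) := by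
      intro e hk
      rcases e with e | e <;> rfl
    rw [h, h, ψ.mate_eq, f.mate_eq]

instance isoSetoid (𝒱 : VertexKinds) (L : Type*) : Setoid (Diagram 𝒱 L) where
  r Γ Δ := Nonempty (Iso Γ Δ)
  iseqv := ⟨fun Γ => ⟨Iso.refl Γ⟩, fun ⟨f⟩ => ⟨f.symm⟩, fun ⟨f⟩ ⟨ψ⟩ => ⟨f.trans ψ⟩⟩

/-- Relabeling of the legs. -/
def mapLabel {L' : Type*} (f : L → L') (Γ : Diagram 𝒱 L) : Diagram 𝒱 L' :=
  { Γ with label := fun s => f (Γ.label s) }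

/-- The empty diagram. -/
def empty (𝒱 : VertexKinds) (L : Type*) : Diagram 𝒱 L where
  Vert := Empty
  Leg := Empty
  finite_vert := inferInstance
  finite_leg := inferInstance
  kind := Empty.elim
  label := Empty.elim
  mate := id
  mate_mate _ := rfl
  mate_ne := by
    rintro (⟨⟨v, _⟩, _⟩ | s)
    · exact v.elim
    · exact s.elim

/-- The strut whose two ends are labeled `a` and `b`. -/
def strut (𝒱 : VertexKinds) {L : Type*} (a b : L) : Diagram 𝒱 L where
  Vert := Empty
  Leg := Bool
  finite_vert := inferInstance
  finite_leg := inferInstance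
  kind := Empty.elim
  label := fun s => if s then b else a
  mate := Sum.map id not
  mate_mate := by
    rintro (⟨⟨v, _⟩, _⟩ | s)
    · exact v.elim
    · simp
  mate_ne := by
    rintro (⟨⟨v, _⟩, _⟩ | s)
    · exact v.elim
    · simp

/-- The ends of the edges of a disjoint union are those of its two parts. -/
def unionEnds {V W S T : Type} (kV : V → 𝒱.Kind) (kW : W → 𝒱.Kind) :
    (Flags 𝒱 (Sum.elim kV kW) ⊕ (S ⊕ T)) ≃ (Flags 𝒱 kV ⊕ S) ⊕ (Flags 𝒱 kW ⊕ T) where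
  toFun
    | .inl ⟨(.inl v, i), h⟩ => .inl (.inl ⟨(v, i), h⟩)
    | .inl ⟨(.inr w, i), h⟩ => .inr (.inl ⟨(w, i), h⟩)
    | .inr (.inl s) => .inl (.inr s)
    | .inr (.inr t) => .inr (.inr t)
  invFun
    | .inl (.inl ⟨(v, i), h⟩) => .inl ⟨(.inl v, i), h⟩
    | .inr (.inl ⟨(w, i), h⟩) => .inl ⟨(.inr w, i), h⟩
    | .inl (.inr s) => .inr (.inl s)
    | .inr (.inr t) => .inr (.inr t)
  left_inv := by rintro (⟨⟨v | w, i⟩, h⟩ | s | t) <;> rfl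
  right_inv := by rintro ((⟨⟨v, i⟩, h⟩ | s) | ⟨⟨w, i⟩, h⟩ | t) <;> rfl

/-- Disjoint union of diagrams. -/
def union (Γ Δ : Diagram 𝒱 L) : Diagram 𝒱 L where
  Vert := Γ.Vert ⊕ Δ.Vert
  Leg := Γ.Leg ⊕ Δ.Leg
  finite_vert := by have := Γ.finite_vert; have := Δ.finite_vert; infer_instance
  finite_leg := by have := Γ.finite_leg; have := Δ.finite_leg; infer_instance
  kind := Sum.elim Γ.kind Δ.kind
  label := Sum.elim Γ.label Δ.label
  mate e := (unionEnds Γ.kind Δ.kind).symm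
    (Sum.map Γ.mate Δ.mate (unionEnds Γ.kind Δ.kind e))
  mate_mate e := by
    rw [Equiv.apply_symm_apply, Sum.map_map, Equiv.symm_apply_eq]
    have h1 : Γ.mate ∘ Γ.mate = id := funext Γ.mate_mate
    have h2 : Δ.mate ∘ Δ.mate = id := funext Δ.mate_mate
    rw [h1, h2, Sum.map_id_id, id]
  mate_ne e := by
    rw [Ne, Equiv.symm_apply_eq]
    rcases unionEnds Γ.kind Δ.kind e with e | e
    · simpa using Γ.mate_ne e
    · simpa using Δ.mate_ne e

/-! ### Gluing -/

theorem follow_reflect {E : Type*} (α g : E → E) (hα : ∀ e, α (α e) = e)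
    (hg : ∀ e, g (g e) = e) (n : ℕ) (q : E) :
    (α ∘ g)^[n] (g ((α ∘ g)^[n] q)) = g q := by
  induction n generalizing q with
  | zero => rfl
  | succ n ih =>
    rw [Function.iterate_succ_apply' (α ∘ g) n (g _), Function.iterate_succ_apply (α ∘ g) n q, ih]
    simp [hα, hg]

/-- If `α` is a perfect matching and `g` an involution, then a walk that starts at a fixed point
`p` of `g` and alternately uses `α` and `g` gets to a fixed point of `g` again. -/
theorem exists_return {E : Type*} [Finite E] (α g : E → E) (hα : ∀ e, α (α e) = e)
    (hg : ∀ e, g (g e) = e) (p : E) (hp : g p = p) :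
    ∃ n, 0 < n ∧ g ((α ∘ g)^[n] p) = (α ∘ g)^[n] p := by
  have hinj : Function.Injective (α ∘ g) :=
    (Function.Involutive.injective hα).comp (Function.Involutive.injective hg)
  obtain ⟨n, hn, h⟩ := hinj.mem_periodicPts p
  exact ⟨n, hn, by rw [h.eq, hp]⟩

open Classical in
/-- The fixed point of `g` at which the walk `p, α p, g (α p), α (g (α p)), …` (that starts at a
fixed point `p = g p` of `g`) first arrives. -/
def follow {E : Type*} [Finite E] (α g : E → E) (hα : ∀ e, α (α e) = e)
    (hg : ∀ e, g (g e) = e) (p : {e // g e = e}) : {e // g e = e} :=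
  ⟨(α ∘ g)^[Nat.find (exists_return α g hα hg p.1 p.2)] p.1,
    (Nat.find_spec (exists_return α g hα hg p.1 p.2)).2⟩

theorem follow_follow {E : Type*} [Finite E] (α g : E → E) (hα : ∀ e, α (α e) = e)
    (hg : ∀ e, g (g e) = e) (p : {e // g e = e}) :
    follow α g hα hg (follow α g hα hg p) = p := by
  classical
  set q := follow α g hα hg p with hq
  set n := Nat.find (exists_return α g hα hg p.1 p.2) with hn
  have hqn : q.1 = (α ∘ g)^[n] p.1 := by rw [hq, follow]
  have hback : (α ∘ g)^[n] q.1 = p.1 := by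
    have := follow_reflect α g hα hg n p.1
    rwa [← hqn, q.2, p.2] at this
  have hfind : Nat.find (exists_return α g hα hg q.1 q.2) = n := by
    rw [Nat.find_eq_iff]
    refine ⟨⟨(Nat.find_spec (exists_return α g hα hg p.1 p.2)).1, by rw [hback, p.2]⟩, ?_⟩
    rintro m hm ⟨hm0, hgm⟩
    have h1 : (α ∘ g)^[m] ((α ∘ g)^[n - m] p.1) = q.1 := by
      rw [← Function.iterate_add_apply, hqn]
      congr 1
      omega
    have h2 := follow_reflect α g hα hg m ((α ∘ g)^[n - m] p.1)
    rw [h1, q.2] at h2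
    rw [h2, hg] at hgm
    exact Nat.find_min (exists_return α g hα hg p.1 p.2) (m := n - m) (by omega)
      ⟨by omega, hgm.symm⟩
  apply Subtype.ext
  conv_lhs => rw [follow]
  simp only [hfind, hback]

theorem follow_ne {E : Type*} [Finite E] (α g : E → E) (hα : ∀ e, α (α e) = e)
    (hne : ∀ e, α e ≠ e) (hg : ∀ e, g (g e) = e) (p : {e // g e = e}) :
    follow α g hα hg p ≠ p := by
  classical
  intro h
  set n := Nat.find (exists_return α g hα hg p.1 p.2) with hn
  have hp : (α ∘ g)^[n] p.1 = p.1 := congrArg Subtype.val h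
  have hpos : 0 < n := (Nat.find_spec (exists_return α g hα hg p.1 p.2)).1
  rcases Nat.even_or_odd' n with ⟨m, hm | hm⟩
  · have h1 : (α ∘ g)^[m] ((α ∘ g)^[m] p.1) = p.1 := by
      rw [← Function.iterate_add_apply, ← two_mul, ← hm, hp]
    have h2 := follow_reflect α g hα hg m ((α ∘ g)^[m] p.1)
    rw [h1, p.2] at h2
    exact Nat.find_min (exists_return α g hα hg p.1 p.2) (m := m) (by omega)
      ⟨by omega, h2.symm⟩
  · have h1 : (α ∘ g)^[m + 1] ((α ∘ g)^[m] p.1) = p.1 := by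
      rw [← Function.iterate_add_apply, show m + 1 + m = n by omega, hp]
    have h2 := follow_reflect α g hα hg (m + 1) ((α ∘ g)^[m] p.1)
    rw [h1, p.2, Function.iterate_succ_apply'] at h2
    exact hne _ h2

/-- A way of gluing some of the legs of `Γ` in pairs: an involution of the set of legs. A leg is
glued to its image, unless it is a fixed point, in which case it stays as it is. -/
def Gluing (Γ : Diagram 𝒱 L) : Type := {g : Γ.Leg → Γ.Leg // ∀ s, g (g s) = s}

/-- The legs that are not glued. -/
def Gluing.Free {Γ : Diagram 𝒱 L} (g : Γ.Gluing) : Type := {s : Γ.Leg // g.1 s = s}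

/-- The ends of edges that remain after gluing. -/
def Gluing.freeEnds {Γ : Diagram 𝒱 L} (g : Γ.Gluing) :
    (Flags 𝒱 Γ.kind ⊕ g.Free) ≃
      {e : Flags 𝒱 Γ.kind ⊕ Γ.Leg // Sum.map id g.1 e = e} where
  toFun
    | .inl f => ⟨.inl f, rfl⟩
    | .inr s => ⟨.inr s.1, congrArg Sum.inr s.2⟩
  invFun
    | ⟨.inl f, _⟩ => .inl f
    | ⟨.inr s, h⟩ => .inr ⟨s, Sum.inr_injective h⟩
  left_inv := by rintro (f | s) <;> rfl
  right_inv := by rintro ⟨f | s, h⟩ <;> rfl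

/-- The result of gluing: legs that are glued disappear, and edges that end there are fused.
(Chains of struts that close up, which have no ends left, are not recorded: diagrams have no
components that are circles without vertices.) -/
def glue (Γ : Diagram 𝒱 L) (g : Γ.Gluing) : Diagram 𝒱 L :=
  have := Γ.finite_vert
  have := Γ.finite_leg
  have hg : ∀ e : Flags 𝒱 Γ.kind ⊕ Γ.Leg, Sum.map id g.1 (Sum.map id g.1 e) = e := by
    rintro (f | s)
    · rfl
    · simp [g.2]
  { Vert := Γ.Vert
    Leg := g.Free
    finite_vert := Γ.finite_vert
    finite_leg := Subtype.finite
    kind := Γ.kind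
    label := fun s => Γ.label s.1
    mate := fun e => g.freeEnds.symm (follow Γ.mate (Sum.map id g.1) Γ.mate_mate hg (g.freeEnds e))
    mate_mate := fun e => by
      rw [Equiv.apply_symm_apply, follow_follow, Equiv.symm_apply_apply]
    mate_ne := fun e h => by
      rw [Equiv.symm_apply_eq] at h
      exact follow_ne _ _ _ Γ.mate_ne _ _ h }

end Diagram

open Diagram

/-! ### Formal sums of diagrams -/

/-- Diagrams up to isomorphism. -/
abbrev DiagramClass (𝒱 : VertexKinds) (L : Type*) := Quotient (Diagram.isoSetoid 𝒱 L)

/-- Possibly infinite formal combinations of diagrams with coefficients in `k`. -/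
def FormalSum (k : Type*) (𝒱 : VertexKinds) (L : Type*) := DiagramClass 𝒱 L → k

namespace FormalSum

variable {k : Type*} [Field k] {𝒱 : VertexKinds} {L : Type*}

instance : AddCommGroup (FormalSum k 𝒱 L) := inferInstanceAs (AddCommGroup (DiagramClass 𝒱 L → k))

instance : Module k (FormalSum k 𝒱 L) := inferInstanceAs (Module k (DiagramClass 𝒱 L → k))

open Classical in
/-- A single diagram, with coefficient `1`. -/
def single (Γ : Diagram 𝒱 L) : FormalSum k 𝒱 L :=
  fun c => if (⟦Γ⟧ : DiagramClass 𝒱 L) = c then 1 else 0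

/-- The bilinear extension to formal sums of an operation on pairs of diagrams: `N Γ Δ c` is the
multiplicity of the diagram `c` in the result of the operation for `Γ` and `Δ`. (Isomorphic
diagrams give the same multiplicities, so the choice of representatives does not matter.) -/
def extend₂ (N : Diagram 𝒱 L → Diagram 𝒱 L → DiagramClass 𝒱 L → ℕ)
    (F G : FormalSum k 𝒱 L) : FormalSum k 𝒱 L :=
  fun c => ∑ᶠ p : DiagramClass 𝒱 L × DiagramClass 𝒱 L,
    F p.1 * G p.2 * (N p.1.out p.2.out c : k)

open Classical in
/-- The product of formal sums, the bilinear extension of disjoint union. -/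
def prod : FormalSum k 𝒱 L → FormalSum k 𝒱 L → FormalSum k 𝒱 L :=
  extend₂ fun Γ Δ c => if ⟦Γ.union Δ⟧ = c then 1 else 0

/-- Powers with respect to `prod`. -/
def power (F : FormalSum k 𝒱 L) : ℕ → FormalSum k 𝒱 L
  | 0 => single (Diagram.empty 𝒱 L)
  | n + 1 => prod F (power F n)

/-- The exponential `∑ Fⁿ / n!` with respect to `prod`. -/
def exp (F : FormalSum k 𝒱 L) : FormalSum k 𝒱 L :=
  fun c => ∑ᶠ n : ℕ, (Nat.factorial n : k)⁻¹ * power F n c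

end FormalSum

/-! ### Internal relations -/

/-- An internal relation: a linear combination of strutless diagrams of the same degree with the
same legs, numbered `0, …, n - 1`, to be set equal to `0` wherever it occurs inside diagrams. -/
structure InternalRelation (k : Type*) [Field k] (𝒱 : VertexKinds) where
  n : ℕ
  deg : ℕ
  comb : Diagram 𝒱 (Fin n) →₀ k
  legs : ∀ Γ ∈ comb.support, Function.Bijective Γ.label
  strutless : ∀ Γ ∈ comb.support, ∀ s t : Γ.Leg, Γ.mate (.inr s) ≠ .inr t
  degree_eq : ∀ Γ ∈ comb.support, Γ.degree = deg

/-- `Δ` is the result of inserting `Γ` in the context `C`: gluing the legs of `Γ` to the legs of `C`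
that are labeled by their numbers. -/
def IsInsertion {𝒱 : VertexKinds} {L : Type*} {n : ℕ} (Γ : Diagram 𝒱 (Fin n))
    (C : Diagram 𝒱 (Fin n ⊕ L)) (Δ : Diagram 𝒱 L) : Prop :=
  ∃ g : ((Γ.mapLabel Sum.inl).union C).Gluing,
    (∀ s : Γ.Leg, ∃ t : C.Leg, C.label t = .inl (Γ.label s) ∧ g.1 (.inl s) = .inr t) ∧
    (∀ t : C.Leg, ∀ i, C.label t = .inl i → ∃ s : Γ.Leg, g.1 (.inr t) = .inl s) ∧
    (∀ t : C.Leg, ∀ a, C.label t = .inr a → g.1 (.inr t) = .inr t) ∧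
    ((((Γ.mapLabel Sum.inl).union C).glue g) ≈ Δ.mapLabel Sum.inr)

/-- The span of all consequences of the relations in `ℛ` for diagrams with legs labeled by `L`. -/
def relationSpan {k : Type*} [Field k] {𝒱 : VertexKinds} (ℛ : Set (InternalRelation k 𝒱))
    (L : Type*) : Submodule k (FormalSum k 𝒱 L) :=
  Submodule.span k {F | ∃ ρ ∈ ℛ, ∃ (C : Diagram 𝒱 (Fin ρ.n ⊕ L))
    (Δ : Diagram 𝒱 (Fin ρ.n) → Diagram 𝒱 L),
    (∀ Γ ∈ ρ.comb.support, IsInsertion Γ C (Δ Γ)) ∧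
    F = ρ.comb.sum fun Γ a => a • FormalSum.single (Δ Γ)}

/-- Equality of formal sums modulo the internal relations `ℛ`: on any finite set of diagrams, the
difference agrees with a combination of consequences of relations. -/
def EqMod {k : Type*} [Field k] {𝒱 : VertexKinds} {L : Type*} (ℛ : Set (InternalRelation k 𝒱))
    (F F' : FormalSum k 𝒱 L) : Prop :=
  ∀ T : Finset (DiagramClass 𝒱 L), ∃ r ∈ relationSpan ℛ L, ∀ c ∈ T, F c - F' c = r c

/-! ### Functions and differential operators -/

/-- The labels of legs: a variable `x` or its dual `∂_x`. -/
inductive LegLabel (Var : Type*)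
  | var (x : Var)
  | dual (x : Var)

namespace FormalSum

variable {k : Type*} [Field k] {𝒱 : VertexKinds} {Var : Type*}

/-- All legs are labeled by variables (rather than dual variables). -/
def IsFunction (F : FormalSum k 𝒱 (LegLabel Var)) : Prop :=
  ∀ Γ : Diagram 𝒱 (LegLabel Var), F ⟦Γ⟧ ≠ 0 → ∀ s, ∃ x, Γ.label s = .var x

/-- A differential operator with respect to `z`, of order `l`: each diagram has `l` legs labeled
`∂_z`, and all of its other legs are labeled by variables (`z` or others). -/
def IsOperator (z : Var) (l : ℕ) (D : FormalSum k 𝒱 (LegLabel Var)) : Prop :=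
  ∀ Γ : Diagram 𝒱 (LegLabel Var), D ⟦Γ⟧ ≠ 0 →
    (∀ s x, Γ.label s = .dual x → x = z) ∧ Nat.card {s // Γ.label s = .dual z} = l

/-- No struts both of whose ends are labeled by members of `X` or their duals. -/
def IsSubstantial (X : Finset Var) (F : FormalSum k 𝒱 (LegLabel Var)) : Prop :=
  ∀ Γ : Diagram 𝒱 (LegLabel Var), F ⟦Γ⟧ ≠ 0 → ∀ s t : Γ.Leg, Γ.mate (.inr s) = .inr t →
    ¬ ((∃ x ∈ X, Γ.label s = .var x ∨ Γ.label s = .dual x) ∧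
       (∃ y ∈ X, Γ.label t = .var y ∨ Γ.label t = .dual y))

end FormalSum

/-- Gluings in which all legs of `D` labeled by dual variables `∂_x` (for all `x`) are glued to legs
of `f` labeled by the corresponding variables `x`, and nothing else is glued. -/
def IsApplyGluing {𝒱 : VertexKinds} {Var : Type*} (D f : Diagram 𝒱 (LegLabel Var))
    (g : (D.union f).Gluing) : Prop :=
  (∀ s : D.Leg, ∀ x, D.label s = .dual x → ∃ t : f.Leg, f.label t = .var x ∧ g.1 (.inl s) = .inr t) ∧
  (∀ s : D.Leg, ∀ x, D.label s = .var x → g.1 (.inl s) = .inl s) ∧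
  (∀ t : f.Leg, g.1 (.inr t) = .inr t ∨ ∃ s : D.Leg, g.1 (.inr t) = .inl s)

/-- Gluings of `Γ` to itself in which all legs labeled `∂_z` are glued to legs labeled `z`, and
nothing else is glued. -/
def IsDivGluing {𝒱 : VertexKinds} {Var : Type*} (z : Var) (Γ : Diagram 𝒱 (LegLabel Var))
    (g : Γ.Gluing) : Prop :=
  (∀ s, Γ.label s = .dual z → Γ.label (g.1 s) = .var z) ∧
  (∀ s, Γ.label s ≠ .dual z → g.1 s = s ∨ Γ.label (g.1 s) = .dual z)

namespace FormalSum

variable {k : Type*} [Field k] {𝒱 : VertexKinds} {Var : Type*}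

/-- `D ▷ F`: the sum of all ways of gluing all legs of `D` labeled by dual variables to some or all
of the legs of `F` labeled by the corresponding variables. -/
def apply : FormalSum k 𝒱 (LegLabel Var) → FormalSum k 𝒱 (LegLabel Var) →
    FormalSum k 𝒱 (LegLabel Var) :=
  extend₂ fun D f c =>
    Nat.card {g : (D.union f).Gluing // IsApplyGluing D f g ∧ ⟦(D.union f).glue g⟧ = c}

/-- The pairing `⟨D, P⟩_X`: the sum of all ways of gluing all legs of `D` labeled by dual variables to
all of the legs of `P` that are labeled by members of `X`. (It is used for `D` whose dual
variables are all in `X`.) -/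
def pairing (X : Finset Var) : FormalSum k 𝒱 (LegLabel Var) → FormalSum k 𝒱 (LegLabel Var) →
    FormalSum k 𝒱 (LegLabel Var) :=
  extend₂ fun D f c =>
    Nat.card {g : (D.union f).Gluing // IsApplyGluing D f g ∧
      (∀ t : f.Leg, ∀ x ∈ X, f.label t = .var x → g.1 (.inr t) ≠ .inr t) ∧
      ⟦(D.union f).glue g⟧ = c}

/-- The divergence `div_z D`: the sum of all ways of gluing all legs labeled `∂_z` to some or all of
the legs labeled `z` of the same diagram. -/
def divergence (z : Var) (D : FormalSum k 𝒱 (LegLabel Var)) : FormalSum k 𝒱 (LegLabel Var) :=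
  fun c => ∑ᶠ a : DiagramClass 𝒱 (LegLabel Var), D a *
    (Nat.card {g : a.out.Gluing // IsDivGluing z a.out g ∧ ⟦a.out.glue g⟧ = c} : k)

/-- The quadratic `∑ l_xy (x — y)`, the sum over `x, y ∈ X`. -/
def quadratic (𝒱 : VertexKinds) {X : Finset Var} (Λ : Matrix X X k) :
    FormalSum k 𝒱 (LegLabel Var) :=
  ∑ x : X, ∑ y : X, Λ x y • single (Diagram.strut 𝒱 (.var x.1) (.var y.1))

/-- The same in the dual variables: `∑ m_xy (∂_x — ∂_y)`. -/
def dualQuadratic (𝒱 : VertexKinds) {X : Finset Var} (M : Matrix X X k) :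
    FormalSum k 𝒱 (LegLabel Var) :=
  ∑ x : X, ∑ y : X, M x y • single (Diagram.strut 𝒱 (.dual x.1) (.dual y.1))

open Classical in
/-- `G = P · exp (Q / 2)` is a non-degenerate Gaussian with respect to `X`, with covariance matrix
`Λ` (modulo the internal relations `ℛ`). -/
structure IsGaussianWith (ℛ : Set (InternalRelation k 𝒱)) (X : Finset Var)
    (G P : FormalSum k 𝒱 (LegLabel Var)) (Λ : Matrix X X k) : Prop where
  symm : Λ.IsSymm
  nondegenerate : IsUnit Λ
  isFunction : P.IsFunction
  substantial : P.IsSubstantial X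
  eq : EqMod ℛ G (prod P (exp ((1 / 2 : k) • quadratic 𝒱 Λ)))

/-- `G` is a non-degenerate Gaussian with respect to `X`. -/
def IsNondegenerateGaussian (ℛ : Set (InternalRelation k 𝒱)) (X : Finset Var)
    (G : FormalSum k 𝒱 (LegLabel Var)) : Prop :=
  ∃ P Λ, IsGaussianWith ℛ X G P Λ

open Classical in
/-- `I` is the formal Gaussian integral of `G` with respect to `X`: `G` can be written as a
non-degenerate Gaussian `P · exp (Q / 2)`, and `I = ⟨exp (-Q⁻¹ / 2), P⟩_X`
(modulo the internal relations `ℛ`). -/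
def HasGaussianIntegral (ℛ : Set (InternalRelation k 𝒱)) (X : Finset Var)
    (G I : FormalSum k 𝒱 (LegLabel Var)) : Prop :=
  ∃ P Λ, IsGaussianWith ℛ X G P Λ ∧
    EqMod ℛ I (pairing X (exp (-(1 / 2 : k) • dualQuadratic 𝒱 Λ⁻¹)) P)

end FormalSum

end FormalDiagram

end

-- The theorem is integration by parts, carried out on diagrams. Suppose that an operator acts on `P
-- · exp (Q / 2)`. A leg `∂_z` of it is glued either to a `z`-leg of `P` or to a strut of the
-- exponential. In the second case the leg gets the label `y` of the other end of the strut instead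
-- of `∂_z`, with coefficient `l_zy`, and the remaining struts form the same exponential again; if
-- `y = z`, the relabeled leg may in turn be the target of another leg `∂_z`. When the result is
-- integrated, a leg labeled `y` is joined to legs labeled `y'` with coefficient `-l^{yy'}`. As the
-- two matrices are inverse to each other, both steps together join the original leg to every other
-- `z`-leg, with coefficient `-1`. The `z`-legs that come from `P` or from struts then cancel
-- against the direct gluings. What is left is to join the leg to a `z`-leg of the operator itself,
-- and this is the divergence, with one sign for each leg `∂_z`.
--
-- The induction over the legs `∂_z` of a single diagram is `exists_applyTerm_eq_prod`. Its state
-- consists of the set `A` of legs still to be glued, the gluing `g` made so far, the current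
-- labels, and the set `Z` of the targets that count as part of the function. One step rests on
-- `lsum_applyTerm_insert` (a derivative acts on the function or on the exponential),
-- `sum_lsum_pairTerm_update` (the two inverse matrices, by way of the Wick expansion
-- `lsum_pairTerm`) and `sum_divAdm_insert` (the cancellation). Diagrams that arise from different
-- orders of gluing are compared by `glue_iso`, which describes the edges of a glued diagram by what
-- can be reached along edges and gluings.
--
-- The passage to infinite sums uses operators each of whose coefficients is a finite linear
-- combination of coefficients of the argument (`IsFinitary`); these are determined by their values
-- on single diagrams. Gluing does not change the vertices, so finiteness amounts to a bound on the
-- number and the labels of the legs. For the pairing this bound comes from the absence of struts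
-- over `X`.
--
-- It remains to see that the choice of `P` and `Q` does not matter modulo the relations. Inserting
-- a diagram in a context commutes with gluing other legs of the context (`Inserts.glue`), so all
-- operations respect the relations; and since relations are strutless, they preserve the struts
-- (`Inserts.mate_iff`). Now `P` is the substantial part of the Gaussian (`restrict_prod_exp`).
-- Removal of a strut `x — y` from the Gaussian has a substantial part proportional to `l_xy · P`,
-- with a nonzero constant (`restrict_removeStrut_prod_exp`). If two presentations have different
-- matrices, it follows that `P` vanishes modulo the relations, and then so do both integrals
-- (`IsGaussianWith.eqMod_integral`).

attribute [reducible] FormalDiagram.Diagram.Gluing FormalDiagram.Diagram.Gluing.Free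
  FormalDiagram.Diagram.union FormalDiagram.Diagram.glue FormalDiagram.Diagram.mapLabel
  FormalDiagram.Diagram.strut FormalDiagram.Diagram.empty

noncomputable section

namespace FormalDiagram

open Relation

namespace Diagram

variable {𝒱 : VertexKinds} {L : Type*}

/-! ### Walks along edges and gluings -/

/-- `q` is reached from `p` by steps along `α` and `g`. -/
def Walk {E : Type*} (α g : E → E) : E → E → Prop :=
  ReflTransGen fun a b => b = α a ∨ b = g a

theorem Walk.refl {E : Type*} {α g : E → E} (a : E) : Walk α g a a := ReflTransGen.refl

theorem Walk.trans {E : Type*} {α g : E → E} {a b c : E} (h : Walk α g a b) (h' : Walk α g b c) :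
    Walk α g a c := ReflTransGen.trans h h'

theorem Walk.left {E : Type*} {α g : E → E} (a : E) : Walk α g a (α a) :=
  ReflTransGen.single (Or.inl rfl)

theorem Walk.right {E : Type*} {α g : E → E} (a : E) : Walk α g a (g a) :=
  ReflTransGen.single (Or.inr rfl)

/-- A single step may become a walk of any length, also of length zero; so edges may be subdivided
or contracted by `φ`. -/
theorem Walk.map {E F : Type*} {α g : E → E} {β h : F → F} (φ : E → F)
    (hα : ∀ a, Walk β h (φ a) (φ (α a))) (hg : ∀ a, Walk β h (φ a) (φ (g a))) {a b : E}
    (w : Walk α g a b) : Walk β h (φ a) (φ b) := by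
  induction w with
  | refl => exact Walk.refl _
  | tail _ h2 ih =>
    rcases h2 with rfl | rfl
    · exact ih.trans (hα _)
    · exact ih.trans (hg _)

theorem walk_follow {E : Type*} [Finite E] (α g : E → E) (hα : ∀ e, α (α e) = e)
    (hg : ∀ e, g (g e) = e) (p : {e // g e = e}) :
    Walk α g p.1 (follow α g hα hg p).1 := by
  have key : ∀ n, Walk α g p.1 ((α ∘ g)^[n] p.1) := by
    intro n
    induction n with
    | zero => exact Walk.refl _
    | succ n ih =>
      rw [Function.iterate_succ_apply']
      exact (ih.trans (Walk.right _)).trans (Walk.left _)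
  exact key _

/-- The fixed points of `g` that can be reached from `p` are `p` and `follow p`. -/
theorem follow_eq_of_walk {E : Type*} [Finite E] (α g : E → E) (hα : ∀ e, α (α e) = e)
    (hg : ∀ e, g (g e) = e) (p q : {e // g e = e}) (hpq : q ≠ p) (w : Walk α g p.1 q.1) :
    follow α g hα hg p = q := by
  classical
  set n := Nat.find (exists_return α g hα hg p.1 p.2) with hn
  have hspec := Nat.find_spec (exists_return α g hα hg p.1 p.2)
  have hmin := fun m => Nat.find_min (exists_return α g hα hg p.1 p.2) (m := m)
  rw [← hn] at hspec
  -- The points of the path from `p` to `follow p`, together with their images under `g`, are closed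
  -- under both kinds of steps: the path cannot be left at its ends, because these are fixed by `g`.
  have key : ∃ i ≤ n, q.1 = (α ∘ g)^[i] p.1 ∨ q.1 = g ((α ∘ g)^[i] p.1) := by
    have h0 := w
    generalize q.1 = x at h0
    induction h0 with
    | refl => exact ⟨0, Nat.zero_le _, Or.inl rfl⟩
    | tail _ h2 ih =>
      obtain ⟨i, hi, rfl | rfl⟩ := ih
      · rcases h2 with rfl | rfl
        · cases i with
          | zero =>
            refine ⟨1, hspec.1, Or.inl ?_⟩
            simp [p.2]
          | succ i =>
            refine ⟨i, by omega, Or.inr ?_⟩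
            rw [Function.iterate_succ_apply']
            simp [hα]
        · exact ⟨i, hi, Or.inr rfl⟩
      · rcases h2 with rfl | rfl
        · rcases Nat.lt_or_ge i n with h | h
          · exact ⟨i + 1, h, Or.inl (by rw [Function.iterate_succ_apply']; rfl)⟩
          · have : i = n := le_antisymm hi h
            subst this
            rw [hspec.2]
            obtain ⟨m, hm⟩ := Nat.exists_eq_succ_of_ne_zero hspec.1.ne'
            refine ⟨m, by omega, Or.inr ?_⟩
            rw [hm, Function.iterate_succ_apply']
            simp [hα]
        · exact ⟨i, hi, Or.inl (hg _)⟩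
  obtain ⟨i, hi, h⟩ := key
  have h : q.1 = (α ∘ g)^[i] p.1 := by
    rcases h with h | h
    · exact h
    · rw [← q.2, h, hg]
  have hfix : g ((α ∘ g)^[i] p.1) = (α ∘ g)^[i] p.1 := by rw [← h, q.2]
  have hin : i = n := by
    rcases Nat.eq_zero_or_pos i with rfl | h0
    · exact absurd (Subtype.ext h) hpq
    · by_contra hne
      exact hmin i (by omega) ⟨h0, hfix⟩
  apply Subtype.ext
  rw [h, hin]
  rfl

/-! ### Isomorphisms of glued diagrams -/

/-- The ends of the edges of a diagram. -/
abbrev Ends (Γ : Diagram 𝒱 L) : Type := Flags 𝒱 Γ.kind ⊕ Γ.Leg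

/-- Involutions of a type. -/
abbrev Invol (T : Type) : Type := {g : T → T // ∀ s, g (g s) = s}

instance (Γ : Diagram 𝒱 L) : Finite Γ.Leg := Γ.finite_leg

instance (Γ : Diagram 𝒱 L) : Finite Γ.Vert := Γ.finite_vert

/-- The walks along the edges of `Γ` and across the gluing `g`. -/
abbrev GlueWalk (Γ : Diagram 𝒱 L) (g : Invol Γ.Leg) : Γ.Ends → Γ.Ends → Prop :=
  Walk Γ.mate (Sum.map id g.1)

/-- The map of ends induced by maps of vertices and legs. -/
def endsMap {L' : Type*} {Δ : Diagram 𝒱 L'} {Γ : Diagram 𝒱 L} (vert : Δ.Vert → Γ.Vert)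
    (kind_eq : ∀ v, Γ.kind (vert v) = Δ.kind v) (leg : Δ.Leg → Γ.Leg) : Δ.Ends → Γ.Ends :=
  Sum.map (Flags.map vert kind_eq) leg

theorem endsMap_injective {L' : Type*} {Δ : Diagram 𝒱 L'} {Γ : Diagram 𝒱 L}
    {vert : Δ.Vert → Γ.Vert} (kind_eq : ∀ v, Γ.kind (vert v) = Δ.kind v) {leg : Δ.Leg → Γ.Leg}
    (hv : Function.Injective vert) (hl : Function.Injective leg) :
    Function.Injective (endsMap vert kind_eq leg) := by
  refine Function.Injective.sumMap ?_ hl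
  rintro ⟨⟨v, i⟩, h⟩ ⟨⟨w, j⟩, h'⟩ e
  have e' := congrArg Subtype.val e
  simp only [Flags.map, Prod.mk.injEq] at e'
  exact Subtype.ext (Prod.ext (hv e'.1) e'.2)

theorem glue_mate_walk (Γ : Diagram 𝒱 L) (g : Invol Γ.Leg) (e : (Γ.glue g).Ends) :
    Γ.GlueWalk g (endsMap (Δ := Γ.glue g) (Γ := Γ) id (fun _ => rfl) Subtype.val e)
      (endsMap (Δ := Γ.glue g) (Γ := Γ) id (fun _ => rfl) Subtype.val ((Γ.glue g).mate e)) := by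
  have hval : ∀ e : (Γ.glue g).Ends,
      endsMap (Δ := Γ.glue g) (Γ := Γ) id (fun _ => rfl) Subtype.val e =
        (Gluing.freeEnds (Γ := Γ) g e).1 := by
    rintro (e | e) <;> rfl
  rw [hval, hval]
  have : Gluing.freeEnds (Γ := Γ) g ((Γ.glue g).mate e) = _ := Equiv.apply_symm_apply _ _
  rw [this]
  exact walk_follow _ _ _ _ _

/-- Together with `glue_mate_walk` this characterizes the edges after gluing, with no need to unfold
`follow`: the mate of a remaining end is the only other remaining end that can be reached from it.
-/
theorem glue_mate_eq_of_walk (Γ : Diagram 𝒱 L) (g : Invol Γ.Leg) (e e' : (Γ.glue g).Ends)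
    (hne : e' ≠ e)
    (w : Γ.GlueWalk g (endsMap (Δ := Γ.glue g) (Γ := Γ) id (fun _ => rfl) Subtype.val e)
      (endsMap (Δ := Γ.glue g) (Γ := Γ) id (fun _ => rfl) Subtype.val e')) :
    (Γ.glue g).mate e = e' := by
  have hval : ∀ e : (Γ.glue g).Ends,
      endsMap (Δ := Γ.glue g) (Γ := Γ) id (fun _ => rfl) Subtype.val e =
        (Gluing.freeEnds (Γ := Γ) g e).1 := by
    rintro (e | e) <;> rfl
  rw [hval, hval] at w
  refine ((Gluing.freeEnds (Γ := Γ) g).symm_apply_eq).2 ?_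
  exact follow_eq_of_walk _ _ _ _ _ _ (fun h => hne ((Gluing.freeEnds (Γ := Γ) g).injective h)) w

/-- A comparison of glued diagrams: it suffices to map vertices bijectively and legs in such a way
that edges and gluings go to walks, and free legs go bijectively to free legs. -/
theorem glue_iso {Γ Δ : Diagram 𝒱 L} (g : Invol Γ.Leg) (h : Invol Δ.Leg)
    (vert : Δ.Vert ≃ Γ.Vert) (kind_eq : ∀ v, Γ.kind (vert v) = Δ.kind v) (leg : Δ.Leg → Γ.Leg)
    (free : ∀ s, h.1 s = s → g.1 (leg s) = leg s)
    (inj : ∀ s t, h.1 s = s → h.1 t = t → leg s = leg t → s = t)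
    (surj : ∀ t, g.1 t = t → ∃ s, h.1 s = s ∧ leg s = t)
    (label_eq : ∀ s, h.1 s = s → Γ.label (leg s) = Δ.label s)
    (edge : ∀ e, Γ.GlueWalk g (endsMap vert kind_eq leg e) (endsMap vert kind_eq leg (Δ.mate e)))
    (glued : ∀ s, h.1 s ≠ s → Γ.GlueWalk g (.inr (leg s)) (.inr (leg (h.1 s)))) :
    Nonempty (Iso (Δ.glue h) (Γ.glue g)) := by
  let lf : (Δ.glue h).Leg → (Γ.glue g).Leg := fun s => ⟨leg s.1, free s.1 s.2⟩
  have hlf : Function.Bijective lf := by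
    constructor
    · rintro ⟨s, hs⟩ ⟨t, ht⟩ e
      exact Subtype.ext (inj s t hs ht (congrArg Subtype.val e))
    · rintro ⟨t, ht⟩
      obtain ⟨s, hs, rfl⟩ := surj t ht
      exact ⟨⟨s, hs⟩, rfl⟩
  refine ⟨{ vert := vert, leg := Equiv.ofBijective lf hlf, kind_eq := kind_eq,
            label_eq := fun s => label_eq s.1 s.2, mate_eq := fun e => ?_ }⟩
  refine glue_mate_eq_of_walk Γ g _ _ ?_ ?_
  · intro e'
    exact (Δ.glue h).mate_ne e
      (endsMap_injective (Δ := Δ.glue h) (Γ := Γ.glue g) kind_eq vert.injective hlf.injective e')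
  · have hcomp : ∀ e : (Δ.glue h).Ends,
        endsMap (Δ := Γ.glue g) (Γ := Γ) id (fun _ => rfl) Subtype.val
          (Sum.map (Flags.map (kV := Δ.kind) (kW := Γ.kind) vert kind_eq) lf e) =
        endsMap vert kind_eq leg
          (endsMap (Δ := Δ.glue h) (Γ := Δ) id (fun _ => rfl) Subtype.val e) := by
      rintro (e | e) <;> rfl
    have w := (glue_mate_walk Δ h e).map (β := Γ.mate) (h := Sum.map id g.1)
      (endsMap vert kind_eq leg) edge (by
        rintro (f | s)
        · exact Walk.refl _
        · by_cases hs : h.1 s = s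
          · change Walk _ _ (Sum.inr (leg s)) (Sum.inr (leg (h.1 s)))
            rw [hs]
            exact Walk.refl _
          · exact glued s hs)
    rw [← hcomp, ← hcomp] at w
    exact w

end Diagram

end FormalDiagram

end

noncomputable section

namespace FormalDiagram

open Classical Diagram

/-! ### Transport of involutions -/

instance Invol.fintype {T : Type} [Finite T] : Fintype (Invol T) := Fintype.ofFinite _

namespace Invol

variable {T T' : Type}

/-- The involution that corresponds to `h` on the range of `φ` and is `G` off the range. -/
def extend (φ : T → T') (G : T' → T') (h : T → T) (t : T') : T' :=
  if H : ∃ s, φ s = t then φ (h H.choose) else G t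

theorem extend_apply {φ : T → T'} (hφ : Function.Injective φ) (G : T' → T') (h : T → T) (s : T) :
    extend φ G h (φ s) = φ (h s) := by
  have H : ∃ s', φ s' = φ s := ⟨s, rfl⟩
  rw [extend, dif_pos H, hφ H.choose_spec]

theorem extend_off (φ : T → T') (G : T' → T') (h : T → T) {t : T'} (ht : ∀ s, φ s ≠ t) :
    extend φ G h t = G t := by
  rw [extend, dif_neg]
  rintro ⟨s, hs⟩
  exact ht s hs

/-- The involution `G` preserves the range of `φ`, hence also its complement, so that the two pieces
do not interfere. -/
theorem extend_extend {φ : T → T'} (hφ : Function.Injective φ) (G : Invol T')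
    (hG : ∀ s, ∃ s', G.1 (φ s) = φ s') (h : Invol T) (t : T') :
    extend φ G.1 h.1 (extend φ G.1 h.1 t) = t := by
  by_cases H : ∃ s, φ s = t
  · obtain ⟨s, rfl⟩ := H
    rw [extend_apply hφ, extend_apply hφ, h.2]
  · push Not at H
    rw [extend_off φ _ _ H, extend_off, G.2]
    intro s hs
    obtain ⟨s', hs'⟩ := hG s
    rw [hs, G.2] at hs'
    exact H s' hs'.symm

/-- Sums over involutions of `T` are sums over those involutions of `T'` that are given by `G` off
the range of an injection `T → T'`. -/
theorem sum_extend [Finite T] [Finite T'] {M : Type*} [AddCommMonoid M] {φ : T → T'}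
    (hφ : Function.Injective φ) (G : Invol T') (hG : ∀ s, ∃ s', G.1 (φ s) = φ s')
    (P : Invol T → Prop) (P' : Invol T' → Prop) (X : Invol T → M) (X' : Invol T' → M)
    (off : ∀ h, P' h → ∀ t, (∀ s, φ s ≠ t) → h.1 t = G.1 t)
    (iff : ∀ (h : Invol T) (h' : Invol T'), (∀ s, h'.1 (φ s) = φ (h.1 s)) →
      (∀ t, (∀ s, φ s ≠ t) → h'.1 t = G.1 t) → (P h ↔ P' h'))
    (eq : ∀ (h : Invol T) (h' : Invol T'), (∀ s, h'.1 (φ s) = φ (h.1 s)) →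
      (∀ t, (∀ s, φ s ≠ t) → h'.1 t = G.1 t) → P h → X h = X' h') :
    ∑ h with P h, X h = ∑ h with P' h, X' h := by
  have hon := fun h : Invol T => extend_apply hφ G.1 h.1
  have hoff := fun (h : Invol T) (t : T') (ht : ∀ s, φ s ≠ t) => extend_off φ G.1 h.1 ht
  refine Finset.sum_bij (fun h _ => ⟨extend φ G.1 h.1, extend_extend hφ G hG h⟩) ?_ ?_ ?_ ?_
  · intro h hh
    simp only [Finset.mem_filter, Finset.mem_univ, true_and] at hh ⊢
    exact (iff _ _ (hon h) (hoff h)).1 hh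
  · intro h _ h' _ e
    refine Subtype.ext (funext fun s => hφ ?_)
    rw [← hon, ← hon]
    exact congrFun (congrArg Subtype.val e) _
  · intro h' hh'
    simp only [Finset.mem_filter, Finset.mem_univ, true_and] at hh'
    have hoff' := off h' hh'
    -- An involution that agrees with `G` off the range preserves the range, and therefore restricts
    -- to an involution of `T`.
    have hcl : ∀ s, ∃ s', h'.1 (φ s) = φ s' := by
      intro s
      by_contra hc
      push Not at hc
      have h1 := hoff' (h'.1 (φ s)) fun s' e => hc s' e.symm
      rw [h'.2] at h1
      obtain ⟨s', hs'⟩ := hG s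
      have h2 := congrArg G.1 h1
      rw [G.2] at h2
      exact hc s' (h2.symm.trans hs')
    choose h0 hh0 using hcl
    have hinv : ∀ s, h0 (h0 s) = s := fun s => hφ (by rw [← hh0, ← hh0, h'.2])
    have e : (⟨extend φ G.1 h0, extend_extend hφ G hG ⟨h0, hinv⟩⟩ : Invol T') = h' := by
      refine Subtype.ext (funext fun t => ?_)
      by_cases H : ∃ s, φ s = t
      · obtain ⟨s, rfl⟩ := H
        exact (extend_apply hφ _ _ _).trans (hh0 s).symm
      · push Not at H
        exact (extend_off φ _ _ H).trans (hoff' t H).symm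
    refine ⟨⟨h0, hinv⟩, ?_, e⟩
    simp only [Finset.mem_filter, Finset.mem_univ, true_and]
    exact (iff ⟨h0, hinv⟩ h' hh0 hoff').2 hh'
  · intro h hh
    simp only [Finset.mem_filter, Finset.mem_univ, true_and] at hh
    exact eq _ _ (hon h) (hoff h) hh

/-- The trivial involution. -/
def one (T : Type) : Invol T := ⟨id, fun _ => rfl⟩

end Invol

/-! ### Linear algebra of formal sums -/

namespace FormalSum

variable {k : Type*} [Field k] {𝒱 : VertexKinds} {L : Type*}

@[simp] theorem add_apply (F G : FormalSum k 𝒱 L) (c) : (F + G) c = F c + G c := rfl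
@[simp] theorem sub_apply (F G : FormalSum k 𝒱 L) (c) : (F - G) c = F c - G c := rfl
@[simp] theorem smul_apply (a : k) (F : FormalSum k 𝒱 L) (c) : (a • F) c = a * F c := rfl
@[simp] theorem zero_apply (c) : (0 : FormalSum k 𝒱 L) c = 0 := rfl

@[simp] theorem sum_apply {ι : Type*} (s : Finset ι) (F : ι → FormalSum k 𝒱 L) (c) :
    (∑ i ∈ s, F i) c = ∑ i ∈ s, F i c :=
  Finset.sum_apply (M := fun _ : DiagramClass 𝒱 L => k) c s F

theorem single_apply (Γ : Diagram 𝒱 L) (c) :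
    (single Γ : FormalSum k 𝒱 L) c = if (⟦Γ⟧ : DiagramClass 𝒱 L) = c then 1 else 0 := rfl

theorem single_congr {Γ Δ : Diagram 𝒱 L} (h : Nonempty (Iso Γ Δ)) :
    (single Γ : FormalSum k 𝒱 L) = single Δ := by
  have : (⟦Γ⟧ : DiagramClass 𝒱 L) = ⟦Δ⟧ := Quotient.sound h
  funext c
  rw [single_apply, single_apply, this]

/-- The pairing of a formal sum with finite combinations of diagrams. -/
def eval (F : FormalSum k 𝒱 L) : (DiagramClass 𝒱 L →₀ k) →ₗ[k] k :=
  Finsupp.linearCombination k (show DiagramClass 𝒱 L → k from F)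

theorem eval_apply (F : FormalSum k 𝒱 L) (κ : DiagramClass 𝒱 L →₀ k) :
    eval F κ = ∑ a ∈ κ.support, F a * κ a :=
  (Finsupp.linearCombination_apply k κ).trans (Finset.sum_congr rfl fun _ _ => mul_comm _ _)

theorem eval_single (F : FormalSum k 𝒱 L) (c) (x : k) : eval F (Finsupp.single c x) = F c * x :=
  (Finsupp.linearCombination_single k x c).trans (mul_comm _ _)

/-- Operators whose value at any diagram is a finite combination of coefficients of the argument. -/
def IsFinitary (Φ : FormalSum k 𝒱 L → FormalSum k 𝒱 L) : Prop :=
  ∀ c, ∃ κ : DiagramClass 𝒱 L →₀ k, ∀ F, Φ F c = eval F κ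

namespace IsFinitary

variable {Φ Ψ : FormalSum k 𝒱 L → FormalSum k 𝒱 L}

theorem comp (hΦ : IsFinitary Φ) (hΨ : IsFinitary Ψ) : IsFinitary fun F => Φ (Ψ F) := by
  intro c
  obtain ⟨κ, hκ⟩ := hΦ c
  choose μ hμ using hΨ
  refine ⟨κ.sum fun a x => x • μ a, fun F => ?_⟩
  beta_reduce
  rw [hκ, eval_apply, Finsupp.sum, map_sum]
  refine Finset.sum_congr rfl fun a _ => ?_
  rw [map_smul, hμ, smul_eq_mul, mul_comm]

theorem smul (a : k) (hΦ : IsFinitary Φ) : IsFinitary fun F => a • Φ F := by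
  intro c
  obtain ⟨κ, hκ⟩ := hΦ c
  exact ⟨a • κ, fun F => by beta_reduce; rw [map_smul, smul_apply, hκ, smul_eq_mul]⟩

theorem map_add (hΦ : IsFinitary Φ) (F G) : Φ (F + G) = Φ F + Φ G := by
  funext c
  obtain ⟨κ, hκ⟩ := hΦ c
  rw [add_apply, hκ, hκ, hκ]
  simp only [eval_apply, add_apply, add_mul, Finset.sum_add_distrib]

theorem map_smul (hΦ : IsFinitary Φ) (a : k) (F) : Φ (a • F) = a • Φ F := by
  funext c
  obtain ⟨κ, hκ⟩ := hΦ c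
  rw [smul_apply, hκ, hκ]
  simp only [eval_apply, smul_apply, Finset.mul_sum, mul_assoc]

theorem map_zero (hΦ : IsFinitary Φ) : Φ 0 = 0 := by
  simpa using hΦ.map_smul 0 0

theorem map_sub (hΦ : IsFinitary Φ) (F G) : Φ (F - G) = Φ F - Φ G := by
  have := hΦ.map_add F ((-1 : k) • G)
  rw [hΦ.map_smul] at this
  simpa [sub_eq_add_neg] using this

theorem map_sum (hΦ : IsFinitary Φ) {ι : Type*} (s : Finset ι) (F : ι → FormalSum k 𝒱 L) :
    Φ (∑ i ∈ s, F i) = ∑ i ∈ s, Φ (F i) := by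
  induction s using Finset.induction_on with
  | empty => simpa using hΦ.map_zero
  | insert a s ha ih => rw [Finset.sum_insert ha, Finset.sum_insert ha, hΦ.map_add, ih]

/-- The coefficients of the finite combination are found by testing on single diagrams. Thus a
finitary operator is determined by single diagrams even on sums with infinite support. -/
theorem apply_eq (hΦ : IsFinitary Φ) (c) : ∃ S : Finset (DiagramClass 𝒱 L), ∀ F,
    Φ F c = ∑ a ∈ S, F a * Φ (single a.out) c := by
  obtain ⟨κ, hκ⟩ := hΦ c
  refine ⟨κ.support, fun F => ?_⟩
  rw [hκ, eval_apply]
  refine Finset.sum_congr rfl fun a ha => ?_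
  rw [hκ, eval_apply, Finset.sum_eq_single a]
  · rw [single_apply, if_pos (Quotient.out_eq a), one_mul]
  · intro b _ hb
    rw [single_apply, if_neg, zero_mul]
    rw [Quotient.out_eq]
    exact hb.symm
  · intro h
    exact absurd ha h

/-- Finitary operators that agree on single diagrams are equal. -/
theorem ext (hΦ : IsFinitary Φ) (hΨ : IsFinitary Ψ) (h : ∀ Γ, Φ (single Γ) = Ψ (single Γ)) (F) :
    Φ F = Ψ F := by
  have hχ : IsFinitary fun F => Φ F - Ψ F := by
    intro c
    obtain ⟨κ, hκ⟩ := hΦ c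
    obtain ⟨μ, hμ⟩ := hΨ c
    exact ⟨κ - μ, fun F => by beta_reduce; rw [sub_apply, hκ, hμ, _root_.map_sub]⟩
  funext c
  obtain ⟨S, hS⟩ := hχ.apply_eq c
  have := hS F
  rw [Finset.sum_eq_zero, sub_apply, sub_eq_zero] at this
  · exact this
  · intro a _
    simp [h]

end IsFinitary

/-- The part of a formal sum that consists of the diagrams in `𝒜`. -/
def restrict (𝒜 : Set (DiagramClass 𝒱 L)) (F : FormalSum k 𝒱 L) : FormalSum k 𝒱 L :=
  fun c => if c ∈ 𝒜 then F c else 0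

theorem restrict_apply (𝒜 : Set (DiagramClass 𝒱 L)) (F : FormalSum k 𝒱 L) (c) :
    restrict 𝒜 F c = if c ∈ 𝒜 then F c else 0 := rfl

theorem restrict_eq_self {𝒜 : Set (DiagramClass 𝒱 L)} {F : FormalSum k 𝒱 L}
    (h : ∀ c, F c ≠ 0 → c ∈ 𝒜) : restrict 𝒜 F = F := by
  funext c
  rw [restrict_apply]
  split_ifs with hc
  · rfl
  · by_contra h0
    exact hc (h c (Ne.symm h0))

theorem mem_of_restrict_ne_zero {𝒜 : Set (DiagramClass 𝒱 L)} {F : FormalSum k 𝒱 L} {c}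
    (h : restrict 𝒜 F c ≠ 0) : c ∈ 𝒜 := by
  by_contra hc
  exact h (if_neg hc)

theorem isFinitary_restrict (𝒜 : Set (DiagramClass 𝒱 L)) :
    IsFinitary (restrict 𝒜 : FormalSum k 𝒱 L → _) := by
  intro c
  by_cases hc : c ∈ 𝒜
  · exact ⟨Finsupp.single c 1, fun F => by rw [eval_single, mul_one, restrict_apply, if_pos hc]⟩
  · exact ⟨0, fun F => by rw [_root_.map_zero, restrict_apply, if_neg hc]⟩

theorem restrict_single (𝒜 : Set (DiagramClass 𝒱 L)) (Γ : Diagram 𝒱 L) :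
    restrict 𝒜 (single Γ : FormalSum k 𝒱 L) = if ⟦Γ⟧ ∈ 𝒜 then single Γ else 0 := by
  split_ifs with h
  · refine restrict_eq_self fun c hc => ?_
    rw [single_apply] at hc
    split_ifs at hc with h'
    · exact h' ▸ h
    · exact absurd rfl hc
  · funext c
    rw [restrict_apply, single_apply]
    split_ifs with h1 h2
    · exact absurd (h2 ▸ h1) h
    · rfl
    · rfl

/-! ### Locally finite sums -/

/-- In every coefficient only finitely many of the formal sums `F n` are nonzero. -/
def LocallyFinite (F : ℕ → FormalSum k 𝒱 L) : Prop :=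
  ∀ c, {n | F n c ≠ 0}.Finite

/-- The sum of a locally finite sequence of formal sums. -/
def lsum (F : ℕ → FormalSum k 𝒱 L) : FormalSum k 𝒱 L := fun c => ∑ᶠ n, F n c

theorem lsum_apply (F : ℕ → FormalSum k 𝒱 L) (c) : lsum F c = ∑ᶠ n, F n c := rfl

theorem LocallyFinite.smul {F : ℕ → FormalSum k 𝒱 L} (hF : LocallyFinite F) (a : k) :
    LocallyFinite fun n => a • F n := fun c =>
  (hF c).subset fun n hn => by
    intro h
    simp [h] at hn

theorem LocallyFinite.sum {ι : Type*} (s : Finset ι) {F : ι → ℕ → FormalSum k 𝒱 L}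
    (hF : ∀ i ∈ s, LocallyFinite (F i)) : LocallyFinite fun n => ∑ i ∈ s, F i n := by
  intro c
  refine (s.finite_toSet.biUnion fun i hi => hF i hi c).subset fun n hn => ?_
  by_contra h
  simp only [Set.mem_iUnion, not_exists, Set.mem_ofPred_eq, not_not] at h
  refine hn ?_
  beta_reduce
  rw [sum_apply]
  exact Finset.sum_eq_zero fun i hi => h i hi

theorem lsum_add {F G : ℕ → FormalSum k 𝒱 L} (hF : LocallyFinite F) (hG : LocallyFinite G) :
    lsum (fun n => F n + G n) = lsum F + lsum G :=
  funext fun c => finsum_add_distrib (hF c) (hG c)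

theorem lsum_smul (F : ℕ → FormalSum k 𝒱 L) (a : k) :
    lsum (fun n => a • F n) = a • lsum F :=
  funext fun _ => (smul_finsum a _).symm

theorem lsum_sum {ι : Type*} (s : Finset ι) {F : ι → ℕ → FormalSum k 𝒱 L}
    (hF : ∀ i ∈ s, LocallyFinite (F i)) :
    lsum (fun n => ∑ i ∈ s, F i n) = ∑ i ∈ s, lsum (F i) := by
  funext c
  simp only [lsum_apply, sum_apply]
  exact finsum_sum_comm s (fun n i => F i n c) fun i hi => hF i hi c

theorem LocallyFinite.shift {F : ℕ → FormalSum k 𝒱 L} (hF : LocallyFinite F) :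
    LocallyFinite fun n => F (n + 1) := fun c =>
  (hF c).preimage (f := fun n => n + 1) (fun _ _ _ _ h => by simpa using h)

theorem lsum_succ {F : ℕ → FormalSum k 𝒱 L} (hF : LocallyFinite F) :
    lsum F = F 0 + lsum fun n => F (n + 1) := by
  funext c
  obtain ⟨N, hN⟩ := (hF c).bddAbove
  rw [add_apply, lsum_apply, lsum_apply,
    finsum_eq_sum_of_support_subset (s := Finset.range (N + 2)),
    finsum_eq_sum_of_support_subset (s := Finset.range (N + 1)), Finset.sum_range_succ', add_comm]
  · intro n hn
    have := hN (show n + 1 ∈ _ from hn)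
    simp only [Finset.coe_range, Set.mem_Iio]
    omega
  · intro n hn
    have := hN hn
    simp only [Finset.coe_range, Set.mem_Iio]
    omega

theorem lsum_eq_zero_term {F : ℕ → FormalSum k 𝒱 L} (hF : ∀ n, F (n + 1) = 0) :
    lsum F = F 0 := by
  funext c
  rw [lsum_apply, finsum_eq_single _ 0]
  intro n hn
  obtain ⟨m, rfl⟩ := Nat.exists_eq_succ_of_ne_zero hn
  rw [Nat.succ_eq_add_one, hF, zero_apply]

/-- A coefficient of the image involves only finitely many coefficients of the argument, and in each
of these the sum is finite. -/
theorem IsFinitary.map_lsum {Φ : FormalSum k 𝒱 L → FormalSum k 𝒱 L} (hΦ : IsFinitary Φ)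
    {F : ℕ → FormalSum k 𝒱 L} (hF : LocallyFinite F) : Φ (lsum F) = lsum fun n => Φ (F n) := by
  funext c
  obtain ⟨S, hS⟩ := hΦ.apply_eq c
  rw [hS, lsum_apply, finsum_congr fun n => hS (F n)]
  rw [finsum_sum_comm S (fun n a => F n a * Φ (single a.out) c)]
  · exact Finset.sum_congr rfl fun a _ => finsum_mul' _ _ (hF a)
  · intro a _
    exact (hF a).subset fun n hn h => hn (by simp [h])

theorem exists_ne_zero_of_lsum_ne_zero {F : ℕ → FormalSum k 𝒱 L} {c} (h : lsum F c ≠ 0) :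
    ∃ n, F n c ≠ 0 := by
  by_contra hc
  push Not at hc
  exact h (by simp [lsum_apply, hc])

end FormalSum

end FormalDiagram

end

/-! ### Disjoint unions, sums of gluings, and their extension to formal sums -/

noncomputable section

namespace FormalDiagram

open Classical Diagram

namespace Diagram

variable {𝒱 : VertexKinds} {L : Type*}

/-- The inclusion of the ends of the first part of a disjoint union. -/
def unionL (Γ Δ : Diagram 𝒱 L) : Γ.Ends → (Γ.union Δ).Ends :=
  endsMap (Γ := Γ.union Δ) Sum.inl (fun _ => rfl) Sum.inl

/-- The inclusion of the ends of the second part of a disjoint union. -/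
def unionR (Γ Δ : Diagram 𝒱 L) : Δ.Ends → (Γ.union Δ).Ends :=
  endsMap (Γ := Γ.union Δ) Sum.inr (fun _ => rfl) Sum.inr

theorem unionEnds_unionL (Γ Δ : Diagram 𝒱 L) (e : Γ.Ends) :
    unionEnds Γ.kind Δ.kind (unionL Γ Δ e) = Sum.inl e := by
  rcases e with ⟨⟨v, i⟩, h⟩ | s <;> rfl

theorem unionEnds_unionR (Γ Δ : Diagram 𝒱 L) (e : Δ.Ends) :
    unionEnds Γ.kind Δ.kind (unionR Γ Δ e) = Sum.inr e := by
  rcases e with ⟨⟨v, i⟩, h⟩ | s <;> rfl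

theorem union_mate_unionL (Γ Δ : Diagram 𝒱 L) (e : Γ.Ends) :
    (Γ.union Δ).mate (unionL Γ Δ e) = unionL Γ Δ (Γ.mate e) := by
  change (unionEnds Γ.kind Δ.kind).symm (Sum.map Γ.mate Δ.mate
    (unionEnds Γ.kind Δ.kind (unionL Γ Δ e))) = _
  rw [unionEnds_unionL, Equiv.symm_apply_eq, unionEnds_unionL]
  rfl

theorem union_mate_unionR (Γ Δ : Diagram 𝒱 L) (e : Δ.Ends) :
    (Γ.union Δ).mate (unionR Γ Δ e) = unionR Γ Δ (Δ.mate e) := by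
  change (unionEnds Γ.kind Δ.kind).symm (Sum.map Γ.mate Δ.mate
    (unionEnds Γ.kind Δ.kind (unionR Γ Δ e))) = _
  rw [unionEnds_unionR, Equiv.symm_apply_eq, unionEnds_unionR]
  rfl

theorem union_ends_cases {Γ Δ : Diagram 𝒱 L} {p : (Γ.union Δ).Ends → Prop}
    (hl : ∀ e, p (unionL Γ Δ e)) (hr : ∀ e, p (unionR Γ Δ e)) (e : (Γ.union Δ).Ends) : p e := by
  rcases e with ⟨⟨v | v, i⟩, h⟩ | s | s
  · exact hl (.inl ⟨(v, i), h⟩)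
  · exact hr (.inl ⟨(v, i), h⟩)
  · exact hl (.inr s)
  · exact hr (.inr s)

theorem glue_one_iso (Γ : Diagram 𝒱 L) : Nonempty (Iso (Γ.glue (Invol.one Γ.Leg)) Γ) := by
  let lf : (Γ.glue (Invol.one Γ.Leg)).Leg ≃ Γ.Leg :=
    { toFun := Subtype.val, invFun := fun s => ⟨s, rfl⟩, left_inv := fun _ => rfl,
      right_inv := fun _ => rfl }
  refine ⟨{ vert := Equiv.refl _, leg := lf, kind_eq := fun _ => rfl, label_eq := fun _ => rfl,
            mate_eq := fun e => ?_ }⟩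
  have h : ∀ e : Γ.Ends, (Γ.glue (Invol.one Γ.Leg)).mate (Sum.map id lf.symm e) =
      Sum.map id lf.symm (Γ.mate e) := by
    have hE : ∀ e : Γ.Ends, endsMap (Δ := Γ.glue (Invol.one Γ.Leg)) (Γ := Γ) id (fun _ => rfl)
        Subtype.val (Sum.map id lf.symm e) = e := by
      rintro (e | e) <;> rfl
    intro e
    refine glue_mate_eq_of_walk Γ _ _ _ ?_ ?_
    · intro h
      have := congrArg (endsMap (Δ := Γ.glue (Invol.one Γ.Leg)) (Γ := Γ) id (fun _ => rfl)
        Subtype.val) h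
      rw [hE, hE] at this
      exact Γ.mate_ne e this
    · rw [hE, hE]
      exact Walk.left _
  have h1 : ∀ e : (Γ.glue (Invol.one Γ.Leg)).Ends,
      Sum.map (Flags.map (𝒱 := 𝒱) (kV := Γ.kind) (kW := Γ.kind) (Equiv.refl Γ.Vert)
        (fun _ => rfl)) lf e = Sum.map id lf e := by
    rintro (e | e) <;> rfl
  have h2 : ∀ e : (Γ.glue (Invol.one Γ.Leg)).Ends, Sum.map id lf.symm (Sum.map id lf e) = e := by
    rintro (e | e) <;> rfl
  have h3 : ∀ e : Γ.Ends, (Sum.map id lf (Sum.map id lf.symm e :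
      (Γ.glue (Invol.one Γ.Leg)).Ends) : Γ.Ends) = e := by
    rintro (e | e) <;> rfl
  have h4 := h (Sum.map id lf e)
  rw [h2] at h4
  refine (congrArg Γ.mate (h1 e)).trans (((h3 _).symm.trans ?_).trans (h1 _).symm)
  rw [h4]

theorem Iso.mate_endsMap {Γ Δ : Diagram 𝒱 L} (f : Iso Γ Δ) (e : Γ.Ends) :
    Δ.mate (endsMap f.vert f.kind_eq f.leg e) = endsMap f.vert f.kind_eq f.leg (Γ.mate e) :=
  f.mate_eq e

/-- The bijection of flags induced by a kind-preserving bijection of vertices. -/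
def flagsEquiv {V W : Type} {kV : V → 𝒱.Kind} {kW : W → 𝒱.Kind} (f : V ≃ W)
    (h : ∀ v, kW (f v) = kV v) : Flags 𝒱 kV ≃ Flags 𝒱 kW where
  toFun := Flags.map f h
  invFun := Flags.map f.symm fun w => by rw [← h, f.apply_symm_apply]
  left_inv p := Subtype.ext (Prod.ext (f.symm_apply_apply _) rfl)
  right_inv p := Subtype.ext (Prod.ext (f.apply_symm_apply _) rfl)

/-- There are only finitely many diagrams of bounded size. -/
theorem finite_bounded (N M : ℕ) {K : Set 𝒱.Kind} (hK : K.Finite) {𝓛 : Set L} (h𝓛 : 𝓛.Finite) :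
    {a : DiagramClass 𝒱 L | ∃ Γ : Diagram 𝒱 L, ⟦Γ⟧ = a ∧ Nat.card Γ.Vert ≤ N ∧
      Nat.card Γ.Leg ≤ M ∧ (∀ v, Γ.kind v ∈ K) ∧ ∀ s, Γ.label s ∈ 𝓛}.Finite := by
  have := hK.to_subtype
  have := h𝓛.to_subtype
  -- Normal forms with numbered vertices and legs. Since valencies are finite, there are finitely
  -- many flags, hence finitely many matchings.
  let Data := Σ (n : Fin (N + 1)) (m : Fin (M + 1)) (κ : Fin n → K) (_ : Fin m → 𝓛),
    {μ : (Flags 𝒱 (fun v => (κ v).1) ⊕ Fin m) → (Flags 𝒱 (fun v => (κ v).1) ⊕ Fin m) //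
      (∀ e, μ (μ e) = e) ∧ ∀ e, μ e ≠ e}
  let build : Data → Diagram 𝒱 L := fun x =>
    { Vert := Fin x.1
      Leg := Fin x.2.1
      finite_vert := inferInstance
      finite_leg := inferInstance
      kind := fun v => (x.2.2.1 v).1
      label := fun s => (x.2.2.2.1 s).1
      mate := x.2.2.2.2.1
      mate_mate := x.2.2.2.2.2.1
      mate_ne := x.2.2.2.2.2.2 }
  refine (Set.finite_range fun x => (⟦build x⟧ : DiagramClass 𝒱 L)).subset ?_
  rintro _ ⟨Γ, rfl, hN, hM, hk, hl⟩
  let eV := (Finite.equivFin Γ.Vert)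
  let eL := (Finite.equivFin Γ.Leg)
  let κ : Fin (Nat.card Γ.Vert) → K := fun v => ⟨Γ.kind (eV.symm v), hk _⟩
  have hκ : ∀ v, (κ (eV v)).1 = Γ.kind v := fun v => by simp [κ]
  let φ : Γ.Ends ≃ (Flags 𝒱 (fun v => (κ v).1) ⊕ Fin (Nat.card Γ.Leg)) :=
    Equiv.sumCongr (flagsEquiv eV hκ) eL
  refine ⟨⟨⟨Nat.card Γ.Vert, by omega⟩, ⟨Nat.card Γ.Leg, by omega⟩, κ,
    fun s => ⟨Γ.label (eL.symm s), hl _⟩, ⟨fun e => φ (Γ.mate (φ.symm e)), ?_, ?_⟩⟩, ?_⟩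
  · intro e
    simp [Γ.mate_mate]
  · intro e h
    rw [← Equiv.eq_symm_apply] at h
    exact Γ.mate_ne _ h
  · refine Quotient.sound ⟨Iso.symm
      { vert := eV, leg := eL, kind_eq := hκ, label_eq := fun s => ?_, mate_eq := fun e => ?_ }⟩
    · simp [build]
    · change φ (Γ.mate (φ.symm (φ e))) = φ (Γ.mate e)
      rw [Equiv.symm_apply_apply]

end Diagram

namespace FormalSum

variable {k : Type*} [Field k] {𝒱 : VertexKinds} {L : Type*}

/-- The sum of all gluings of `Γ` that satisfy `P`. -/
def glueSum (Γ : Diagram 𝒱 L) (P : Invol Γ.Leg → Prop) : FormalSum k 𝒱 L :=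
  ∑ h with P h, single (Γ.glue h)

/-- The basic operations are defined by multiplicities. As coefficients of a sum of diagrams they
can be compared through bijections of gluings. -/
theorem natCard_gluing (Γ : Diagram 𝒱 L) (P : Invol Γ.Leg → Prop) (c : DiagramClass 𝒱 L) :
    (Nat.card {g : Γ.Gluing // P g ∧ ⟦Γ.glue g⟧ = c} : k) = glueSum Γ P c := by
  rw [glueSum, sum_apply]
  simp only [single_apply]
  rw [← Finset.sum_filter, Finset.sum_const, Finset.filter_filter, nsmul_eq_mul, mul_one]
  congr 1
  exact Nat.subtype_card _ (by simp)

theorem exists_of_glueSum_ne_zero {Γ : Diagram 𝒱 L} {P : Invol Γ.Leg → Prop}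
    {c : DiagramClass 𝒱 L} (h : (glueSum Γ P : FormalSum k 𝒱 L) c ≠ 0) :
    ∃ g, P g ∧ (⟦Γ.glue g⟧ : DiagramClass 𝒱 L) = c := by
  rw [glueSum, sum_apply] at h
  obtain ⟨g, hg, h1⟩ := Finset.exists_ne_zero_of_sum_ne_zero h
  refine ⟨g, by simpa using hg, ?_⟩
  by_contra h2
  exact h1 (if_neg h2)

theorem glueSum_congr {Γ : Diagram 𝒱 L} {P P' : Invol Γ.Leg → Prop} (h : ∀ g, P g ↔ P' g) :
    (glueSum Γ P : FormalSum k 𝒱 L) = glueSum Γ P' := by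
  have : P = P' := funext fun g => propext (h g)
  rw [this]

theorem glueSum_one (Γ : Diagram 𝒱 L) (P : Invol Γ.Leg → Prop) (h : ∀ g, P g ↔ g.1 = id) :
    (glueSum Γ P : FormalSum k 𝒱 L) = single Γ := by
  have : (Finset.univ.filter fun g : Invol Γ.Leg => P g) = {Invol.one Γ.Leg} := by
    ext g
    simp only [Finset.mem_filter, Finset.mem_univ, true_and, Finset.mem_singleton, h]
    exact ⟨fun e => Subtype.ext e, fun e => congrArg Subtype.val e⟩
  rw [glueSum, this, Finset.sum_singleton]
  exact single_congr (glue_one_iso Γ)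

/-- Comparison of the sums of gluings of two diagrams, given maps of vertices and legs. -/
theorem glueSum_eq {Γ Δ : Diagram 𝒱 L} (P : Invol Δ.Leg → Prop) (P' : Invol Γ.Leg → Prop)
    (vert : Δ.Vert ≃ Γ.Vert) (kind_eq : ∀ v, Γ.kind (vert v) = Δ.kind v) {leg : Δ.Leg → Γ.Leg}
    (inj : Function.Injective leg) (G : Invol Γ.Leg) (hG : ∀ s, ∃ s', G.1 (leg s) = leg s')
    (hG' : ∀ t, (∀ s, leg s ≠ t) → G.1 t ≠ t)
    (off : ∀ h, P' h → ∀ t, (∀ s, leg s ≠ t) → h.1 t = G.1 t)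
    (iff : ∀ (h : Invol Δ.Leg) (h' : Invol Γ.Leg), (∀ s, h'.1 (leg s) = leg (h.1 s)) →
      (∀ t, (∀ s, leg s ≠ t) → h'.1 t = G.1 t) → (P h ↔ P' h'))
    (label_eq : ∀ h, P h → ∀ s, h.1 s = s → Γ.label (leg s) = Δ.label s)
    (edge : ∀ h' : Invol Γ.Leg, (∀ t, (∀ s, leg s ≠ t) → h'.1 t = G.1 t) → ∀ e,
      Γ.GlueWalk h' (endsMap vert kind_eq leg e) (endsMap vert kind_eq leg (Δ.mate e))) :
    (glueSum Δ P : FormalSum k 𝒱 L) = glueSum Γ P' := by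
  -- Off the image of `leg` the gluing is prescribed by `G` and leaves no leg free, so all free legs
  -- of the glued diagram come from `Δ`.
  refine Invol.sum_extend inj G hG P P' _ _ off iff fun h h' hon hoff hP =>
    single_congr (glue_iso h' h vert kind_eq leg ?_ ?_ ?_ (label_eq h hP) (edge h' hoff) ?_)
  · intro s hs
    rw [hon, hs]
  · intro s t _ _ e
    exact inj e
  · intro t ht
    by_cases H : ∃ s, leg s = t
    · obtain ⟨s, rfl⟩ := H
      exact ⟨s, inj (by rw [← hon, ht]), rfl⟩
    · push Not at H
      exact absurd ((hoff t H).symm.trans ht) (hG' t H)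
  · intro s _
    rw [← hon]
    exact Walk.right (Sum.inr (leg s))

/-- Conditions on gluings of a disjoint union, in terms of the labels of the legs. -/
abbrev GluePred (L : Type*) := ∀ S T : Type, (S → L) → (T → L) → (S ⊕ T → S ⊕ T) → Prop

/-- Conditions that are invariant under bijections of legs. -/
def GluePred.Natural (𝒢 : GluePred L) : Prop :=
  ∀ {S T S' T' : Type} (σ : S ≃ S') (τ : T ≃ T') (l : S → L) (m : T → L) (l' : S' → L) (m' : T' → L)
    (g : S ⊕ T → S ⊕ T) (g' : S' ⊕ T' → S' ⊕ T'), (∀ s, l' (σ s) = l s) → (∀ t, m' (τ t) = m t) →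
    (∀ e, g' (Sum.map σ τ e) = Sum.map σ τ (g e)) → 𝒢 S T l m g → 𝒢 S' T' l' m' g'

theorem GluePred.Natural.iff {𝒢 : GluePred L} (h𝒢 : 𝒢.Natural) {S T S' T' : Type} (σ : S ≃ S')
    (τ : T ≃ T') {l : S → L} {m : T → L} {l' : S' → L} {m' : T' → L}
    {g : S ⊕ T → S ⊕ T} {g' : S' ⊕ T' → S' ⊕ T'} (hl : ∀ s, l' (σ s) = l s)
    (hm : ∀ t, m' (τ t) = m t) (hg : ∀ e, g' (Sum.map σ τ e) = Sum.map σ τ (g e)) :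
    𝒢 S T l m g ↔ 𝒢 S' T' l' m' g' := by
  refine ⟨h𝒢 σ τ l m l' m' g g' hl hm hg,
    h𝒢 σ.symm τ.symm l' m' l m g' g (fun s => ?_) (fun t => ?_) fun e => ?_⟩
  · rw [← hl, σ.apply_symm_apply]
  · rw [← hm, τ.apply_symm_apply]
  · have h1 : ∀ e : S' ⊕ T', Sum.map σ τ (Sum.map σ.symm τ.symm e) = e := by
      rintro (e | e) <;> simp
    have h2 : ∀ e : S ⊕ T, Sum.map σ.symm τ.symm (Sum.map σ τ e) = e := by
      rintro (e | e) <;> simp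
    have := hg (Sum.map σ.symm τ.symm e)
    rw [h1] at this
    rw [this, h2]

/-- The sum of the gluings of `Γ` to `Δ` that are allowed by `𝒢`. -/
def opSum (𝒢 : GluePred L) (Γ Δ : Diagram 𝒱 L) : FormalSum k 𝒱 L :=
  glueSum (Γ.union Δ) fun h => 𝒢 Γ.Leg Δ.Leg Γ.label Δ.label h.1

/-- The bilinear extension of `opSum`. -/
def op (𝒢 : GluePred L) : FormalSum k 𝒱 L → FormalSum k 𝒱 L → FormalSum k 𝒱 L :=
  extend₂ fun Γ Δ c => Nat.card
    {g : (Γ.union Δ).Gluing // 𝒢 Γ.Leg Δ.Leg Γ.label Δ.label g.1 ∧ ⟦(Γ.union Δ).glue g⟧ = c}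

theorem op_apply (𝒢 : GluePred L) (F G : FormalSum k 𝒱 L) (c) :
    op 𝒢 F G c = ∑ᶠ p : DiagramClass 𝒱 L × DiagramClass 𝒱 L,
      F p.1 * G p.2 * (opSum 𝒢 p.1.out p.2.out : FormalSum k 𝒱 L) c := by
  rw [op, extend₂]
  refine finsum_congr fun p => ?_
  rw [opSum, ← natCard_gluing]

theorem opSum_congr {𝒢 : GluePred L} (h𝒢 : 𝒢.Natural) {Γ Γ' Δ Δ' : Diagram 𝒱 L} (f : Iso Γ Γ')
    (f' : Iso Δ Δ') : (opSum 𝒢 Γ Δ : FormalSum k 𝒱 L) = opSum 𝒢 Γ' Δ' := by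
  refine glueSum_eq (Γ := Γ'.union Δ') (Δ := Γ.union Δ) _ _ (Equiv.sumCongr f.vert f'.vert) ?_
    (leg := Sum.map f.leg f'.leg) ?_ (Invol.one _) ?_ ?_ ?_ ?_ ?_ ?_
  · rintro (v | v)
    · exact f.kind_eq v
    · exact f'.kind_eq v
  · exact Function.Injective.sumMap f.leg.injective f'.leg.injective
  · exact fun s => ⟨s, rfl⟩
  · rintro (t | t) ht
    · exact absurd (congrArg Sum.inl (f.leg.apply_symm_apply t)) (ht (.inl (f.leg.symm t)))
    · exact absurd (congrArg Sum.inr (f'.leg.apply_symm_apply t)) (ht (.inr (f'.leg.symm t)))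
  · rintro h _ (t | t) ht
    · exact absurd (congrArg Sum.inl (f.leg.apply_symm_apply t)) (ht (.inl (f.leg.symm t)))
    · exact absurd (congrArg Sum.inr (f'.leg.apply_symm_apply t)) (ht (.inr (f'.leg.symm t)))
  · exact fun h h' hon _ => h𝒢.iff f.leg f'.leg f.label_eq f'.label_eq hon
  · rintro h _ (s | s) _
    · exact f.label_eq s
    · exact f'.label_eq s
  · intro h' _ e
    induction e using union_ends_cases with
    | hl e =>
      rw [union_mate_unionL]
      have hE : ∀ e, endsMap (Δ := Γ.union Δ) (Γ := Γ'.union Δ') (Equiv.sumCongr f.vert f'.vert)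
          (by rintro (v | v); exacts [f.kind_eq v, f'.kind_eq v]) (Sum.map f.leg f'.leg)
          (unionL Γ Δ e) = unionL Γ' Δ' (endsMap f.vert f.kind_eq f.leg e) := by
        rintro (⟨⟨v, i⟩, h⟩ | s) <;> rfl
      rw [hE, hE, ← f.mate_endsMap, ← union_mate_unionL]
      exact Walk.left _
    | hr e =>
      rw [union_mate_unionR]
      have hE : ∀ e, endsMap (Δ := Γ.union Δ) (Γ := Γ'.union Δ') (Equiv.sumCongr f.vert f'.vert)
          (by rintro (v | v); exacts [f.kind_eq v, f'.kind_eq v]) (Sum.map f.leg f'.leg)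
          (unionR Γ Δ e) = unionR Γ' Δ' (endsMap f'.vert f'.kind_eq f'.leg e) := by
        rintro (⟨⟨v, i⟩, h⟩ | s) <;> rfl
      rw [hE, hE, ← f'.mate_endsMap, ← union_mate_unionR]
      exact Walk.left _

/-- Naturality of `𝒢` makes the result independent of the representatives that `Quotient.out`
chooses. -/
theorem op_single {𝒢 : GluePred L} (h𝒢 : 𝒢.Natural) (Γ Δ : Diagram 𝒱 L) :
    op 𝒢 (single Γ) (single Δ) = (opSum 𝒢 Γ Δ : FormalSum k 𝒱 L) := by
  funext c
  rw [op_apply, finsum_eq_single _ (⟦Γ⟧, ⟦Δ⟧)]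
  · have h1 := Quotient.exact (Quotient.out_eq (⟦Γ⟧ : DiagramClass 𝒱 L))
    have h2 := Quotient.exact (Quotient.out_eq (⟦Δ⟧ : DiagramClass 𝒱 L))
    rw [single_apply, single_apply, if_pos rfl, if_pos rfl, one_mul, one_mul,
      opSum_congr h𝒢 h1.some h2.some]
  · rintro ⟨a, b⟩ hab
    rw [single_apply, single_apply]
    split_ifs with h1 h2
    · exact absurd (Prod.ext h1.symm h2.symm) hab
    all_goals simp

theorem exists_of_op_ne_zero {𝒢 : GluePred L} {F G : FormalSum k 𝒱 L} {c}
    (h : op 𝒢 F G c ≠ 0) : ∃ Γ Δ : Diagram 𝒱 L, F ⟦Γ⟧ ≠ 0 ∧ G ⟦Δ⟧ ≠ 0 ∧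
      ∃ g : Invol (Γ.union Δ).Leg, 𝒢 Γ.Leg Δ.Leg Γ.label Δ.label g.1 ∧
        (⟦(Γ.union Δ).glue g⟧ : DiagramClass 𝒱 L) = c := by
  rw [op_apply] at h
  obtain ⟨p, hp⟩ : ∃ p : DiagramClass 𝒱 L × DiagramClass 𝒱 L,
      F p.1 * G p.2 * (opSum 𝒢 p.1.out p.2.out : FormalSum k 𝒱 L) c ≠ 0 := by
    by_contra hc
    push Not at hc
    exact h (by simp [hc])
  refine ⟨p.1.out, p.2.out, ?_, ?_, ?_⟩
  · intro h0
    rw [Quotient.out_eq] at h0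
    simp [h0] at hp
  · intro h0
    rw [Quotient.out_eq] at h0
    simp [h0] at hp
  · exact exists_of_glueSum_ne_zero (right_ne_zero_of_mul hp)

/-- For every result `c` there are only finitely many pairs of diagrams in `𝒜` and `ℬ` that can
be glued to `c`. -/
def FinitePairs (𝒢 : GluePred L) (𝒜 ℬ : Set (DiagramClass 𝒱 L)) : Prop :=
  ∀ c : DiagramClass 𝒱 L, {p : DiagramClass 𝒱 L × DiagramClass 𝒱 L | p.1 ∈ 𝒜 ∧ p.2 ∈ ℬ ∧
    ∃ g : Invol (p.1.out.union p.2.out).Leg, 𝒢 _ _ p.1.out.label p.2.out.label g.1 ∧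
      (⟦(p.1.out.union p.2.out).glue g⟧ : DiagramClass 𝒱 L) = c}.Finite

/-- The finite set `S` depends on the result `c` only, not on `F` and `G`. This makes the `finsum`
in the definition bilinear. -/
theorem FinitePairs.op_eq {𝒢 : GluePred L} {𝒜 ℬ : Set (DiagramClass 𝒱 L)}
    (h : FinitePairs 𝒢 𝒜 ℬ) (c) : ∃ S : Finset (DiagramClass 𝒱 L × DiagramClass 𝒱 L),
      ∀ F G : FormalSum k 𝒱 L, op 𝒢 (restrict 𝒜 F) (restrict ℬ G) c =
        ∑ p ∈ S, restrict 𝒜 F p.1 * restrict ℬ G p.2 *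
          (opSum 𝒢 p.1.out p.2.out : FormalSum k 𝒱 L) c := by
  refine ⟨(h c).toFinset, fun F G => ?_⟩
  rw [op_apply]
  refine finsum_eq_sum_of_support_subset _ fun p hp => ?_
  rw [Function.mem_support] at hp
  simp only [Set.Finite.coe_toFinset, Set.mem_ofPred_eq]
  exact ⟨mem_of_restrict_ne_zero (left_ne_zero_of_mul (left_ne_zero_of_mul hp)),
    mem_of_restrict_ne_zero (right_ne_zero_of_mul (left_ne_zero_of_mul hp)),
    exists_of_glueSum_ne_zero (right_ne_zero_of_mul hp)⟩

theorem FinitePairs.isFinitary_left {𝒢 : GluePred L} {𝒜 ℬ : Set (DiagramClass 𝒱 L)}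
    (h : FinitePairs 𝒢 𝒜 ℬ) (G : FormalSum k 𝒱 L) :
    IsFinitary fun F => op 𝒢 (restrict 𝒜 F) (restrict ℬ G) := by
  intro c
  obtain ⟨S, hS⟩ := h.op_eq (k := k) c
  refine ⟨∑ p ∈ S, Finsupp.single p.1 (if p.1 ∈ 𝒜 then
    restrict ℬ G p.2 * (opSum 𝒢 p.1.out p.2.out : FormalSum k 𝒱 L) c else 0), fun F => ?_⟩
  beta_reduce
  rw [hS, _root_.map_sum]
  refine Finset.sum_congr rfl fun p _ => ?_
  rw [eval_single, restrict_apply 𝒜]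
  split_ifs <;> ring

theorem FinitePairs.isFinitary_right {𝒢 : GluePred L} {𝒜 ℬ : Set (DiagramClass 𝒱 L)}
    (h : FinitePairs 𝒢 𝒜 ℬ) (F : FormalSum k 𝒱 L) :
    IsFinitary fun G => op 𝒢 (restrict 𝒜 F) (restrict ℬ G) := by
  intro c
  obtain ⟨S, hS⟩ := h.op_eq (k := k) c
  refine ⟨∑ p ∈ S, Finsupp.single p.2 (if p.2 ∈ ℬ then
    restrict 𝒜 F p.1 * (opSum 𝒢 p.1.out p.2.out : FormalSum k 𝒱 L) c else 0), fun G => ?_⟩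
  beta_reduce
  rw [hS, _root_.map_sum]
  refine Finset.sum_congr rfl fun p _ => ?_
  rw [eval_single, restrict_apply ℬ]
  split_ifs <;> ring

/-- To see that there are finitely many pairs it suffices to bound the legs. -/
theorem finitePairs_of_bounded {𝒢 : GluePred L} {𝒜 ℬ : Set (DiagramClass 𝒱 L)}
    (h : ∀ Θ : Diagram 𝒱 L, ∃ M : ℕ, ∃ 𝓛 : Set L, 𝓛.Finite ∧ ∀ Γ Δ : Diagram 𝒱 L, ⟦Γ⟧ ∈ 𝒜 →
      ⟦Δ⟧ ∈ ℬ → ∀ g : Invol (Γ.union Δ).Leg, 𝒢 _ _ Γ.label Δ.label g.1 →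
        Iso ((Γ.union Δ).glue g) Θ →
        Nat.card (Γ.union Δ).Leg ≤ M ∧ ∀ s, (Γ.union Δ).label s ∈ 𝓛) :
    FinitePairs 𝒢 𝒜 ℬ := by
  intro c
  obtain ⟨M, 𝓛, h𝓛, hb⟩ := h c.out
  have hK : (Set.range c.out.kind).Finite := Set.finite_range _
  have hfin := finite_bounded (Nat.card c.out.Vert) M hK h𝓛
  refine (hfin.prod hfin).subset ?_
  rintro ⟨a, b⟩ ⟨ha, hb', g, hg, hc⟩
  have f : Iso ((a.out.union b.out).glue g) c.out :=
    (Quotient.exact (hc.trans (Quotient.out_eq c).symm)).some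
  dsimp only at ha hb' g hg hc f
  rw [← Quotient.out_eq a] at ha
  rw [← Quotient.out_eq b] at hb'
  obtain ⟨h1, h2⟩ := hb _ _ ha hb' g hg f
  refine ⟨⟨a.out, Quotient.out_eq a, ?_, ?_, ?_, ?_⟩, ⟨b.out, Quotient.out_eq b, ?_, ?_, ?_, ?_⟩⟩
  · exact Nat.card_le_card_of_injective (fun v => f.vert (.inl v))
      (f.vert.injective.comp Sum.inl_injective)
  · exact (Nat.card_le_card_of_injective (β := (a.out.union b.out).Leg) Sum.inl
      Sum.inl_injective).trans h1
  · exact fun v => ⟨f.vert (.inl v), f.kind_eq (.inl v)⟩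
  · exact fun s => h2 (.inl s)
  · exact Nat.card_le_card_of_injective (fun v => f.vert (.inr v))
      (f.vert.injective.comp Sum.inr_injective)
  · exact (Nat.card_le_card_of_injective (β := (a.out.union b.out).Leg) Sum.inr
      Sum.inr_injective).trans h1
  · exact fun v => ⟨f.vert (.inr v), f.kind_eq (.inr v)⟩
  · exact fun s => h2 (.inr s)

/-! ### Unary operations -/

/-- Conditions on gluings that are invariant under isomorphisms. -/
def NaturalGluing (𝒢 : ∀ Γ : Diagram 𝒱 L, Invol Γ.Leg → Prop) : Prop :=
  ∀ {Γ Δ : Diagram 𝒱 L} (f : Iso Γ Δ) (g : Invol Γ.Leg) (h : Invol Δ.Leg),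
    (∀ s, h.1 (f.leg s) = f.leg (g.1 s)) → 𝒢 Γ g → 𝒢 Δ h

theorem NaturalGluing.iff {𝒢 : ∀ Γ : Diagram 𝒱 L, Invol Γ.Leg → Prop} (h𝒢 : NaturalGluing 𝒢)
    {Γ Δ : Diagram 𝒱 L} (f : Iso Γ Δ) (g : Invol Γ.Leg) (h : Invol Δ.Leg)
    (hgh : ∀ s, h.1 (f.leg s) = f.leg (g.1 s)) : 𝒢 Γ g ↔ 𝒢 Δ h := by
  refine ⟨h𝒢 f g h hgh, h𝒢 f.symm h g fun s => ?_⟩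
  change g.1 (f.leg.symm s) = f.leg.symm (h.1 s)
  rw [Equiv.eq_symm_apply, ← hgh, Equiv.apply_symm_apply]

theorem glueSum_eq_of_iso {Γ Δ : Diagram 𝒱 L} (f : Iso Γ Δ) (P : Invol Γ.Leg → Prop)
    (P' : Invol Δ.Leg → Prop)
    (iff : ∀ (g : Invol Γ.Leg) (h : Invol Δ.Leg), (∀ s, h.1 (f.leg s) = f.leg (g.1 s)) →
      (P g ↔ P' h)) : (glueSum Γ P : FormalSum k 𝒱 L) = glueSum Δ P' := by
  refine glueSum_eq _ _ f.vert f.kind_eq f.leg.injective (Invol.one _) (fun s => ⟨s, rfl⟩) ?_ ?_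
    (fun g h hgh _ => iff g h hgh) (fun _ _ s _ => f.label_eq s) ?_
  · exact fun t ht => absurd (f.leg.apply_symm_apply t) (ht _)
  · exact fun _ _ t ht => absurd (f.leg.apply_symm_apply t) (ht _)
  · intro h' _ e
    rw [← f.mate_endsMap]
    exact Walk.left _

theorem glueSum_iso {𝒢 : ∀ Γ : Diagram 𝒱 L, Invol Γ.Leg → Prop} (h𝒢 : NaturalGluing 𝒢)
    {Γ Δ : Diagram 𝒱 L} (f : Iso Γ Δ) :
    (glueSum Γ (𝒢 Γ) : FormalSum k 𝒱 L) = glueSum Δ (𝒢 Δ) :=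
  glueSum_eq_of_iso f _ _ fun g h => h𝒢.iff f g h

/-- The linear extension of the sum of all gluings allowed by `𝒢`. -/
def unop (𝒢 : ∀ Γ : Diagram 𝒱 L, Invol Γ.Leg → Prop) (F : FormalSum k 𝒱 L) : FormalSum k 𝒱 L :=
  fun c => ∑ᶠ a : DiagramClass 𝒱 L, F a *
    (Nat.card {g : a.out.Gluing // 𝒢 a.out g ∧ ⟦a.out.glue g⟧ = c} : k)

theorem unop_apply (𝒢 : ∀ Γ : Diagram 𝒱 L, Invol Γ.Leg → Prop) (F : FormalSum k 𝒱 L) (c) :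
    unop 𝒢 F c = ∑ᶠ a : DiagramClass 𝒱 L, F a *
      (glueSum a.out (𝒢 a.out) : FormalSum k 𝒱 L) c := by
  rw [unop]
  exact finsum_congr fun a => by rw [natCard_gluing]

theorem unop_single {𝒢 : ∀ Γ : Diagram 𝒱 L, Invol Γ.Leg → Prop} (h𝒢 : NaturalGluing 𝒢)
    (Γ : Diagram 𝒱 L) : unop 𝒢 (single Γ) = (glueSum Γ (𝒢 Γ) : FormalSum k 𝒱 L) := by
  funext c
  rw [unop_apply, finsum_eq_single _ ⟦Γ⟧]
  · have h1 := Quotient.exact (Quotient.out_eq (⟦Γ⟧ : DiagramClass 𝒱 L))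
    rw [single_apply, if_pos rfl, one_mul, glueSum_iso h𝒢 h1.some]
  · intro a ha
    rw [single_apply, if_neg ha.symm, zero_mul]

theorem exists_of_unop_ne_zero {𝒢 : ∀ Γ : Diagram 𝒱 L, Invol Γ.Leg → Prop} {F : FormalSum k 𝒱 L}
    {c} (h : unop 𝒢 F c ≠ 0) : ∃ Γ : Diagram 𝒱 L, F ⟦Γ⟧ ≠ 0 ∧ ∃ g, 𝒢 Γ g ∧
      (⟦Γ.glue g⟧ : DiagramClass 𝒱 L) = c := by
  rw [unop_apply] at h
  obtain ⟨a, ha⟩ : ∃ a : DiagramClass 𝒱 L,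
      F a * (glueSum a.out (𝒢 a.out) : FormalSum k 𝒱 L) c ≠ 0 := by
    by_contra hc
    push Not at hc
    exact h (by simp [hc])
  refine ⟨a.out, ?_, exists_of_glueSum_ne_zero (right_ne_zero_of_mul ha)⟩
  rw [Quotient.out_eq]
  exact left_ne_zero_of_mul ha

/-- Gluing keeps all vertices, so a bound on the legs leaves only finitely many diagrams that can
produce a given result. -/
theorem isFinitary_unop {𝒢 : ∀ Γ : Diagram 𝒱 L, Invol Γ.Leg → Prop} {𝒜 : Set (DiagramClass 𝒱 L)}
    (h : ∀ Θ : Diagram 𝒱 L, ∃ M : ℕ, ∃ 𝓛 : Set L, 𝓛.Finite ∧ ∀ Γ : Diagram 𝒱 L, ⟦Γ⟧ ∈ 𝒜 →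
      ∀ g, 𝒢 Γ g → Iso (Γ.glue g) Θ → Nat.card Γ.Leg ≤ M ∧ ∀ s, Γ.label s ∈ 𝓛) :
    IsFinitary (fun F : FormalSum k 𝒱 L => unop 𝒢 (restrict 𝒜 F)) := by
  intro c
  obtain ⟨M, 𝓛, h𝓛, hb⟩ := h c.out
  have hfin := finite_bounded (Nat.card c.out.Vert) M (Set.finite_range c.out.kind) h𝓛
  have hfin' : {a : DiagramClass 𝒱 L | a ∈ 𝒜 ∧ ∃ g, 𝒢 a.out g ∧ ⟦a.out.glue g⟧ = c}.Finite := by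
    refine hfin.subset ?_
    rintro a ⟨ha, g, hg, hc⟩
    have f : Iso (a.out.glue g) c.out :=
      (Quotient.exact (hc.trans (Quotient.out_eq c).symm)).some
    rw [← Quotient.out_eq a] at ha
    obtain ⟨h1, h2⟩ := hb _ ha g hg f
    refine ⟨a.out, Quotient.out_eq a, ?_, h1, ?_, h2⟩
    · exact Nat.card_le_card_of_injective f.vert f.vert.injective
    · exact fun v => ⟨f.vert v, f.kind_eq v⟩
  refine ⟨∑ a ∈ hfin'.toFinset, Finsupp.single a (if a ∈ 𝒜 then
    (glueSum a.out (𝒢 a.out) : FormalSum k 𝒱 L) c else 0), fun F => ?_⟩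
  beta_reduce
  rw [unop_apply, _root_.map_sum, finsum_eq_sum_of_support_subset (s := hfin'.toFinset)]
  · refine Finset.sum_congr rfl fun a _ => ?_
    rw [eval_single, restrict_apply]
    split_ifs <;> ring
  · intro a ha
    rw [Function.mem_support] at ha
    simp only [Set.Finite.coe_toFinset, Set.mem_ofPred_eq]
    exact ⟨mem_of_restrict_ne_zero (left_ne_zero_of_mul ha),
      exists_of_glueSum_ne_zero (right_ne_zero_of_mul ha)⟩

end FormalSum

end FormalDiagram

end

noncomputable section

namespace FormalDiagram

open Classical Diagram

namespace FormalSum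

/-! ### Product, application, pairing and divergence -/

section Predicates

variable {L Var : Type*}

/-- Nothing is glued. -/
def UnionPred (L : Type*) : GluePred L := fun _ _ _ _ g => g = id

/-- The condition on the gluings in the application of an operator. -/
def ApplyPred (Var : Type*) : GluePred (LegLabel Var) := fun S T l m g =>
  (∀ s : S, ∀ x, l s = .dual x → ∃ t : T, m t = .var x ∧ g (.inl s) = .inr t) ∧
  (∀ s : S, ∀ x, l s = .var x → g (.inl s) = .inl s) ∧
  (∀ t : T, g (.inr t) = .inr t ∨ ∃ s : S, g (.inr t) = .inl s)

/-- The condition on the gluings in a pairing. -/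
def PairPred (X : Finset Var) : GluePred (LegLabel Var) := fun S T l m g =>
  ApplyPred Var S T l m g ∧ ∀ t : T, ∀ x ∈ X, m t = .var x → g (.inr t) ≠ .inr t

theorem natural_unionPred : (UnionPred L).Natural := by
  intro S T S' T' σ τ l m l' m' g g' _ _ hg h
  funext e
  have h1 : Sum.map σ τ (Sum.map σ.symm τ.symm e) = e := by
    rcases e with e | e <;> simp
  rw [← h1, hg, show g = id from h]
  rfl

theorem natural_applyPred : (ApplyPred Var).Natural := by
  rintro S T S' T' σ τ l m l' m' g g' hl hm hg ⟨h1, h2, h3⟩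
  have hgl : ∀ s, g' (.inl (σ s)) = Sum.map σ τ (g (.inl s)) := fun s => hg (.inl s)
  have hgr : ∀ s, g' (.inr (τ s)) = Sum.map σ τ (g (.inr s)) := fun s => hg (.inr s)
  refine ⟨?_, ?_, ?_⟩
  · intro s' x hs
    obtain ⟨s, rfl⟩ := σ.surjective s'
    obtain ⟨t, ht, hst⟩ := h1 s x (by rw [← hl, hs])
    exact ⟨τ t, by rw [hm, ht], by rw [hgl, hst]; rfl⟩
  · intro s' x hs
    obtain ⟨s, rfl⟩ := σ.surjective s'
    rw [hgl, h2 s x (by rw [← hl, hs])]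
    rfl
  · intro t'
    obtain ⟨t, rfl⟩ := τ.surjective t'
    rw [hgr]
    rcases h3 t with h | ⟨s, h⟩
    · left; rw [h]; rfl
    · right; exact ⟨σ s, by rw [h]; rfl⟩

theorem natural_pairPred (X : Finset Var) : (PairPred X).Natural := by
  rintro S T S' T' σ τ l m l' m' g g' hl hm hg ⟨h1, h2⟩
  refine ⟨natural_applyPred σ τ l m l' m' g g' hl hm hg h1, ?_⟩
  intro t' x hx ht h
  obtain ⟨t, rfl⟩ := τ.surjective t'
  refine h2 t x hx (by rw [← hm, ht]) ?_
  have := hg (.inr t)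
  rw [Sum.map_inr, h] at this
  refine Function.Injective.sumMap σ.injective τ.injective ?_
  rw [← this]
  rfl

end Predicates

section Operations

variable {k : Type*} [Field k] {𝒱 : VertexKinds} {L : Type*}

theorem opSum_unionPred (Γ Δ : Diagram 𝒱 L) :
    (opSum (UnionPred L) Γ Δ : FormalSum k 𝒱 L) = single (Γ.union Δ) :=
  glueSum_one _ _ fun _ => Iff.rfl

theorem prod_eq_op (F G : FormalSum k 𝒱 L) : prod F G = op (UnionPred L) F G := by
  funext c
  rw [op_apply, prod, extend₂]
  refine finsum_congr fun p => ?_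
  rw [opSum_unionPred, single_apply]
  split_ifs <;> simp

theorem finitePairs_unionPred : FinitePairs (UnionPred L) (Set.univ : Set (DiagramClass 𝒱 L))
    Set.univ := by
  refine finitePairs_of_bounded fun Θ => ⟨Nat.card Θ.Leg, Set.range Θ.label, Set.finite_range _,
    fun Γ Δ _ _ g hg f => ?_⟩
  have hg : g.1 = id := hg
  have hfree : ∀ s, g.1 s = s := fun s => by rw [hg]; rfl
  refine ⟨Nat.card_le_card_of_injective (fun s => f.leg ⟨s, hfree s⟩) fun s t h => ?_,
    fun s => ⟨f.leg ⟨s, hfree s⟩, f.label_eq _⟩⟩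
  exact congrArg Subtype.val (f.leg.injective h)

theorem restrict_univ (F : FormalSum k 𝒱 L) : restrict Set.univ F = F :=
  restrict_eq_self fun _ _ => trivial

theorem isFinitary_prod_left (G : FormalSum k 𝒱 L) : IsFinitary fun F => prod F G := by
  have := finitePairs_unionPred.isFinitary_left (k := k) (𝒱 := 𝒱) (L := L) G
  simpa only [restrict_univ, ← prod_eq_op] using this

theorem isFinitary_prod_right (F : FormalSum k 𝒱 L) : IsFinitary fun G => prod F G := by
  have := finitePairs_unionPred.isFinitary_right (k := k) (𝒱 := 𝒱) (L := L) F
  simpa only [restrict_univ, ← prod_eq_op] using this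

theorem prod_single (Γ Δ : Diagram 𝒱 L) :
    prod (single Γ) (single Δ) = (single (Γ.union Δ) : FormalSum k 𝒱 L) := by
  rw [prod_eq_op, op_single natural_unionPred, opSum_unionPred]

theorem exists_of_prod_ne_zero {F G : FormalSum k 𝒱 L} {c} (h : prod F G c ≠ 0) :
    ∃ Γ Δ : Diagram 𝒱 L, F ⟦Γ⟧ ≠ 0 ∧ G ⟦Δ⟧ ≠ 0 ∧ (⟦Γ.union Δ⟧ : DiagramClass 𝒱 L) = c := by
  rw [prod_eq_op] at h
  obtain ⟨Γ, Δ, h1, h2, g, hg, hc⟩ := exists_of_op_ne_zero h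
  refine ⟨Γ, Δ, h1, h2, ?_⟩
  have : g = Invol.one _ := Subtype.ext hg
  rw [← hc, this]
  exact (Quotient.sound (glue_one_iso _)).symm

/-- A comparison of diagrams, given bijections of vertices and legs. -/
theorem iso_of_mate {Γ Δ : Diagram 𝒱 L} (vert : Δ.Vert ≃ Γ.Vert) (leg : Δ.Leg ≃ Γ.Leg)
    (kind_eq : ∀ v, Γ.kind (vert v) = Δ.kind v) (label_eq : ∀ s, Γ.label (leg s) = Δ.label s)
    (edge : ∀ e, Γ.mate (endsMap vert kind_eq leg e) = endsMap vert kind_eq leg (Δ.mate e)) :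
    Nonempty (Iso Δ Γ) :=
  ⟨{ vert := vert, leg := leg, kind_eq := kind_eq, label_eq := label_eq, mate_eq := edge }⟩

/-- Disjoint union is associative. -/
def unionAssocIso (Γ Δ Θ : Diagram 𝒱 L) :
    Iso ((Γ.union Δ).union Θ) (Γ.union (Δ.union Θ)) where
  vert := Equiv.sumAssoc _ _ _
  leg := Equiv.sumAssoc _ _ _
  kind_eq := by rintro ((v | v) | v) <;> rfl
  label_eq := by rintro ((v | v) | v) <;> rfl
  mate_eq := by
    intro e
    have h1 : ∀ e, endsMap (Δ := (Γ.union Δ).union Θ) (Γ := Γ.union (Δ.union Θ))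
        (Equiv.sumAssoc _ _ _) (by rintro ((v | v) | v) <;> rfl) (Equiv.sumAssoc _ _ _)
        (unionL _ _ (unionL Γ Δ e)) = unionL _ _ e := by
      rintro (⟨⟨v, i⟩, h⟩ | s) <;> rfl
    have h2 : ∀ e, endsMap (Δ := (Γ.union Δ).union Θ) (Γ := Γ.union (Δ.union Θ))
        (Equiv.sumAssoc _ _ _) (by rintro ((v | v) | v) <;> rfl) (Equiv.sumAssoc _ _ _)
        (unionL _ _ (unionR Γ Δ e)) = unionR _ _ (unionL _ _ e) := by
      rintro (⟨⟨v, i⟩, h⟩ | s) <;> rfl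
    have h3 : ∀ e, endsMap (Δ := (Γ.union Δ).union Θ) (Γ := Γ.union (Δ.union Θ))
        (Equiv.sumAssoc _ _ _) (by rintro ((v | v) | v) <;> rfl) (Equiv.sumAssoc _ _ _)
        (unionR _ _ e) = unionR _ _ (unionR _ _ e) := by
      rintro (⟨⟨v, i⟩, h⟩ | s) <;> rfl
    change (Γ.union (Δ.union Θ)).mate (endsMap (Δ := (Γ.union Δ).union Θ)
        (Γ := Γ.union (Δ.union Θ)) (Equiv.sumAssoc _ _ _) (by rintro ((v | v) | v) <;> rfl)
        (Equiv.sumAssoc _ _ _) e) = endsMap (Δ := (Γ.union Δ).union Θ)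
        (Γ := Γ.union (Δ.union Θ)) (Equiv.sumAssoc _ _ _) (by rintro ((v | v) | v) <;> rfl)
        (Equiv.sumAssoc _ _ _) (((Γ.union Δ).union Θ).mate e)
    induction e using union_ends_cases with
    | hl e =>
      induction e using union_ends_cases with
      | hl e => rw [union_mate_unionL, union_mate_unionL, h1, h1, union_mate_unionL]
      | hr e =>
        rw [union_mate_unionL, union_mate_unionR, h2, h2, union_mate_unionR, union_mate_unionL]
    | hr e => rw [union_mate_unionR, h3, h3, union_mate_unionR, union_mate_unionR]

/-- Both sides are finitary in each argument, which reduces the claim to single diagrams. -/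
theorem prod_assoc (F G H : FormalSum k 𝒱 L) : prod (prod F G) H = prod F (prod G H) := by
  refine IsFinitary.ext ((isFinitary_prod_left H).comp (isFinitary_prod_left G))
    (isFinitary_prod_left (prod G H)) (fun Γ => ?_) F
  refine IsFinitary.ext ((isFinitary_prod_left H).comp (isFinitary_prod_right (single Γ)))
    ((isFinitary_prod_right (single Γ)).comp (isFinitary_prod_left H)) (fun Δ => ?_) G
  refine IsFinitary.ext (isFinitary_prod_right (prod (single Γ) (single Δ)))
    ((isFinitary_prod_right (single Γ)).comp (isFinitary_prod_right (single Δ))) (fun Θ => ?_) H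
  rw [prod_single, prod_single, prod_single, prod_single]
  exact single_congr ⟨unionAssocIso Γ Δ Θ⟩

end Operations

section Functions

variable {k : Type*} [Field k] {𝒱 : VertexKinds} {Var : Type*}

theorem apply_eq_op (D F : FormalSum k 𝒱 (LegLabel Var)) : apply D F = op (ApplyPred Var) D F :=
  rfl

theorem pairing_eq_op (X : Finset Var) (D F : FormalSum k 𝒱 (LegLabel Var)) :
    pairing X D F = op (PairPred X) D F := by
  simp only [pairing, op, PairPred, and_assoc]
  rfl

theorem divergence_eq_unop (z : Var) (D : FormalSum k 𝒱 (LegLabel Var)) :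
    divergence z D = unop (fun Γ => IsDivGluing z Γ) D := rfl

/-- The isomorphism classes of diagrams with a given property. -/
def classOf {L : Type*} (p : Diagram 𝒱 L → Prop) : Set (DiagramClass 𝒱 L) :=
  {a | ∀ Γ, ⟦Γ⟧ = a → p Γ}

/-- Properties that are invariant under isomorphisms. -/
def Invariant {L : Type*} (p : Diagram 𝒱 L → Prop) : Prop := ∀ {Γ Δ}, Iso Γ Δ → p Γ → p Δ

theorem mk_mem_classOf {L : Type*} {p : Diagram 𝒱 L → Prop} (hp : Invariant p) {Γ} :
    (⟦Γ⟧ : DiagramClass 𝒱 L) ∈ classOf p ↔ p Γ :=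
  ⟨fun h => h Γ rfl, fun h _ hΔ => hp (Quotient.exact hΔ.symm).some h⟩

/-- All legs are labeled by variables. -/
def FunctionDiagram (Γ : Diagram 𝒱 (LegLabel Var)) : Prop := ∀ s, ∃ x, Γ.label s = .var x

/-- There are `l` legs labeled `∂_z`, and no other legs with dual labels. -/
def OperatorDiagram (z : Var) (l : ℕ) (Γ : Diagram 𝒱 (LegLabel Var)) : Prop :=
  (∀ s x, Γ.label s = .dual x → x = z) ∧ Nat.card {s // Γ.label s = .dual z} = l

/-- The labels that are members of `X` or their duals. -/
def Over (X : Finset Var) (a : LegLabel Var) : Prop := ∃ x ∈ X, a = .var x ∨ a = .dual x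

/-- There are no struts over `X`. -/
def SubstantialDiagram (X : Finset Var) (Γ : Diagram 𝒱 (LegLabel Var)) : Prop :=
  ∀ s t : Γ.Leg, Γ.mate (.inr s) = .inr t → ¬ (Over X (Γ.label s) ∧ Over X (Γ.label t))

/-- All legs are labeled by duals of members of `X`. -/
def DualDiagram (X : Finset Var) (Γ : Diagram 𝒱 (LegLabel Var)) : Prop :=
  ∀ s, ∃ x ∈ X, Γ.label s = .dual x

theorem invariant_functionDiagram : Invariant (FunctionDiagram (𝒱 := 𝒱) (Var := Var)) := by
  intro Γ Δ f h s
  obtain ⟨s, rfl⟩ := f.leg.surjective s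
  rw [f.label_eq]
  exact h s

theorem invariant_dualDiagram (X : Finset Var) : Invariant (DualDiagram (𝒱 := 𝒱) X) := by
  intro Γ Δ f h s
  obtain ⟨s, rfl⟩ := f.leg.surjective s
  rw [f.label_eq]
  exact h s

theorem invariant_operatorDiagram (z : Var) (l : ℕ) :
    Invariant (OperatorDiagram (𝒱 := 𝒱) z l) := by
  intro Γ Δ f h
  refine ⟨fun s x hs => ?_, ?_⟩
  · obtain ⟨s, rfl⟩ := f.leg.surjective s
    rw [f.label_eq] at hs
    exact h.1 s x hs
  · rw [← h.2]
    exact (Nat.card_congr (f.leg.subtypeEquiv fun s => by rw [f.label_eq])).symm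

theorem Iso.mate_leg {L : Type*} {Γ Δ : Diagram 𝒱 L} (f : Iso Γ Δ) (s t : Γ.Leg) :
    Δ.mate (.inr (f.leg s)) = .inr (f.leg t) ↔ Γ.mate (.inr s) = .inr t := by
  have h := f.mate_endsMap (.inr s)
  have h1 : endsMap f.vert f.kind_eq f.leg (.inr s) = .inr (f.leg s) := rfl
  have h2 : endsMap f.vert f.kind_eq f.leg (.inr t) = .inr (f.leg t) := rfl
  rw [← h1, ← h2, h]
  exact (endsMap_injective f.kind_eq f.vert.injective f.leg.injective).eq_iff

theorem invariant_substantialDiagram (X : Finset Var) :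
    Invariant (SubstantialDiagram (𝒱 := 𝒱) X) := by
  intro Γ Δ f h s t hst
  obtain ⟨s, rfl⟩ := f.leg.surjective s
  obtain ⟨t, rfl⟩ := f.leg.surjective t
  rw [f.label_eq, f.label_eq]
  exact h s t ((Iso.mate_leg f s t).1 hst)

theorem Invariant.and {L : Type*} {p q : Diagram 𝒱 L → Prop} (hp : Invariant p)
    (hq : Invariant q) : Invariant fun Γ => p Γ ∧ q Γ := fun f h => ⟨hp f h.1, hq f h.2⟩

/-- The classes of substantial functions. -/
def functionClasses (𝒱 : VertexKinds) (X : Finset Var) : Set (DiagramClass 𝒱 (LegLabel Var)) :=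
  classOf fun Γ => FunctionDiagram Γ ∧ SubstantialDiagram X Γ

/-- The classes of substantial operators. -/
def operatorClasses (𝒱 : VertexKinds) (X : Finset Var) (z : Var) (l : ℕ) :
    Set (DiagramClass 𝒱 (LegLabel Var)) :=
  classOf fun Γ => OperatorDiagram z l Γ ∧ SubstantialDiagram X Γ

/-- The classes of diagrams with legs labeled by duals of members of `X`. -/
def dualClasses (𝒱 : VertexKinds) (X : Finset Var) : Set (DiagramClass 𝒱 (LegLabel Var)) :=
  classOf (DualDiagram X)

theorem mk_mem_functionClasses {X : Finset Var} {Γ : Diagram 𝒱 (LegLabel Var)} :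
    ⟦Γ⟧ ∈ functionClasses 𝒱 X ↔ FunctionDiagram Γ ∧ SubstantialDiagram X Γ :=
  mk_mem_classOf (Invariant.and invariant_functionDiagram (invariant_substantialDiagram X))

theorem mk_mem_operatorClasses {X : Finset Var} {z : Var} {l : ℕ}
    {Γ : Diagram 𝒱 (LegLabel Var)} :
    ⟦Γ⟧ ∈ operatorClasses 𝒱 X z l ↔ OperatorDiagram z l Γ ∧ SubstantialDiagram X Γ :=
  mk_mem_classOf (Invariant.and (invariant_operatorDiagram z l) (invariant_substantialDiagram X))

theorem mk_mem_dualClasses {X : Finset Var} {Γ : Diagram 𝒱 (LegLabel Var)} :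
    ⟦Γ⟧ ∈ dualClasses 𝒱 X ↔ DualDiagram X Γ :=
  mk_mem_classOf (invariant_dualDiagram X)

theorem restrict_functionClasses {X : Finset Var} {F : FormalSum k 𝒱 (LegLabel Var)}
    (h : F.IsFunction) (h' : F.IsSubstantial X) : restrict (functionClasses 𝒱 X) F = F := by
  refine restrict_eq_self fun c hc Γ hΓ => ?_
  subst hΓ
  exact ⟨h Γ hc, h' Γ hc⟩

theorem restrict_operatorClasses {X : Finset Var} {z : Var} {l : ℕ}
    {F : FormalSum k 𝒱 (LegLabel Var)} (h : F.IsOperator z l) (h' : F.IsSubstantial X) :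
    restrict (operatorClasses 𝒱 X z l) F = F := by
  refine restrict_eq_self fun c hc Γ hΓ => ?_
  subst hΓ
  exact ⟨h Γ hc, h' Γ hc⟩

/-- Every glued pair contains an element with property `p`. A glued element without this property is
recorded by its partner; hence `p` is counted twice. -/
theorem card_le_of_glued {T : Type} [Finite T] (g : Invol T) (p : T → Prop)
    (h : ∀ e, g.1 e ≠ e → p e ∨ p (g.1 e)) :
    Nat.card T ≤ Nat.card {e // g.1 e = e} + (Nat.card {e // p e} + Nat.card {e // p e}) := by
  have hn : ∀ e, g.1 e ≠ e → ¬ p e → p (g.1 e) := fun e he hp => (h e he).resolve_left hp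
  let φ : T → {e // g.1 e = e} ⊕ ({e // p e} ⊕ {e // p e}) := fun e =>
    if h1 : g.1 e = e then .inl ⟨e, h1⟩ else
      if h2 : p e then .inr (.inl ⟨e, h2⟩) else .inr (.inr ⟨g.1 e, hn e h1 h2⟩)
  have hφ : Function.Injective φ := by
    intro e e' he
    simp only [φ] at he
    split_ifs at he
    all_goals simp only [Sum.inl.injEq, Sum.inr.injEq, Subtype.mk.injEq, reduceCtorEq] at he
    · exact he
    · exact he
    · have := congrArg g.1 he
      rwa [g.2, g.2] at this
  have := Nat.card_le_card_of_injective φ hφ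
  rwa [Nat.card_sum, Nat.card_sum] at this

/-- Only the `l` legs `∂_z` and their partners, which are labeled `z`, disappear; all other legs can
be seen in the result. -/
theorem finitePairs_applyPred (X : Finset Var) (z : Var) (l : ℕ) :
    FinitePairs (ApplyPred Var) (operatorClasses 𝒱 X z l) Set.univ := by
  refine finitePairs_of_bounded fun Θ => ⟨Nat.card Θ.Leg + (l + l),
    Set.range Θ.label ∪ {.var z, .dual z}, (Set.finite_range _).union (by simp),
    fun Γ Δ hΓ _ g hg f => ?_⟩
  obtain ⟨⟨hz, hl⟩, -⟩ := mk_mem_operatorClasses.1 hΓ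
  obtain ⟨h1, h2, h3⟩ := hg
  have hdual : ∀ s : Γ.Leg, g.1 (.inl s) ≠ .inl s → Γ.label s = .dual z := by
    intro s hs
    cases hls : Γ.label s with
    | var x => exact absurd (h2 s x hls) hs
    | dual x => rw [hz s x hls]
  have hright : ∀ t : Δ.Leg, g.1 (.inr t) ≠ .inr t →
      ∃ s : Γ.Leg, g.1 (.inr t) = .inl s ∧ Γ.label s = .dual z := by
    intro t ht
    obtain ⟨s, hs⟩ := (h3 t).resolve_left ht
    refine ⟨s, hs, hdual s fun h => ?_⟩
    have := congrArg g.1 hs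
    rw [g.2, h] at this
    cases this
  constructor
  · have h5 := card_le_of_glued g (fun e => ∃ s, e = .inl s ∧ Γ.label s = .dual z) (by
      rintro (s | t) he
      · exact Or.inl ⟨s, rfl, hdual s he⟩
      · exact Or.inr (hright t he))
    have h6 : Nat.card {e : (Γ.union Δ).Leg // ∃ s, e = .inl s ∧ Γ.label s = .dual z} = l := by
      rw [← hl]
      refine (Nat.card_congr (Equiv.ofBijective (fun s => ⟨.inl s.1, s.1, rfl, s.2⟩) ⟨?_, ?_⟩)).symm
      · intro s t h
        exact Subtype.ext (Sum.inl_injective (congrArg Subtype.val h))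
      · rintro ⟨_, s, rfl, hs⟩
        exact ⟨⟨s, hs⟩, rfl⟩
    rw [h6] at h5
    rwa [← Nat.card_congr f.leg]
  · rintro (s | t)
    · by_cases h : g.1 (.inl s) = .inl s
      · exact Or.inl ⟨f.leg ⟨.inl s, h⟩, f.label_eq _⟩
      · exact Or.inr (Or.inr (hdual s h))
    · by_cases h : g.1 (.inr t) = .inr t
      · exact Or.inl ⟨f.leg ⟨.inr t, h⟩, f.label_eq _⟩
      · obtain ⟨s, hs, hd⟩ := hright t h
        obtain ⟨t', ht', hst⟩ := h1 s z hd
        have := congrArg g.1 hs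
        rw [g.2, hst] at this
        cases this
        exact Or.inr (Or.inl ht')

/-- All legs labeled by `X` disappear in a pairing, so they have to be bounded in another way. By
substantiality, the edge at such a leg leads to a flag or to a leg with another label; both of these
survive in the result. With struts over `X` there would be no bound, since closed chains of struts
leave no trace. -/
theorem finitePairs_pairPred (X : Finset Var) :
    FinitePairs (PairPred X) (dualClasses 𝒱 X) (functionClasses 𝒱 X) := by
  -- The function has at most (flags + legs of the result) legs labeled by `X`, and the dual legs
  -- inject into these. The other legs of the function remain free, which gives the last summand.
  refine finitePairs_of_bounded fun Θ => ⟨(Nat.card (Flags 𝒱 Θ.kind) + Nat.card Θ.Leg) +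
      ((Nat.card (Flags 𝒱 Θ.kind) + Nat.card Θ.Leg) + Nat.card Θ.Leg),
    Set.range Θ.label ∪ ((fun x => .var x) '' (X : Set Var) ∪ (fun x => .dual x) '' (X : Set Var)),
    (Set.finite_range _).union ((X.finite_toSet.image _).union (X.finite_toSet.image _)),
    fun Γ Δ hΓ hΔ g hg f => ?_⟩
  have hΓ := mk_mem_dualClasses.1 hΓ
  obtain ⟨hfun, hsub⟩ := mk_mem_functionClasses.1 hΔ
  obtain ⟨⟨h1, h2, h3⟩, h4⟩ := hg
  have hover : ∀ t : Δ.Leg, g.1 (.inr t) ≠ .inr t → ∃ x ∈ X, Δ.label t = .var x := by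
    intro t ht
    obtain ⟨s, hs⟩ := (h3 t).resolve_left ht
    obtain ⟨x, hx, hsx⟩ := hΓ s
    obtain ⟨t', ht', hst⟩ := h1 s x hsx
    have := congrArg g.1 hs
    rw [g.2, hst] at this
    cases this
    exact ⟨x, hx, ht'⟩
  let B := {t : Δ.Leg // ∃ x ∈ X, Δ.label t = .var x}
  have hfree : ∀ t : Δ.Leg, (¬ ∃ x ∈ X, Δ.label t = .var x) → g.1 (.inr t) = .inr t :=
    fun t ht => by
      by_contra h
      exact ht (hover t h)
  have hB : Nat.card B ≤ Nat.card (Flags 𝒱 Θ.kind) + Nat.card Θ.Leg := by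
    let C := {t : Δ.Leg // ¬ ∃ x ∈ X, Δ.label t = .var x}
    have hC : ∀ t : B, ∀ u, Δ.mate (.inr t.1) = .inr u → ¬ ∃ x ∈ X, Δ.label u = .var x := by
      rintro ⟨t, x, hx, ht⟩ u hu ⟨y, hy, huy⟩
      exact hsub t u hu ⟨⟨x, hx, Or.inl ht⟩, ⟨y, hy, Or.inl huy⟩⟩
    have hCcard : Nat.card C ≤ Nat.card Θ.Leg := by
      refine Nat.card_le_card_of_injective (fun t : C => f.leg ⟨.inr t.1, hfree t.1 t.2⟩) ?_
      intro t t' h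
      have := congrArg Subtype.val (f.leg.injective h)
      exact Subtype.ext (Sum.inr_injective this)
    have hF : Nat.card (Flags 𝒱 Δ.kind) ≤ Nat.card (Flags 𝒱 Θ.kind) := by
      refine Nat.card_le_card_of_injective
        (Flags.map (kV := Δ.kind) (kW := Θ.kind) (fun v => f.vert (.inr v))
          (fun v => f.kind_eq (.inr v))) ?_
      rintro ⟨⟨v, i⟩, h⟩ ⟨⟨w, j⟩, h'⟩ e
      have e' := congrArg Subtype.val e
      simp only [Flags.map, Prod.mk.injEq] at e'
      exact Subtype.ext (Prod.ext (Sum.inr_injective (f.vert.injective e'.1)) e'.2)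
    let ψ : Flags 𝒱 Δ.kind ⊕ C → Δ.Ends := Sum.map id Subtype.val
    have hψ : Function.Injective ψ :=
      Function.Injective.sumMap Function.injective_id Subtype.val_injective
    have hex : ∀ t : B, ∃ e, ψ e = Δ.mate (.inr t.1) := by
      intro t
      cases hm : Δ.mate (.inr t.1) with
      | inl p => exact ⟨.inl p, rfl⟩
      | inr u => exact ⟨.inr ⟨u, hC t u hm⟩, rfl⟩
    choose χ hχ using hex
    have := Nat.card_le_card_of_injective χ (fun t t' h => by
      have h5 := hχ t
      rw [h, hχ t'] at h5
      have h6 := congrArg Δ.mate h5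
      rw [Δ.mate_mate, Δ.mate_mate] at h6
      exact Subtype.ext (Sum.inr_injective h6.symm))
    rw [Nat.card_sum] at this
    omega
  have hA : Nat.card Γ.Leg ≤ Nat.card B := by
    have hex : ∀ s : Γ.Leg, ∃ t : B, g.1 (.inl s) = .inr t.1 := by
      intro s
      obtain ⟨x, hx, hs⟩ := hΓ s
      obtain ⟨t, ht, hst⟩ := h1 s x hs
      exact ⟨⟨t, x, hx, ht⟩, hst⟩
    choose χ hχ using hex
    refine Nat.card_le_card_of_injective χ fun s s' h => ?_
    have h5 := hχ s
    rw [h, ← hχ s'] at h5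
    have h6 := congrArg g.1 h5
    rw [g.2, g.2] at h6
    exact Sum.inl_injective h6
  constructor
  · have hΔ : Nat.card Δ.Leg ≤ Nat.card B + Nat.card Θ.Leg := by
      let φ : Δ.Leg → B ⊕ Θ.Leg := fun t =>
        if h : ∃ x ∈ X, Δ.label t = .var x then .inl ⟨t, h⟩ else .inr (f.leg ⟨.inr t, hfree t h⟩)
      have hφ : Function.Injective φ := by
        intro t t' e
        by_cases h : ∃ x ∈ X, Δ.label t = .var x <;> by_cases h' : ∃ x ∈ X, Δ.label t' = .var x
        · simp only [φ, dif_pos h, dif_pos h'] at e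
          exact congrArg Subtype.val (Sum.inl_injective e)
        · simp only [φ, dif_pos h, dif_neg h'] at e
          cases e
        · simp only [φ, dif_neg h, dif_pos h'] at e
          cases e
        · simp only [φ, dif_neg h, dif_neg h'] at e
          have := congrArg Subtype.val (f.leg.injective (Sum.inr_injective e))
          exact Sum.inr_injective this
      have := Nat.card_le_card_of_injective φ hφ
      rwa [Nat.card_sum] at this
    have : Nat.card (Γ.union Δ).Leg = Nat.card Γ.Leg + Nat.card Δ.Leg := Nat.card_sum
    omega
  · rintro (s | t)
    · obtain ⟨x, hx, hs⟩ := hΓ s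
      exact Or.inr (Or.inr ⟨x, hx, hs.symm⟩)
    · by_cases h : g.1 (.inr t) = .inr t
      · exact Or.inl ⟨f.leg ⟨.inr t, h⟩, f.label_eq _⟩
      · obtain ⟨x, hx, ht⟩ := hover t h
        exact Or.inr (Or.inl ⟨x, hx, ht.symm⟩)

theorem natural_isDivGluing (z : Var) :
    NaturalGluing fun Γ : Diagram 𝒱 (LegLabel Var) => IsDivGluing z Γ := by
  rintro Γ Δ f g h hgh ⟨h1, h2⟩
  refine ⟨fun s hs => ?_, fun s hs => ?_⟩
  · obtain ⟨s, rfl⟩ := f.leg.surjective s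
    rw [f.label_eq] at hs
    rw [hgh, f.label_eq]
    exact h1 s hs
  · obtain ⟨s, rfl⟩ := f.leg.surjective s
    rw [f.label_eq] at hs
    rw [hgh, f.label_eq]
    exact (h2 s hs).imp (congrArg f.leg) id

/-- As for the application of operators, at most `2 l` legs disappear, with labels `∂_z` and `z`. -/
theorem isFinitary_divergence (X : Finset Var) (z : Var) (l : ℕ) :
    IsFinitary fun D : FormalSum k 𝒱 (LegLabel Var) =>
      divergence z (restrict (operatorClasses 𝒱 X z l) D) := by
  refine isFinitary_unop fun Θ => ⟨Nat.card Θ.Leg + (l + l),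
    Set.range Θ.label ∪ {.var z, .dual z}, (Set.finite_range _).union (by simp),
    fun Γ hΓ g hg f => ?_⟩
  obtain ⟨⟨hz, hl⟩, -⟩ := mk_mem_operatorClasses.1 hΓ
  obtain ⟨h1, h2⟩ := hg
  constructor
  · have h5 := card_le_of_glued g (fun e => Γ.label e = .dual z) fun e he => by
      by_cases h' : Γ.label e = .dual z
      · exact Or.inl h'
      · exact Or.inr ((h2 e h').resolve_left he)
    rw [hl] at h5
    rwa [← Nat.card_congr f.leg]
  · intro s
    by_cases h : g.1 s = s
    · exact Or.inl ⟨f.leg ⟨s, h⟩, f.label_eq _⟩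
    · by_cases h' : Γ.label s = .dual z
      · exact Or.inr (Or.inr h')
      · have := h1 _ ((h2 s h').resolve_left h)
        rw [g.2] at this
        exact Or.inr (Or.inl this)

end Functions

end FormalSum

end FormalDiagram

end

/-! ### Families of struts, exponentials of quadratics, and gluing a leg to a strut -/

noncomputable section

namespace FormalDiagram

open Classical Diagram

/-- The end of a pair that is chosen by a Boolean. -/
def endOf {Y : Type*} (p : Y × Y) (ε : Bool) : Y := if ε then p.2 else p.1

namespace Diagram

variable {𝒱 : VertexKinds} {L : Type*}

/-- The disjoint union of a finite family of struts. -/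
@[reducible] def struts (𝒱 : VertexKinds) {ι : Type} [Finite ι] (F : ι → L × L) : Diagram 𝒱 L where
  Vert := Empty
  Leg := ι × Bool
  finite_vert := inferInstance
  finite_leg := inferInstance
  kind := Empty.elim
  label := fun s => endOf (F s.1) s.2
  mate := Sum.map id fun s => (s.1, !s.2)
  mate_mate := by
    rintro (⟨⟨v, _⟩, _⟩ | s)
    · exact v.elim
    · simp
  mate_ne := by
    rintro (⟨⟨v, _⟩, _⟩ | s)
    · exact v.elim
    · simp [Prod.ext_iff]

/-- A diagram with other labels. -/
@[reducible] def withLabel {L' : Type*} (Γ : Diagram 𝒱 L) (lab : Γ.Leg → L') : Diagram 𝒱 L' :=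
  { Γ with label := lab }

theorem strut_union_struts_iso {n : ℕ} (p : L × L) (F : Fin n → L × L) :
    Nonempty (Iso ((strut 𝒱 p.1 p.2).union (struts 𝒱 F))
      (struts 𝒱 (Fin.cons p F : Fin (n + 1) → L × L))) := by
  let leg : (Bool ⊕ Fin n × Bool) → Fin (n + 1) × Bool :=
    Sum.elim (fun b => (0, b)) fun s => (s.1.succ, s.2)
  have hleg : Function.Bijective leg := by
    constructor
    · rintro (b | ⟨i, b⟩) (b' | ⟨i', b'⟩) h
      · simpa [leg] using h
      · simp [leg, Prod.ext_iff, (Fin.succ_ne_zero _).symm] at h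
      · simp [leg, Prod.ext_iff] at h
      · simpa [leg] using h
    · rintro ⟨i, b⟩
      refine Fin.cases ⟨.inl b, rfl⟩ (fun i => ⟨.inr (i, b), rfl⟩) i
  refine FormalSum.iso_of_mate (Δ := (strut 𝒱 p.1 p.2).union (struts 𝒱 F))
    (Γ := struts 𝒱 (Fin.cons p F : Fin (n + 1) → L × L)) (Equiv.equivOfIsEmpty _ _)
    (Equiv.ofBijective leg hleg) ?_ ?_ ?_
  · rintro (v | v) <;> exact v.elim
  · rintro (b | ⟨i, b⟩) <;> rfl
  · rintro (⟨⟨v | v, i⟩, h⟩ | b | ⟨i, b⟩)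
    · exact v.elim
    · exact v.elim
    · rfl
    · rfl

theorem empty_iso (F : Fin 0 → L × L) : Nonempty (Iso (empty 𝒱 L) (struts 𝒱 F)) := by
  refine FormalSum.iso_of_mate (Δ := empty 𝒱 L) (Γ := struts 𝒱 F) (Equiv.refl _)
    (Equiv.equivOfIsEmpty _ _) (fun v => v.elim) (fun v => v.elim) ?_
  rintro (⟨⟨v, i⟩, h⟩ | v) <;> exact v.elim

theorem union_empty_iso (Γ Δ : Diagram 𝒱 L) [hv : IsEmpty Δ.Vert] [hl : IsEmpty Δ.Leg] :
    Nonempty (Iso Γ (Γ.union Δ)) := by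
  refine FormalSum.iso_of_mate (Δ := Γ) (Γ := Γ.union Δ) (Equiv.sumEmpty _ _).symm
    (Equiv.sumEmpty _ _).symm (fun _ => rfl) (fun _ => rfl) ?_
  intro e
  have h : ∀ e, endsMap (Δ := Γ) (Γ := Γ.union Δ) (Equiv.sumEmpty _ _).symm (fun _ => rfl)
      (Equiv.sumEmpty _ _).symm e = unionL Γ Δ e := fun _ => rfl
  rw [h, h, union_mate_unionL]

end Diagram

namespace FormalSum

variable {k : Type*} [Field k] {𝒱 : VertexKinds} {L : Type*} {Y : Type*} [Fintype Y]

/-- The labels of the struts of a family of pairs. -/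
abbrev pairLabels {ι : Type} (lbl : Y → L) (f : ι → Y × Y) : ι → L × L :=
  fun i => (lbl (f i).1, lbl (f i).2)

/-- The weighted sum of all disjoint unions of `n` struts, divided by `n!`. -/
def expTerm (𝒱 : VertexKinds) (lbl : Y → L) (w : Y × Y → k) (n : ℕ) : FormalSum k 𝒱 L :=
  (Nat.factorial n : k)⁻¹ •
    ∑ f : Fin n → Y × Y, (∏ i, w (f i)) • single (struts 𝒱 (pairLabels lbl f))

/-- Ordered families of oriented struts avoid multinomial coefficients and symmetry factors; the
factorials remain in `expTerm`. -/
theorem power_eq (lbl : Y → L) (w : Y × Y → k) (n : ℕ) :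
    power (∑ p : Y × Y, w p • single (strut 𝒱 (lbl p.1) (lbl p.2)) : FormalSum k 𝒱 L) n =
      ∑ f : Fin n → Y × Y, (∏ i, w (f i)) • single (struts 𝒱 (pairLabels lbl f)) := by
  induction n with
  | zero =>
    rw [power, Fintype.sum_unique, Fin.prod_univ_zero, one_smul]
    exact single_congr (empty_iso _)
  | succ n ih =>
    rw [power, ih, (isFinitary_prod_left _).map_sum]
    refine Eq.trans ?_ ((Fin.consEquiv fun _ => Y × Y).sum_comp fun f : Fin (n + 1) → Y × Y =>
      (∏ i, w (f i)) • (single (struts 𝒱 (pairLabels lbl f)) : FormalSum k 𝒱 L))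
    refine Eq.trans ?_ (Fintype.sum_prod_type _).symm
    refine Finset.sum_congr rfl fun p _ => ?_
    rw [(isFinitary_prod_right _).map_sum]
    refine Finset.sum_congr rfl fun f _ => ?_
    rw [(isFinitary_prod_left _).map_smul, (isFinitary_prod_right _).map_smul, smul_smul,
      prod_single, single_congr (strut_union_struts_iso (lbl p.1, lbl p.2) (pairLabels lbl f))]
    simp only [Fin.consEquiv_apply, Fin.prod_univ_succ, Fin.cons_zero, Fin.cons_succ]
    congr 3
    funext i
    refine Fin.cases rfl (fun i => ?_) i
    simp [pairLabels]

theorem exp_eq_lsum (lbl : Y → L) (w : Y × Y → k) :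
    exp (∑ p : Y × Y, w p • single (strut 𝒱 (lbl p.1) (lbl p.2)) : FormalSum k 𝒱 L) =
      lsum (expTerm 𝒱 lbl w) := by
  funext c
  rw [exp, lsum_apply]
  refine finsum_congr fun n => ?_
  rw [power_eq, expTerm, smul_apply]

/-- The number of legs of a given diagram bounds the index `n` of the terms in which it occurs. -/
theorem locallyFinite_of_legs {F : ℕ → FormalSum k 𝒱 L} (B : ℕ)
    (h : ∀ n Γ, F n ⟦Γ⟧ ≠ 0 → n ≤ Nat.card Γ.Leg + B) : LocallyFinite F := by
  intro c
  refine (Set.finite_Iic (Nat.card c.out.Leg + B)).subset fun n hn => h n c.out ?_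
  rw [Quotient.out_eq]
  exact hn

theorem exists_of_sum_smul_ne_zero {ι : Type*} {s : Finset ι} {a : ι → k}
    {F : ι → FormalSum k 𝒱 L} {c} (h : (∑ i ∈ s, a i • F i) c ≠ 0) : ∃ i ∈ s, F i c ≠ 0 := by
  rw [sum_apply] at h
  obtain ⟨i, hi, h1⟩ := Finset.exists_ne_zero_of_sum_ne_zero h
  exact ⟨i, hi, right_ne_zero_of_mul h1⟩

theorem single_ne_zero_iff {Γ : Diagram 𝒱 L} {c} :
    (single Γ : FormalSum k 𝒱 L) c ≠ 0 ↔ (⟦Γ⟧ : DiagramClass 𝒱 L) = c := by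
  rw [single_apply]
  split_ifs with h <;> simp [h]

theorem exists_of_expTerm_ne_zero {lbl : Y → L} {w : Y × Y → k} {n : ℕ} {c}
    (h : expTerm 𝒱 lbl w n c ≠ 0) :
    ∃ f : Fin n → Y × Y, (⟦struts 𝒱 (pairLabels lbl f)⟧ : DiagramClass 𝒱 L) = c := by
  rw [expTerm, smul_apply] at h
  obtain ⟨f, _, hf⟩ := exists_of_sum_smul_ne_zero (right_ne_zero_of_mul h)
  exact ⟨f, single_ne_zero_iff.1 hf⟩

theorem locallyFinite_expTerm (lbl : Y → L) (w : Y × Y → k) :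
    LocallyFinite (expTerm 𝒱 lbl w) := by
  refine locallyFinite_of_legs 0 fun n Γ h => ?_
  obtain ⟨f, hf⟩ := exists_of_expTerm_ne_zero h
  rw [← Nat.card_congr (Quotient.exact hf).some.leg, Nat.card_prod, Nat.card_fin]
  simp
  omega

/-! ### Struts that are glued to a diagram -/

/-- The weighted sum of the gluings of `Γ` to `n` struts. -/
def strutSum (Γ : Diagram 𝒱 L) (lbl : Y → L) (w : Y × Y → k) (n : ℕ)
    (P : ∀ _ : Fin n → Y × Y, Invol (Γ.Leg ⊕ Fin n × Bool) → Prop) : FormalSum k 𝒱 L :=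
  ∑ f : Fin n → Y × Y, (∏ i, w (f i)) • glueSum (Γ.union (struts 𝒱 (pairLabels lbl f))) (P f)

/-- The inclusion of the legs that remain when one end of the strut `i` is glued to the leg `a`,
which then stands for the other end `(i, b)` of this strut. -/
def absorbMap {S : Type} (a : S) {n : ℕ} (i : Fin (n + 1)) (b : Bool) :
    S ⊕ Fin n × Bool → S ⊕ Fin (n + 1) × Bool :=
  Sum.elim (fun s => if s = a then .inr (i, b) else .inl s) fun s => .inr (i.succAbove s.1, s.2)

theorem absorbMap_injective {S : Type} (a : S) {n : ℕ} (i : Fin (n + 1)) (b : Bool) :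
    Function.Injective (absorbMap a i b) := by
  rintro (s | ⟨j, δ⟩) (s' | ⟨j', δ'⟩) h
  · simp only [absorbMap, Sum.elim_inl] at h
    split_ifs at h with h1 h2 h2
    · rw [h1, h2]
    · exact congrArg Sum.inl (Sum.inl_injective h)
  · simp only [absorbMap, Sum.elim_inl, Sum.elim_inr] at h
    split_ifs at h with h1
    have := (Prod.ext_iff.1 (Sum.inr_injective h)).1
    exact absurd this.symm (Fin.succAbove_ne i j')
  · simp only [absorbMap, Sum.elim_inl, Sum.elim_inr] at h
    split_ifs at h with h1
    have := (Prod.ext_iff.1 (Sum.inr_injective h)).1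
    exact absurd this (Fin.succAbove_ne i j)
  · simp only [absorbMap, Sum.elim_inr, Sum.inr.injEq, Prod.mk.injEq] at h
    rw [Fin.succAbove_right_injective h.1, h.2]

theorem absorbMap_self {S : Type} (a : S) {n : ℕ} (i : Fin (n + 1)) (b : Bool) :
    absorbMap a i b (.inl a) = .inr (i, b) := if_pos rfl

theorem absorbMap_inl {S : Type} {a s : S} (h : s ≠ a) {n : ℕ} (i : Fin (n + 1)) (b : Bool) :
    absorbMap a i b (.inl s) = .inl s := if_neg h

theorem absorbMap_inr {S : Type} (a : S) {n : ℕ} (i : Fin (n + 1)) (b : Bool) (j : Fin n)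
    (δ : Bool) : absorbMap a i b (.inr (j, δ)) = .inr (i.succAbove j, δ) := rfl

/-- Only the two legs that are glued to each other are missed: `a` and the near end `(i, !b)` of the
strut. The leg `a` of the smaller diagram goes to the far end `(i, b)`. -/
theorem absorbMap_cases {S : Type} (a : S) {n : ℕ} (i : Fin (n + 1)) (b : Bool)
    (t : S ⊕ Fin (n + 1) × Bool) :
    t = .inl a ∨ t = .inr (i, !b) ∨ ∃ s, absorbMap a i b s = t := by
  rcases t with s | ⟨j, δ⟩
  · by_cases h : s = a
    · exact Or.inl (by rw [h])
    · exact Or.inr (Or.inr ⟨.inl s, absorbMap_inl h i b⟩)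
  · by_cases h : j = i
    · subst h
      by_cases h' : δ = b
      · exact Or.inr (Or.inr ⟨.inl a, by rw [absorbMap_self, h']⟩)
      · refine Or.inr (Or.inl ?_)
        rw [Bool.eq_not_of_ne h']
    · obtain ⟨j, rfl⟩ := Fin.exists_succAbove_eq h
      exact Or.inr (Or.inr ⟨.inr (j, δ), rfl⟩)

/-- The gluing of the leg `a` to one end of the strut `i`. -/
def absorbInvol {S : Type} (a : S) {n : ℕ} (i : Fin (n + 1)) (b : Bool) :
    Invol (S ⊕ Fin (n + 1) × Bool) :=
  ⟨Equiv.swap (.inl a) (.inr (i, !b)), fun s => Equiv.swap_apply_self _ _ s⟩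

/-- Gluing one end of a strut to a leg `a` amounts to a change of the label of `a`. -/
theorem glueSum_absorb (Γ : Diagram 𝒱 L) (lab lab' : Γ.Leg → L) (a : Γ.Leg) {n : ℕ}
    (F : Fin (n + 1) → L × L) (F' : Fin n → L × L) (i : Fin (n + 1)) (b : Bool)
    (hF : ∀ j, F (i.succAbove j) = F' j)
    (P : Invol (Γ.Leg ⊕ Fin n × Bool) → Prop) (P' : Invol (Γ.Leg ⊕ Fin (n + 1) × Bool) → Prop)
    (hP' : ∀ h, P' h → h.1 (.inl a) = .inr (i, !b))
    (iff : ∀ (h : Invol (Γ.Leg ⊕ Fin n × Bool)) (h' : Invol (Γ.Leg ⊕ Fin (n + 1) × Bool)),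
      (∀ s, h'.1 (absorbMap a i b s) = absorbMap a i b (h.1 s)) →
      h'.1 (.inl a) = .inr (i, !b) → (P h ↔ P' h'))
    (hlab : ∀ h, P h → ∀ s, h.1 (.inl s) = .inl s →
      lab' s = if s = a then endOf (F i) b else lab s) :
    (glueSum ((Γ.withLabel lab').union (struts 𝒱 F')) P : FormalSum k 𝒱 L) =
      glueSum ((Γ.withLabel lab).union (struts 𝒱 F)) P' := by
  have hrange : ∀ t, (∀ s, absorbMap a i b s ≠ t) → t = .inl a ∨ t = .inr (i, !b) := by
    intro t ht
    rcases absorbMap_cases a i b t with h | h | ⟨s, hs⟩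
    · exact Or.inl h
    · exact Or.inr h
    · exact absurd hs (ht s)
  have hna : ∀ s, absorbMap a i b s ≠ .inl a := by
    rintro (s | s) h
    · simp only [absorbMap, Sum.elim_inl] at h
      split_ifs at h with h1
      exact h1 (Sum.inl_injective h)
    · cases h
  have hnb : ∀ s, absorbMap a i b s ≠ .inr (i, !b) := by
    rintro (s | s) h
    · simp only [absorbMap, Sum.elim_inl] at h
      split_ifs at h with h1
      simp at h
    · exact Fin.succAbove_ne i s.1 (Prod.ext_iff.1 (Sum.inr_injective h)).1
  refine glueSum_eq (Γ := (Γ.withLabel lab).union (struts 𝒱 F))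
    (Δ := (Γ.withLabel lab').union (struts 𝒱 F')) P P' (Equiv.refl _) (fun _ => rfl)
    (leg := absorbMap a i b) (absorbMap_injective a i b) (absorbInvol a i b) ?_ ?_ ?_ ?_ ?_ ?_
  · intro s
    exact ⟨s, Equiv.swap_apply_of_ne_of_ne (hna s) (hnb s)⟩
  · intro t ht
    rcases hrange t ht with rfl | rfl
    · change Equiv.swap _ _ _ ≠ _
      rw [Equiv.swap_apply_left]
      simp
    · change Equiv.swap _ _ _ ≠ _
      rw [Equiv.swap_apply_right]
      simp
  · intro h hh t ht
    rcases hrange t ht with rfl | rfl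
    · rw [hP' h hh]
      exact (Equiv.swap_apply_left _ _).symm
    · rw [← hP' h hh, h.2, hP' h hh]
      exact (Equiv.swap_apply_right _ _).symm
  · intro h h' hon hoff
    refine iff h h' hon ?_
    rw [hoff _ hna]
    exact Equiv.swap_apply_left _ _
  · rintro h hh (s | ⟨j, δ⟩) hs
    · have := hlab h hh s hs
      by_cases hsa : s = a
      · rw [if_pos hsa] at this
        rw [hsa, absorbMap_self]
        rw [hsa] at this
        exact this.symm
      · rw [if_neg hsa] at this
        rw [absorbMap_inl hsa]
        exact this.symm
    · change endOf (F (i.succAbove j)) δ = endOf (F' j) δ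
      rw [hF]
  · intro h' hoff e
    have hα : h'.1 (.inl a) = .inr (i, !b) := by
      rw [hoff _ hna]
      exact Equiv.swap_apply_left _ _
    have hβ : h'.1 (.inr (i, !b)) = .inl a := by rw [← hα, h'.2]
    set M : ((Γ.withLabel lab').union (struts 𝒱 F')).Ends →
        ((Γ.withLabel lab).union (struts 𝒱 F)).Ends :=
      endsMap (Δ := (Γ.withLabel lab').union (struts 𝒱 F'))
        (Γ := (Γ.withLabel lab).union (struts 𝒱 F)) (Equiv.refl _) (fun _ => rfl)
        (absorbMap a i b) with hM
    have hstrut : ∀ j δ, ((Γ.withLabel lab).union (struts 𝒱 F)).mate (.inr (.inr (j, δ))) =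
        .inr (.inr (j, !δ)) := fun j δ =>
      union_mate_unionR (Γ.withLabel lab) (struts 𝒱 F) (.inr (j, δ))
    induction e using union_ends_cases with
    | hl e =>
      rw [union_mate_unionL]
      have hne : ∀ e : Γ.Ends, e ≠ .inr a → M (unionL (Γ.withLabel lab') (struts 𝒱 F') e) =
          unionL (Γ.withLabel lab) (struts 𝒱 F) e := by
        rintro (⟨⟨v, i⟩, h⟩ | s) he
        · rfl
        · exact congrArg Sum.inr (absorbMap_inl (fun h => he (by rw [h])) i b)
      have ha : M (unionL (Γ.withLabel lab') (struts 𝒱 F') (.inr a)) = .inr (.inr (i, b)) :=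
        congrArg Sum.inr (absorbMap_self a i b)
      -- From the far end, along the strut and across the gluing, one gets to `a`, and back again.
      -- So an edge of `Γ` that ends at `a` is prolonged to the far end.
      have w1 : GlueWalk ((Γ.withLabel lab).union (struts 𝒱 F)) h' (.inr (.inr (i, b)))
          (.inr (.inl a)) := by
        refine (Walk.left _).trans ?_
        rw [hstrut]
        have := Walk.right (α := ((Γ.withLabel lab).union (struts 𝒱 F)).mate)
          (g := Sum.map id h'.1) (.inr (.inr (i, !b)))
        rwa [Sum.map_inr, hβ] at this
      have w2 : GlueWalk ((Γ.withLabel lab).union (struts 𝒱 F)) h' (.inr (.inl a))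
          (.inr (.inr (i, b))) := by
        have := Walk.right (α := ((Γ.withLabel lab).union (struts 𝒱 F)).mate)
          (g := Sum.map id h'.1) (.inr (.inl a))
        rw [Sum.map_inr, hα] at this
        refine this.trans ?_
        have := Walk.left (α := ((Γ.withLabel lab).union (struts 𝒱 F)).mate)
          (g := Sum.map id h'.1) (.inr (.inr (i, !b)))
        rwa [hstrut, Bool.not_not] at this
      have w3 : ∀ e : Γ.Ends, GlueWalk ((Γ.withLabel lab).union (struts 𝒱 F)) h'
          (unionL (Γ.withLabel lab) (struts 𝒱 F) e)
          (unionL (Γ.withLabel lab) (struts 𝒱 F) (Γ.mate e)) := by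
        intro e
        have := Walk.left (α := ((Γ.withLabel lab).union (struts 𝒱 F)).mate)
          (g := Sum.map id h'.1) (unionL (Γ.withLabel lab) (struts 𝒱 F) e)
        rwa [union_mate_unionL] at this
      by_cases h1 : e = .inr a
      · subst h1
        have h2 : Γ.mate (.inr a) ≠ .inr a := Γ.mate_ne _
        rw [ha]
        change GlueWalk _ _ _ (M (unionL (Γ.withLabel lab') (struts 𝒱 F') (Γ.mate (.inr a))))
        rw [hne _ h2]
        exact w1.trans (w3 (.inr a))
      · rw [hne e h1]
        by_cases h2 : Γ.mate e = .inr a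
        · have h3 := w3 e
          rw [h2] at h3
          change GlueWalk _ _ _ (M (unionL (Γ.withLabel lab') (struts 𝒱 F') (Γ.mate e)))
          rw [h2, ha]
          exact h3.trans w2
        · change GlueWalk _ _ _ (M (unionL (Γ.withLabel lab') (struts 𝒱 F') (Γ.mate e)))
          rw [hne _ h2]
          exact w3 e
    | hr e =>
      rw [union_mate_unionR]
      rcases e with ⟨⟨v, _⟩, _⟩ | ⟨j, δ⟩
      · exact v.elim
      · have := Walk.left (α := ((Γ.withLabel lab).union (struts 𝒱 F)).mate)
          (g := Sum.map id h'.1) (.inr (.inr (i.succAbove j, δ)))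
        rw [hstrut] at this
        exact this

/-- Extraction of a strut that is glued to a given leg. -/
theorem strutSum_succ (Γ : Diagram 𝒱 L) (lbl : Y → L) {w : Y × Y → k}
    (hw : ∀ x y, w (x, y) = w (y, x)) (n : ℕ)
    (P : ∀ _ : Fin (n + 1) → Y × Y, Invol (Γ.Leg ⊕ Fin (n + 1) × Bool) → Prop) (a : Γ.Leg)
    (ha : ∀ f h, P f h → ∃ e, h.1 (.inl a) = .inr e) (x : Y) (T : Y → FormalSum k 𝒱 L)
    (hT : ∀ i b y, ∑ f : Fin n → Y × Y, (∏ j, w (f j)) •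
      glueSum (Γ.union (struts 𝒱 (pairLabels lbl (i.insertNth y f))))
        (fun h => P (i.insertNth y f) h ∧ h.1 (.inl a) = .inr (i, !b)) =
      if endOf y (!b) = x then T (endOf y b) else 0) :
    strutSum Γ lbl w (n + 1) P = (2 * (n + 1) : k) • ∑ y, w (x, y) • T y := by
  -- The gluings are sorted by the strut end at which `a` arrives. There are `2 (n + 1)` ends, which
  -- all contribute the same amount; this is the factor in the statement.
  have h1 : ∀ f, (glueSum (Γ.union (struts 𝒱 (pairLabels lbl f))) (P f) : FormalSum k 𝒱 L) =
      ∑ e : Fin (n + 1) × Bool, glueSum (Γ.union (struts 𝒱 (pairLabels lbl f)))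
        fun h => P f h ∧ h.1 (.inl a) = .inr (e.1, !e.2) := by
    intro f
    simp only [glueSum]
    rw [← Finset.sum_biUnion]
    · refine Finset.sum_congr ?_ fun _ _ => rfl
      ext h
      simp only [Finset.mem_filter, Finset.mem_univ, true_and, Finset.mem_biUnion]
      constructor
      · intro hh
        obtain ⟨⟨i, b⟩, he⟩ := ha f h hh
        exact ⟨(i, !b), hh, by rw [Bool.not_not, he]⟩
      · rintro ⟨_, hh, _⟩
        exact hh
    · intro e _ e' _ hne
      refine Finset.disjoint_left.2 fun h hh hh' => hne ?_
      simp only [Finset.mem_filter, Finset.mem_univ, true_and] at hh hh'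
      have := hh.2.symm.trans hh'.2
      simpa [Prod.ext_iff] using this
  have h2 : ∀ (i : Fin (n + 1)) (b : Bool), ∑ f : Fin (n + 1) → Y × Y, (∏ j, w (f j)) •
      (glueSum (Γ.union (struts 𝒱 (pairLabels lbl f)))
        (fun h => P f h ∧ h.1 (.inl a) = .inr (i, !b)) : FormalSum k 𝒱 L) =
      ∑ y, w (x, y) • T y := by
    intro i b
    rw [← (Fin.insertNthEquiv (fun _ => Y × Y) i).sum_comp, Fintype.sum_prod_type]
    have h3 : ∀ y : Y × Y, ∑ f : Fin n → Y × Y,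
        (∏ j, w ((Fin.insertNthEquiv (fun _ => Y × Y) i) (y, f) j)) •
        (glueSum (Γ.union (struts 𝒱 (pairLabels lbl
          ((Fin.insertNthEquiv (fun _ => Y × Y) i) (y, f)))))
          (fun h => P ((Fin.insertNthEquiv (fun _ => Y × Y) i) (y, f)) h ∧
            h.1 (.inl a) = .inr (i, !b)) : FormalSum k 𝒱 L) =
        if endOf y (!b) = x then w y • T (endOf y b) else 0 := by
      intro y
      have h4 := congrArg (w y • ·) (hT i b y)
      simp only [Finset.smul_sum, smul_smul] at h4
      rw [← smul_ite_zero, ← h4]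
      refine Finset.sum_congr rfl fun f _ => ?_
      simp only [Fin.insertNthEquiv_apply, Fin.prod_univ_succAbove _ i, Fin.insertNth_apply_same,
        Fin.insertNth_apply_succAbove]
      rfl
    rw [Finset.sum_congr rfl fun y _ => h3 y, Fintype.sum_prod_type]
    -- The near end is the second or the first component of the pair of variables at the strut. The
    -- symmetry of `w` makes the two cases agree.
    cases b
    · simp only [endOf, Bool.not_false, if_true, Bool.false_eq_true, if_false]
      refine Finset.sum_congr rfl fun y _ => ?_
      rw [Finset.sum_ite_eq' Finset.univ x, if_pos (Finset.mem_univ _), hw]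
    · simp only [endOf, Bool.not_true, if_true, Bool.false_eq_true, if_false]
      rw [Finset.sum_comm]
      refine Finset.sum_congr rfl fun y _ => ?_
      rw [Finset.sum_ite_eq' Finset.univ x, if_pos (Finset.mem_univ _)]
  simp only [strutSum, h1, Finset.smul_sum]
  rw [Finset.sum_comm]
  simp only [← Finset.smul_sum]
  rw [Finset.sum_congr rfl fun e _ => h2 e.1 e.2, Finset.sum_const, Finset.card_univ,
    Fintype.card_prod, Fintype.card_fin, Fintype.card_bool, ← Nat.cast_smul_eq_nsmul k]
  push_cast
  rw [mul_comm]

end FormalSum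

end FormalDiagram

end

/-! ### Combinatorics of partially completed gluings -/

noncomputable section

namespace FormalDiagram

open Classical Diagram

namespace Invol

variable {T : Type}

/-- The involution `g`, followed by the transposition of `a` and `c` (if this is an involution). -/
def pairUp (g : Invol T) (a c : T) : Invol T :=
  if h : ∀ t, Equiv.swap a c (g.1 (Equiv.swap a c (g.1 t))) = t then
    ⟨fun t => Equiv.swap a c (g.1 t), h⟩ else g

theorem pairUp_apply {g : Invol T} {a c : T} (h : g.1 a = a ∧ g.1 c = c ∨ g.1 a = c) (t : T) :
    (pairUp g a c).1 t = Equiv.swap a c (g.1 t) := by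
  have H : ∀ t, Equiv.swap a c (g.1 (Equiv.swap a c (g.1 t))) = t := by
    have hs : ∀ t, g.1 (Equiv.swap a c t) = Equiv.swap a c (g.1 t) := by
      intro t
      rcases h with ⟨ha, hc⟩ | h
      · by_cases h1 : t = a
        · rw [h1, Equiv.swap_apply_left, ha, Equiv.swap_apply_left, hc]
        by_cases h2 : t = c
        · rw [h2, Equiv.swap_apply_right, hc, Equiv.swap_apply_right, ha]
        rw [Equiv.swap_apply_of_ne_of_ne h1 h2, Equiv.swap_apply_of_ne_of_ne]
        · exact fun e => h1 (by rw [← g.2 t, e, ha])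
        · exact fun e => h2 (by rw [← g.2 t, e, hc])
      · have hc : g.1 c = a := by rw [← h, g.2]
        by_cases h1 : t = a
        · rw [h1, Equiv.swap_apply_left, h, Equiv.swap_apply_right, hc]
        by_cases h2 : t = c
        · rw [h2, Equiv.swap_apply_right, hc, Equiv.swap_apply_left, h]
        rw [Equiv.swap_apply_of_ne_of_ne h1 h2, Equiv.swap_apply_of_ne_of_ne]
        · exact fun e => h2 (by rw [← g.2 t, e, h])
        · exact fun e => h1 (by rw [← g.2 t, e, hc])
    intro t
    rw [hs, Equiv.swap_apply_self, g.2]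
  rw [pairUp, dif_pos H]

theorem pairUp_left {g : Invol T} {a c : T} (ha : g.1 a = a) (hc : g.1 c = c) :
    (pairUp g a c).1 a = c := by
  rw [pairUp_apply (Or.inl ⟨ha, hc⟩), ha, Equiv.swap_apply_left]

theorem pairUp_right {g : Invol T} {a c : T} (ha : g.1 a = a) (hc : g.1 c = c) :
    (pairUp g a c).1 c = a := by
  rw [pairUp_apply (Or.inl ⟨ha, hc⟩), hc, Equiv.swap_apply_right]

theorem pairUp_of_ne {g : Invol T} {a c t : T} (ha : g.1 a = a) (hc : g.1 c = c) (h1 : t ≠ a)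
    (h2 : t ≠ c) : (pairUp g a c).1 t = g.1 t := by
  rw [pairUp_apply (Or.inl ⟨ha, hc⟩), Equiv.swap_apply_of_ne_of_ne]
  · exact fun e => h1 (by rw [← g.2 t, e, ha])
  · exact fun e => h2 (by rw [← g.2 t, e, hc])

theorem pairUp_pairUp {g : Invol T} {a c : T} (h : g.1 a = a ∧ g.1 c = c ∨ g.1 a = c) :
    pairUp (pairUp g a c) a c = g := by
  refine Subtype.ext (funext fun t => ?_)
  have h' : (pairUp g a c).1 a = a ∧ (pairUp g a c).1 c = c ∨ (pairUp g a c).1 a = c := by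
    rcases h with ⟨ha, hc⟩ | h
    · exact Or.inr (pairUp_left ha hc)
    · have hc : g.1 c = a := by rw [← h, g.2]
      refine Or.inl ⟨?_, ?_⟩
      · rw [pairUp_apply (Or.inr h), h, Equiv.swap_apply_right]
      · rw [pairUp_apply (Or.inr h), hc, Equiv.swap_apply_left]
  rw [pairUp_apply h', pairUp_apply h, Equiv.swap_apply_self]

/-- Sums over involutions that exchange `a` and `c` are sums over involutions that fix `a`, `c`. -/
theorem sum_pairUp [Finite T] {M : Type*} [AddCommMonoid M] (a c : T) (P P' : Invol T → Prop)
    (F : Invol T → M) (hP : ∀ h, P h → h.1 a = a ∧ h.1 c = c) (hP' : ∀ h, P' h → h.1 a = c)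
    (iff : ∀ h : Invol T, h.1 a = a → h.1 c = c → (P h ↔ P' (pairUp h a c))) :
    ∑ h with P h, F (pairUp h a c) = ∑ h with P' h, F h := by
  refine Finset.sum_bij' (fun h _ => pairUp h a c) (fun h _ => pairUp h a c) ?_ ?_ ?_ ?_ ?_
  · intro h hh
    simp only [Finset.mem_filter, Finset.mem_univ, true_and] at hh ⊢
    exact (iff h (hP h hh).1 (hP h hh).2).1 hh
  · intro h hh
    simp only [Finset.mem_filter, Finset.mem_univ, true_and] at hh ⊢
    have h1 := hP' h hh
    have hc : h.1 c = a := by rw [← h1, h.2]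
    refine (iff _ ?_ ?_).2 ?_
    · rw [pairUp_apply (Or.inr h1), h1, Equiv.swap_apply_right]
    · rw [pairUp_apply (Or.inr h1), hc, Equiv.swap_apply_left]
    · rwa [pairUp_pairUp (Or.inr h1)]
  · intro h hh
    simp only [Finset.mem_filter, Finset.mem_univ, true_and] at hh
    exact pairUp_pairUp (Or.inl (hP h hh))
  · intro h hh
    simp only [Finset.mem_filter, Finset.mem_univ, true_and] at hh
    exact pairUp_pairUp (Or.inr (hP' h hh))
  · intro h _
    rfl

end Invol

open Invol

/-! ### Admissible gluings -/

section Admissible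

variable {S E Var : Type*}

/-- The gluings that extend `g`, in which all legs in `A` are glued to legs in `Z` or `Ze`, and
nothing else is glued. -/
def ApplyAdm (A : Finset S) (g : S → S) (Z : Finset S) (Ze : E → Prop) (h : S ⊕ E → S ⊕ E) :
    Prop :=
  (∀ s, g s ≠ s → h (.inl s) = .inl (g s)) ∧
  (∀ a ∈ A, (∃ c ∈ Z, h (.inl a) = .inl c) ∨ ∃ e, Ze e ∧ h (.inl a) = .inr e) ∧
  (∀ s ∉ A, g s = s → h (.inl s) = .inl s ∨ ∃ a ∈ A, h (.inl s) = .inl a) ∧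
  (∀ e, h (.inr e) = .inr e ∨ ∃ a ∈ A, h (.inr e) = .inl a)

/-- The gluings that extend `g`, in which all legs in `E` are glued to legs with the same label, all
legs with labels in `X` are glued to legs in `E`, and nothing else is glued. -/
def PairAdm {X : Finset Var} (g : S → S) (lab : S → LegLabel Var) (labE : E → X)
    (h : S ⊕ E → S ⊕ E) : Prop :=
  (∀ s, g s ≠ s → h (.inl s) = .inl (g s)) ∧
  (∀ e, ∃ s, g s = s ∧ lab s = .var (labE e).1 ∧ h (.inr e) = .inl s) ∧
  (∀ s, g s = s → (∀ x ∈ X, lab s ≠ .var x) → h (.inl s) = .inl s) ∧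
  (∀ s, g s = s → ∀ x ∈ X, lab s = .var x → ∃ e, h (.inl s) = .inr e)

/-- The gluings that extend `g`, in which all legs in `A` are glued to legs labeled `z` that are not
in `Z`, and nothing else is glued. -/
def DivAdm (A : Finset S) (g : S → S) (lab : S → LegLabel Var) (z : Var) (Z : Finset S)
    (h : S → S) : Prop :=
  (∀ s, g s ≠ s → h s = g s) ∧
  (∀ a ∈ A, g (h a) = h a ∧ lab (h a) = .var z ∧ h a ∉ Z) ∧
  (∀ s ∉ A, g s = s → h s = s ∨ h s ∈ A)

end Admissible

section Absorb

variable {S : Type} {n : ℕ} {a : S} {i : Fin (n + 1)} {b : Bool}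

theorem absorbMap_eq_inl {t : S ⊕ Fin n × Bool} {s : S} :
    FormalSum.absorbMap a i b t = .inl s ↔ t = .inl s ∧ s ≠ a := by
  constructor
  · intro h
    rcases t with t | t
    · simp only [FormalSum.absorbMap, Sum.elim_inl] at h
      split_ifs at h with h1
      cases h
      exact ⟨rfl, h1⟩
    · cases h
  · rintro ⟨rfl, h⟩
    exact FormalSum.absorbMap_inl h i b

theorem absorbMap_eq_self {t : S ⊕ Fin n × Bool} :
    FormalSum.absorbMap a i b t = .inr (i, b) ↔ t = .inl a := by
  rw [← FormalSum.absorbMap_self a i b, (FormalSum.absorbMap_injective a i b).eq_iff]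

theorem absorbMap_eq_inr {t : S ⊕ Fin n × Bool} {j : Fin n} {δ : Bool} :
    FormalSum.absorbMap a i b t = .inr (i.succAbove j, δ) ↔ t = .inr (j, δ) := by
  rw [← FormalSum.absorbMap_inr a i b, (FormalSum.absorbMap_injective a i b).eq_iff]

theorem strutEnd_cases (i : Fin (n + 1)) (b : Bool) (e : Fin (n + 1) × Bool) :
    e = (i, !b) ∨ e = (i, b) ∨ ∃ j δ, e = (i.succAbove j, δ) := by
  obtain ⟨j, δ⟩ := e
  by_cases h : j = i
  · subst h
    by_cases h' : δ = b
    · exact Or.inr (Or.inl (by rw [h']))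
    · exact Or.inl (by rw [Bool.eq_not_of_ne h'])
  · obtain ⟨j, rfl⟩ := Fin.exists_succAbove_eq h
    exact Or.inr (Or.inr ⟨j, δ, rfl⟩)

variable {h : Invol (S ⊕ Fin n × Bool)} {h' : Invol (S ⊕ Fin (n + 1) × Bool)}

/-- Once `a` is glued to the near end `(i, !b)`, it stands for the far end and has no further
obligation. If the far end is an admissible target, other legs in `A` may still be glued to it,
which is why `a` then joins `Z`. -/
theorem applyAdm_absorb {A Z : Finset S} {g : Invol S} {Ze : Fin (n + 1) × Bool → Prop}
    (haA : a ∉ A) (haZ : a ∉ Z) (ha : g.1 a = a) (hz : Ze (i, !b))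
    (hon : ∀ s, h'.1 (FormalSum.absorbMap a i b s) = FormalSum.absorbMap a i b (h.1 s))
    (hh : h'.1 (.inl a) = .inr (i, !b)) :
    ApplyAdm A g.1 (if Ze (i, b) then insert a Z else Z) (fun e => Ze (i.succAbove e.1, e.2)) h.1 ↔
      ApplyAdm (insert a A) g.1 Z Ze h'.1 := by
  have hself : h'.1 (.inr (i, b)) = FormalSum.absorbMap a i b (h.1 (.inl a)) := by
    rw [← hon, FormalSum.absorbMap_self]
  have hinl : ∀ s, s ≠ a → h'.1 (.inl s) = FormalSum.absorbMap a i b (h.1 (.inl s)) := by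
    intro s hs
    rw [← hon, FormalSum.absorbMap_inl hs]
  have hinr : ∀ j δ, h'.1 (.inr (i.succAbove j, δ)) =
      FormalSum.absorbMap a i b (h.1 (.inr (j, δ))) := by
    intro j δ
    rw [← hon, FormalSum.absorbMap_inr]
  have hback : h'.1 (.inr (i, !b)) = .inl a := by rw [← hh, h'.2]
  have hinj : ∀ s t, h'.1 s = h'.1 t → s = t := fun s t e => by rw [← h'.2 s, e, h'.2]
  have hga : ∀ s, g.1 s ≠ s → s ≠ a ∧ g.1 s ≠ a := by
    intro s hs
    refine ⟨fun e => hs (by rw [e, ha]), fun e => hs ?_⟩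
    have := congrArg g.1 e
    rw [g.2, ha] at this
    rw [this, ha]
  constructor
  · rintro ⟨h1, h2, h3, h4⟩
    refine ⟨fun s hs => ?_, fun s hs => ?_, fun s hs hgs => ?_, fun e => ?_⟩
    · rw [hinl s (hga s hs).1, h1 s hs, absorbMap_eq_inl]
      exact ⟨rfl, (hga s hs).2⟩
    · rcases Finset.mem_insert.1 hs with rfl | hs
      · exact Or.inr ⟨_, hz, hh⟩
      · have hsa : s ≠ a := fun e => haA (e ▸ hs)
        rw [hinl s hsa]
        rcases h2 s hs with ⟨c, hc, hsc⟩ | ⟨⟨j, δ⟩, he, hse⟩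
        · by_cases hca : c = a
          · subst hca
            split_ifs at hc with h5
            · exact Or.inr ⟨(i, b), h5, by rw [hsc, FormalSum.absorbMap_self]⟩
            · exact absurd hc haZ
          · refine Or.inl ⟨c, ?_, by rw [hsc, FormalSum.absorbMap_inl hca]⟩
            split_ifs at hc
            · exact (Finset.mem_insert.1 hc).resolve_left hca
            · exact hc
        · exact Or.inr ⟨_, he, by rw [hse, FormalSum.absorbMap_inr]⟩
    · rw [Finset.mem_insert, not_or] at hs
      rw [hinl s hs.1]
      rcases h3 s hs.2 hgs with h5 | ⟨a', ha', h5⟩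
      · exact Or.inl (by rw [h5, FormalSum.absorbMap_inl hs.1])
      · exact Or.inr ⟨a', Finset.mem_insert_of_mem ha',
          by rw [h5, FormalSum.absorbMap_inl (ne_of_mem_of_not_mem ha' haA)]⟩
    · rcases strutEnd_cases i b e with rfl | rfl | ⟨j, δ, rfl⟩
      · exact Or.inr ⟨a, Finset.mem_insert_self _ _, hback⟩
      · rw [hself]
        rcases h3 a haA ha with h5 | ⟨a', ha', h5⟩
        · exact Or.inl (by rw [h5, FormalSum.absorbMap_self])
        · exact Or.inr ⟨a', Finset.mem_insert_of_mem ha',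
            by rw [h5, FormalSum.absorbMap_inl (ne_of_mem_of_not_mem ha' haA)]⟩
      · rw [hinr]
        rcases h4 (j, δ) with h5 | ⟨a', ha', h5⟩
        · exact Or.inl (by rw [h5, FormalSum.absorbMap_inr])
        · exact Or.inr ⟨a', Finset.mem_insert_of_mem ha',
            by rw [h5, FormalSum.absorbMap_inl (ne_of_mem_of_not_mem ha' haA)]⟩
  · rintro ⟨h1, h2, h3, h4⟩
    refine ⟨fun s hs => ?_, fun s hs => ?_, fun s hs hgs => ?_, ?_⟩
    · have := h1 s hs
      rw [hinl s (hga s hs).1, absorbMap_eq_inl] at this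
      exact this.1
    · have hsa : s ≠ a := fun e => haA (e ▸ hs)
      have h5 := h2 s (Finset.mem_insert_of_mem hs)
      rcases h5 with ⟨c, hc, hsc⟩ | ⟨e, he, hse⟩
      · rw [hinl s hsa, absorbMap_eq_inl] at hsc
        refine Or.inl ⟨c, ?_, hsc.1⟩
        split_ifs
        · exact Finset.mem_insert_of_mem hc
        · exact hc
      · rcases strutEnd_cases i b e with rfl | rfl | ⟨j, δ, rfl⟩
        · exact absurd (Sum.inl_injective (hinj _ _ (hse.trans hh.symm))) hsa
        · rw [hinl s hsa, absorbMap_eq_self] at hse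
          exact Or.inl ⟨a, by rw [if_pos he]; exact Finset.mem_insert_self _ _, hse⟩
        · rw [hinl s hsa, absorbMap_eq_inr] at hse
          exact Or.inr ⟨(j, δ), he, hse⟩
    · by_cases hsa : s = a
      · subst hsa
        rcases h4 (i, b) with h5 | ⟨a', ha', h5⟩
        · rw [hself, absorbMap_eq_self] at h5
          exact Or.inl h5
        · rcases Finset.mem_insert.1 ha' with rfl | ha'
          · have := hinj _ _ (h5.trans hback.symm)
            simp at this
          · rw [hself, absorbMap_eq_inl] at h5
            exact Or.inr ⟨a', ha', h5.1⟩
      · have hs' : s ∉ insert a A := by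
          rw [Finset.mem_insert, not_or]
          exact ⟨hsa, hs⟩
        rcases h3 s hs' hgs with h5 | ⟨a', ha', h5⟩
        · rw [hinl s hsa, absorbMap_eq_inl] at h5
          exact Or.inl h5.1
        · rcases Finset.mem_insert.1 ha' with rfl | ha'
          · have := hinj _ _ (h5.trans hback.symm)
            cases this
          · rw [hinl s hsa, absorbMap_eq_inl] at h5
            exact Or.inr ⟨a', ha', h5.1⟩
    · rintro ⟨j, δ⟩
      rcases h4 (i.succAbove j, δ) with h5 | ⟨a', ha', h5⟩
      · rw [hinr, absorbMap_eq_inr] at h5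
        exact Or.inl h5
      · rcases Finset.mem_insert.1 ha' with rfl | ha'
        · have := hinj _ _ (h5.trans hback.symm)
          simp at this
        · rw [hinr, absorbMap_eq_inl] at h5
          exact Or.inr ⟨a', ha', h5.1⟩

/-- In a pairing both ends of a strut are glued. The strut at `a` therefore leads on to a second leg
`c`, and it amounts to gluing `a` to `c` directly, which is recorded by `pairUp g a c`. -/
theorem pairAdm_absorb {Var : Type*} {X : Finset Var} {g : Invol S} {lab : S → LegLabel Var}
    {labE : Fin (n + 1) × Bool → X} (ha : g.1 a = a) (hla : lab a = .var (labE (i, !b)).1)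
    (hon : ∀ s, h'.1 (FormalSum.absorbMap a i b s) = FormalSum.absorbMap a i b (h.1 s))
    (hh : h'.1 (.inl a) = .inr (i, !b)) :
    (∃ c, c ≠ a ∧ g.1 c = c ∧ lab c = .var (labE (i, b)).1 ∧
      PairAdm (pairUp g a c).1 lab (fun e => labE (i.succAbove e.1, e.2)) h.1) ↔
      PairAdm g.1 lab labE h'.1 := by
  have hself : h'.1 (.inr (i, b)) = FormalSum.absorbMap a i b (h.1 (.inl a)) := by
    rw [← hon, FormalSum.absorbMap_self]
  have hinl : ∀ s, s ≠ a → h'.1 (.inl s) = FormalSum.absorbMap a i b (h.1 (.inl s)) := by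
    intro s hs
    rw [← hon, FormalSum.absorbMap_inl hs]
  have hinr : ∀ j δ, h'.1 (.inr (i.succAbove j, δ)) =
      FormalSum.absorbMap a i b (h.1 (.inr (j, δ))) := by
    intro j δ
    rw [← hon, FormalSum.absorbMap_inr]
  have hback : h'.1 (.inr (i, !b)) = .inl a := by rw [← hh, h'.2]
  have hinj : ∀ s t, h.1 s = h.1 t → s = t := fun s t e => by rw [← h.2 s, e, h.2]
  have hinj' : ∀ s t, h'.1 s = h'.1 t → s = t := fun s t e => by rw [← h'.2 s, e, h'.2]
  have hga : ∀ s, g.1 s ≠ s → s ≠ a ∧ g.1 s ≠ a := by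
    intro s hs
    refine ⟨fun e => hs (by rw [e, ha]), fun e => hs ?_⟩
    have := congrArg g.1 e
    rw [g.2, ha] at this
    rw [this, ha]
  constructor
  · rintro ⟨c, hca, hgc, hlc, h1, h2, h3, h4⟩
    have hpa := pairUp_left ha hgc
    have hpc := pairUp_right ha hgc
    have hpn : ∀ t, t ≠ a → t ≠ c → (pairUp g a c).1 t = g.1 t :=
      fun t h1 h2 => pairUp_of_ne ha hgc h1 h2
    have hac : h.1 (.inl a) = .inl c := by
      rw [h1 a (by rw [hpa]; exact hca), hpa]
    refine ⟨fun s hs => ?_, fun e => ?_, fun s hgs hs => ?_, fun s hgs x hx hs => ?_⟩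
    · have h5 := hga s hs
      have h6 : s ≠ c := fun e => hs (by rw [e, hgc])
      have h7 := hpn s h5.1 h6
      rw [hinl s h5.1, h1 s (by rw [h7]; exact hs), h7, FormalSum.absorbMap_inl h5.2]
    · rcases strutEnd_cases i b e with rfl | rfl | ⟨j, δ, rfl⟩
      · exact ⟨a, ha, hla, hback⟩
      · exact ⟨c, hgc, hlc, by rw [hself, hac, FormalSum.absorbMap_inl hca]⟩
      · obtain ⟨s, hs, hls, hes⟩ := h2 (j, δ)
        have h5 : s ≠ a := fun e => by rw [e, hpa] at hs; exact hca hs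
        have h6 : s ≠ c := fun e => by rw [e, hpc] at hs; exact hca hs.symm
        exact ⟨s, by rw [← hpn s h5 h6, hs], hls,
          by rw [hinr, hes, FormalSum.absorbMap_inl h5]⟩
    · have h5 : s ≠ a := fun e => hs _ (labE (i, !b)).2 (by rw [e, hla])
      have h6 : s ≠ c := fun e => hs _ (labE (i, b)).2 (by rw [e, hlc])
      rw [hinl s h5, h3 s (by rw [hpn s h5 h6, hgs]) hs, FormalSum.absorbMap_inl h5]
    · by_cases h5 : s = a
      · exact ⟨_, by rw [h5, hh]⟩
      by_cases h6 : s = c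
      · refine ⟨(i, b), ?_⟩
        rw [hinl s h5, h6, ← hac, h.2, FormalSum.absorbMap_self]
      · obtain ⟨⟨j, δ⟩, he⟩ := h4 s (by rw [hpn s h5 h6, hgs]) x hx hs
        exact ⟨_, by rw [hinl s h5, he, FormalSum.absorbMap_inr]⟩
  · rintro ⟨h1, h2, h3, h4⟩
    obtain ⟨c, hgc, hlc, hc⟩ := h2 (i, b)
    rw [hself, absorbMap_eq_inl] at hc
    obtain ⟨hac, hca⟩ := hc
    have hpa := pairUp_left ha hgc
    have hpc := pairUp_right ha hgc
    have hpn : ∀ t, t ≠ a → t ≠ c → (pairUp g a c).1 t = g.1 t :=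
      fun t h1 h2 => pairUp_of_ne ha hgc h1 h2
    have hfix : ∀ s, (pairUp g a c).1 s = s → s ≠ a ∧ s ≠ c := fun s hs =>
      ⟨fun e => by rw [e, hpa] at hs; exact hca hs, fun e => by rw [e, hpc] at hs; exact hca hs.symm⟩
    refine ⟨c, hca, hgc, hlc, fun s hs => ?_, ?_, fun s hgs hs => ?_, fun s hgs x hx hs => ?_⟩
    · by_cases h5 : s = a
      · rw [h5, hpa, hac]
      by_cases h6 : s = c
      · rw [h6, hpc, ← hac, h.2]
      · rw [hpn s h5 h6] at hs ⊢
        have := h1 s hs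
        rw [hinl s h5, absorbMap_eq_inl] at this
        exact this.1
    · rintro ⟨j, δ⟩
      obtain ⟨s, hs, hls, hes⟩ := h2 (i.succAbove j, δ)
      rw [hinr, absorbMap_eq_inl] at hes
      have h6 : s ≠ c := by
        rintro rfl
        have := hinj _ _ (hes.1.trans hac.symm)
        cases this
      exact ⟨s, by rw [hpn s hes.2 h6, hs], hls, hes.1⟩
    · obtain ⟨h5, h6⟩ := hfix s hgs
      rw [hpn s h5 h6] at hgs
      have := h3 s hgs hs
      rw [hinl s h5, absorbMap_eq_inl] at this
      exact this.1
    · obtain ⟨h5, h6⟩ := hfix s hgs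
      rw [hpn s h5 h6] at hgs
      obtain ⟨e, he⟩ := h4 s hgs x hx hs
      rcases strutEnd_cases i b e with rfl | rfl | ⟨j, δ, rfl⟩
      · exact absurd (Sum.inl_injective (hinj' _ _ (he.trans hh.symm))) h5
      · rw [hinl s h5, absorbMap_eq_self] at he
        have := congrArg h.1 he
        rw [h.2, hac] at this
        exact absurd (Sum.inl_injective this) h6
      · rw [hinl s h5, absorbMap_eq_inr] at he
        exact ⟨_, he⟩

end Absorb

section Pair

variable {S E Var : Type} {A Z : Finset S} {g : Invol S} {a c : S}

/-- The choice of `c` as partner of `a` becomes part of the gluing made in advance. In exchange `a`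
is no longer to be glued and `c` is no longer available. -/
theorem applyAdm_pairUp {Ze : E → Prop} {h : Invol (S ⊕ E)} (haA : a ∉ A) (ha : g.1 a = a)
    (hc : g.1 c = c) (hcZ : c ∈ Z) (hcA : c ∉ A) (hac : c ≠ a) :
    ApplyAdm A (pairUp g a c).1 (Z.erase c) Ze h.1 ↔
      ApplyAdm (insert a A) g.1 Z Ze h.1 ∧ h.1 (.inl a) = .inl c := by
  have hpa := pairUp_left ha hc
  have hpc := pairUp_right ha hc
  have hpn : ∀ t, t ≠ a → t ≠ c → (pairUp g a c).1 t = g.1 t :=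
    fun t h1 h2 => pairUp_of_ne ha hc h1 h2
  have hinj : ∀ s t, h.1 s = h.1 t → s = t := fun s t e => by rw [← h.2 s, e, h.2]
  have hgn : ∀ s, g.1 s ≠ s → s ≠ a ∧ s ≠ c := fun s hs =>
    ⟨fun e => hs (by rw [e, ha]), fun e => hs (by rw [e, hc])⟩
  constructor
  · rintro ⟨h1, h2, h3, h4⟩
    have hA : h.1 (.inl a) = .inl c := by rw [h1 a (by rw [hpa]; exact hac), hpa]
    have hC : h.1 (.inl c) = .inl a := by rw [← hA, h.2]
    refine ⟨⟨fun s hs => ?_, fun s hs => ?_, fun s hs hgs => ?_, fun e => ?_⟩, hA⟩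
    · have h5 := hpn s (hgn s hs).1 (hgn s hs).2
      rw [h1 s (by rw [h5]; exact hs), h5]
    · rcases Finset.mem_insert.1 hs with rfl | hs
      · exact Or.inl ⟨c, hcZ, hA⟩
      · exact (h2 s hs).imp (fun ⟨c', hc', h5⟩ => ⟨c', Finset.mem_of_mem_erase hc', h5⟩) id
    · rw [Finset.mem_insert, not_or] at hs
      by_cases h6 : s = c
      · exact Or.inr ⟨a, Finset.mem_insert_self _ _, by rw [h6, hC]⟩
      · exact (h3 s hs.2 (by rw [hpn s hs.1 h6, hgs])).imp id
          fun ⟨a', ha', h5⟩ => ⟨a', Finset.mem_insert_of_mem ha', h5⟩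
    · exact (h4 e).imp id fun ⟨a', ha', h5⟩ => ⟨a', Finset.mem_insert_of_mem ha', h5⟩
  · rintro ⟨⟨h1, h2, h3, h4⟩, hA⟩
    have hC : h.1 (.inl c) = .inl a := by rw [← hA, h.2]
    refine ⟨fun s hs => ?_, fun s hs => ?_, fun s hs hgs => ?_, fun e => ?_⟩
    · by_cases h5 : s = a
      · rw [h5, hpa, hA]
      by_cases h6 : s = c
      · rw [h6, hpc, hC]
      · rw [hpn s h5 h6] at hs ⊢
        exact h1 s hs
    · refine (h2 s (Finset.mem_insert_of_mem hs)).imp (fun ⟨c', hc', h5⟩ => ⟨c', ?_, h5⟩) id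
      refine Finset.mem_erase.2 ⟨?_, hc'⟩
      rintro rfl
      exact haA ((Sum.inl_injective (hinj _ _ (h5.trans hA.symm))) ▸ hs)
    · have h5 : s ≠ a := fun e => by rw [e, hpa] at hgs; exact hac hgs
      have h6 : s ≠ c := fun e => by rw [e, hpc] at hgs; exact hac hgs.symm
      rw [hpn s h5 h6] at hgs
      refine (h3 s (by rw [Finset.mem_insert, not_or]; exact ⟨h5, hs⟩) hgs).imp id ?_
      rintro ⟨a', ha', h7⟩
      refine ⟨a', ?_, h7⟩
      rcases Finset.mem_insert.1 ha' with rfl | ha'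
      · exact absurd (Sum.inl_injective (hinj _ _ (h7.trans hC.symm))) h6
      · exact ha'
    · refine (h4 e).imp id ?_
      rintro ⟨a', ha', h7⟩
      refine ⟨a', ?_, h7⟩
      rcases Finset.mem_insert.1 ha' with rfl | ha'
      · have := hinj _ _ (h7.trans hC.symm)
        cases this
      · exact ha'

end Pair

section Div

variable {S : Type} {Var : Type*} {A Z : Finset S} {g h : Invol S} {a c : S}
  {lab : S → LegLabel Var} {z : Var}

/-- A new gluing outside `A` has its partner in `A`, and such a partner accepts only legs labeled
`z` that are not in `Z`. -/
theorem DivAdm.apply_eq_self (H : DivAdm A g.1 lab z Z h.1) (ha : g.1 a = a) (haA : a ∉ A)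
    (hl : lab a ≠ .var z ∨ a ∈ Z) : h.1 a = a := by
  refine (H.2.2 a haA ha).resolve_right fun h1 => ?_
  have h2 := H.2.1 _ h1
  rw [h.2] at h2
  rcases hl with hl | hl
  · exact hl h2.2.1
  · exact h2.2.2 hl

/-- The leg `a` is a possible target neither before nor after the change: before, because of its
label; after, because it has a label other than `z` or else belongs to `Z`. -/
theorem divAdm_update (hla : lab a ≠ .var z) (y : Var) :
    DivAdm A g.1 (Function.update lab a (.var y)) z (if y = z then insert a Z else Z) h.1 ↔
      DivAdm A g.1 lab z Z h.1 := by
  unfold DivAdm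
  refine and_congr Iff.rfl (and_congr ?_ Iff.rfl)
  refine forall_congr' fun s => forall_congr' fun hs => and_congr Iff.rfl ?_
  by_cases h1 : h.1 s = a
  · rw [h1, Function.update_self]
    constructor
    · rintro ⟨h2, h3⟩
      have h2 : y = z := LegLabel.var.inj h2
      rw [if_pos h2] at h3
      exact absurd (Finset.mem_insert_self _ _) h3
    · exact fun h2 => absurd h2.1 hla
  · rw [Function.update_of_ne h1]
    refine and_congr Iff.rfl ?_
    split_ifs
    · rw [Finset.mem_insert, not_or]
      exact ⟨fun h2 => h2.2, fun h2 => ⟨h1, h2⟩⟩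
    · rfl

/-- The pair `a`, `c` takes no part in the remaining choices: on the left it is free, on the right
it is glued in advance. Erasing `c` from `Z` opens no new possibility, since `c` is occupied then.
-/
theorem divAdm_pairUp (haA : a ∉ A) (hcA : c ∉ A) (ha : g.1 a = a) (hc : g.1 c = c) (hac : c ≠ a)
    (h1 : h.1 a = a) (h2 : h.1 c = c) :
    DivAdm A g.1 lab z Z h.1 ↔
      DivAdm A (pairUp g a c).1 lab z (Z.erase c) (pairUp h a c).1 := by
  have hpa := pairUp_left ha hc
  have hpc := pairUp_right ha hc
  have hpn : ∀ t, t ≠ a → t ≠ c → (pairUp g a c).1 t = g.1 t :=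
    fun t h1 h2 => pairUp_of_ne ha hc h1 h2
  have hqa := pairUp_left h1 h2
  have hqc := pairUp_right h1 h2
  have hqn : ∀ t, t ≠ a → t ≠ c → (pairUp h a c).1 t = h.1 t :=
    fun t h3 h4 => pairUp_of_ne h1 h2 h3 h4
  have hne : ∀ t, t ≠ a → t ≠ c → h.1 t ≠ a ∧ h.1 t ≠ c := fun t h3 h4 =>
    ⟨fun e => h3 (by rw [← h.2 t, e, h1]), fun e => h4 (by rw [← h.2 t, e, h2])⟩
  have hA : ∀ s ∈ A, s ≠ a ∧ s ≠ c := fun s hs => ⟨fun e => haA (e ▸ hs), fun e => hcA (e ▸ hs)⟩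
  constructor
  · rintro ⟨h3, h4, h5⟩
    refine ⟨fun s hs => ?_, fun s hs => ?_, fun s hs hgs => ?_⟩
    · by_cases h6 : s = a
      · rw [h6, hpa, hqa]
      by_cases h7 : s = c
      · rw [h7, hpc, hqc]
      rw [hpn s h6 h7] at hs ⊢
      rw [hqn s h6 h7, h3 s hs]
    · obtain ⟨h6, h7⟩ := hA s hs
      obtain ⟨h8, h9⟩ := hne s h6 h7
      rw [hqn s h6 h7, hpn _ h8 h9]
      exact ⟨(h4 s hs).1, (h4 s hs).2.1, fun h10 => (h4 s hs).2.2 (Finset.mem_of_mem_erase h10)⟩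
    · have h6 : s ≠ a := fun e => by rw [e, hpa] at hgs; exact hac hgs
      have h7 : s ≠ c := fun e => by rw [e, hpc] at hgs; exact hac hgs.symm
      rw [hqn s h6 h7]
      exact h5 s hs (by rw [← hpn s h6 h7, hgs])
  · rintro ⟨h3, h4, h5⟩
    refine ⟨fun s hs => ?_, fun s hs => ?_, fun s hs hgs => ?_⟩
    · have h6 : s ≠ a := fun e => hs (by rw [e, ha])
      have h7 : s ≠ c := fun e => hs (by rw [e, hc])
      rw [← hqn s h6 h7, h3 s (by rw [hpn s h6 h7]; exact hs), hpn s h6 h7]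
    · obtain ⟨h6, h7⟩ := hA s hs
      obtain ⟨h8, h9⟩ := hne s h6 h7
      have h10 := h4 s hs
      rw [hqn s h6 h7, hpn _ h8 h9] at h10
      exact ⟨h10.1, h10.2.1, fun h11 => h10.2.2 (Finset.mem_erase.2 ⟨h9, h11⟩)⟩
    · by_cases h6 : s = a
      · rw [h6]; exact Or.inl h1
      by_cases h7 : s = c
      · rw [h7]; exact Or.inl h2
      rw [← hqn s h6 h7]
      exact h5 s hs (by rw [hpn s h6 h7, hgs])

/-- Here `a` enters the divergence. The conditions on `c` are just those for being a target, apart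
from being free for `g`; this follows from being free for `h`. -/
theorem divAdm_insert (haA : a ∉ A) (hcA : c ∉ A) (ha : g.1 a = a) (hac : c ≠ a)
    (hla : lab a ≠ .var z) (h1 : h.1 a = a) (h2 : h.1 c = c) :
    DivAdm A g.1 lab z Z h.1 ∧ lab c = .var z ∧ c ∉ Z ↔
      DivAdm (insert a A) g.1 lab z Z (pairUp h a c).1 := by
  have hqa := pairUp_left h1 h2
  have hqc := pairUp_right h1 h2
  have hqn : ∀ t, t ≠ a → t ≠ c → (pairUp h a c).1 t = h.1 t :=
    fun t h3 h4 => pairUp_of_ne h1 h2 h3 h4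
  have hne : ∀ t, t ≠ a → t ≠ c → h.1 t ≠ a ∧ h.1 t ≠ c := fun t h3 h4 =>
    ⟨fun e => h3 (by rw [← h.2 t, e, h1]), fun e => h4 (by rw [← h.2 t, e, h2])⟩
  have hA : ∀ s ∈ A, s ≠ a ∧ s ≠ c := fun s hs => ⟨fun e => haA (e ▸ hs), fun e => hcA (e ▸ hs)⟩
  constructor
  · rintro ⟨⟨h3, h4, h5⟩, hlc, hcZ⟩
    have hgc : g.1 c = c := by
      by_contra h6
      exact h6 (by rw [← h3 c h6, h2])
    refine ⟨fun s hs => ?_, fun s hs => ?_, fun s hs hgs => ?_⟩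
    · have h6 : s ≠ a := fun e => hs (by rw [e, ha])
      have h7 : s ≠ c := fun e => hs (by rw [e, hgc])
      rw [hqn s h6 h7, h3 s hs]
    · rcases Finset.mem_insert.1 hs with rfl | hs
      · rw [hqa]
        exact ⟨hgc, hlc, hcZ⟩
      · rw [hqn s (hA s hs).1 (hA s hs).2]
        exact h4 s hs
    · rw [Finset.mem_insert, not_or] at hs
      by_cases h7 : s = c
      · rw [h7, hqc]
        exact Or.inr (Finset.mem_insert_self _ _)
      · rw [hqn s hs.1 h7]
        exact (h5 s hs.2 hgs).imp id Finset.mem_insert_of_mem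
  · rintro ⟨h3, h4, h5⟩
    have h6 := h4 a (Finset.mem_insert_self _ _)
    rw [hqa] at h6
    refine ⟨⟨fun s hs => ?_, fun s hs => ?_, fun s hs hgs => ?_⟩, h6.2⟩
    · have h7 : s ≠ a := fun e => hs (by rw [e, ha])
      have h8 : s ≠ c := fun e => hs (by rw [e, h6.1])
      rw [← hqn s h7 h8, h3 s hs]
    · have := h4 s (Finset.mem_insert_of_mem hs)
      rwa [hqn s (hA s hs).1 (hA s hs).2] at this
    · by_cases h7 : s = a
      · rw [h7]; exact Or.inl h1
      by_cases h8 : s = c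
      · rw [h8]; exact Or.inl h2
      have := h5 s (by rw [Finset.mem_insert, not_or]; exact ⟨h7, hs⟩) hgs
      rw [hqn s h7 h8] at this
      exact this.imp id fun h9 => (Finset.mem_insert.1 h9).resolve_left (hne s h7 h8).1

end Div

end FormalDiagram

end

/-! ### Recursions for the weighted sums of gluings to struts -/

noncomputable section

namespace FormalDiagram

open Classical Diagram Invol

namespace FormalSum

section Terms

instance {𝒱 : VertexKinds} {L : Type*} (Γ : Diagram 𝒱 L) : Fintype Γ.Leg := Fintype.ofFinite _

variable {k : Type*} [Field k] {𝒱 : VertexKinds} {Var : Type*} {X : Finset Var}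
  {Γ : Diagram 𝒱 (LegLabel Var)} {w : X × X → k}

/-- The label of a variable in `X`. -/
abbrev varLabel (X : Finset Var) : X → LegLabel Var := fun x => .var x.1

/-- The label of the dual of a variable in `X`. -/
abbrev dualLabel (X : Finset Var) : X → LegLabel Var := fun x => .dual x.1

/-- The ends of struts that carry the variable `z`. -/
def endsAt {n : ℕ} (f : Fin n → X × X) (z : X) (e : Fin n × Bool) : Prop := endOf (f e.1) e.2 = z

/-- The variables at the ends of struts. -/
def endVar {n : ℕ} (f : Fin n → X × X) (e : Fin n × Bool) : X := endOf (f e.1) e.2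

/-- The gluings of all legs in `A` to legs in `Z` or to the `z`-ends of `n` struts, where the edges
that are glued by `g` are fused already. -/
def applyTerm (Γ : Diagram 𝒱 (LegLabel Var)) (w : X × X → k) (z : X) (A : Finset Γ.Leg)
    (g : Invol Γ.Leg) (lab : Γ.Leg → LegLabel Var) (Z : Finset Γ.Leg) (n : ℕ) :
    FormalSum k 𝒱 (LegLabel Var) :=
  (Nat.factorial n : k)⁻¹ • strutSum (Γ.withLabel lab) (varLabel X) w n
    fun f h => ApplyAdm A g.1 Z (endsAt f z) h.1

/-- The gluings of all ends of `n` dual struts to all legs labeled by members of `X`, where the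
edges that are glued by `g` are fused already. -/
def pairTerm (Γ : Diagram 𝒱 (LegLabel Var)) (w : X × X → k) (g : Invol Γ.Leg)
    (lab : Γ.Leg → LegLabel Var) (n : ℕ) : FormalSum k 𝒱 (LegLabel Var) :=
  (Nat.factorial n : k)⁻¹ • strutSum (Γ.withLabel lab) (dualLabel X) w n
    fun f h => PairAdm g.1 lab (endVar f) h.1

/-- The number `2 (n + 1)` of strut ends reduces the factorial by one step. The factor `2` that
remains undoes the `1 / 2` in the exponents. -/
theorem factorial_succ_smul [CharZero k] (n : ℕ) (F : FormalSum k 𝒱 (LegLabel Var)) :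
    (Nat.factorial (n + 1) : k)⁻¹ • (2 * (n + 1) : k) • F =
      (2 : k) • (Nat.factorial n : k)⁻¹ • F := by
  rw [smul_smul, smul_smul, Nat.factorial_succ]
  congr 1
  have h1 : (n + 1 : k) ≠ 0 := by exact_mod_cast Nat.succ_ne_zero n
  have h2 : (Nat.factorial n : k) ≠ 0 := by exact_mod_cast Nat.factorial_ne_zero n
  push_cast
  field_simp

theorem strutSum_congr {n : ℕ} {lbl : X → LegLabel Var}
    {P P' : ∀ _ : Fin n → X × X, Invol (Γ.Leg ⊕ Fin n × Bool) → Prop}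
    (h : ∀ f g, P f g ↔ P' f g) : strutSum Γ lbl w n P = strutSum Γ lbl w n P' := by
  refine Finset.sum_congr rfl fun f _ => ?_
  rw [glueSum_congr (h f)]

theorem strutSum_add {n : ℕ} {lbl : X → LegLabel Var}
    {P P' : ∀ _ : Fin n → X × X, Invol (Γ.Leg ⊕ Fin n × Bool) → Prop}
    (h : ∀ f g, ¬ (P f g ∧ P' f g)) : strutSum Γ lbl w n (fun f g => P f g ∨ P' f g) =
      strutSum Γ lbl w n P + strutSum Γ lbl w n P' := by
  simp only [strutSum, ← Finset.sum_add_distrib, ← smul_add]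
  refine Finset.sum_congr rfl fun f _ => congrArg _ ?_
  simp only [glueSum]
  rw [Finset.filter_or, Finset.sum_union]
  exact Finset.disjoint_filter.2 fun g _ h1 h2 => h f g ⟨h1, h2⟩

theorem glueSum_exists {Δ : Diagram 𝒱 (LegLabel Var)} {ι : Type*} (s : Finset ι)
    (P : ι → Invol Δ.Leg → Prop) (h : ∀ i j g, P i g → P j g → i = j) :
    (glueSum Δ (fun g => ∃ i ∈ s, P i g) : FormalSum k 𝒱 (LegLabel Var)) =
      ∑ i ∈ s, glueSum Δ (P i) := by
  simp only [glueSum]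
  rw [← Finset.sum_biUnion]
  · refine Finset.sum_congr ?_ fun _ _ => rfl
    ext g
    simp
  · intro i _ j _ hij
    exact Finset.disjoint_filter.2 fun g _ h1 h2 => hij (h i j g h1 h2)

theorem strutSum_exists {n : ℕ} {lbl : X → LegLabel Var} {ι : Type*} (s : Finset ι)
    (P : ι → ∀ _ : Fin n → X × X, Invol (Γ.Leg ⊕ Fin n × Bool) → Prop)
    (h : ∀ i j f g, P i f g → P j f g → i = j) :
    strutSum Γ lbl w n (fun f g => ∃ i ∈ s, P i f g) = ∑ i ∈ s, strutSum Γ lbl w n (P i) := by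
  simp only [strutSum]
  rw [Finset.sum_comm]
  refine Finset.sum_congr rfl fun f _ => ?_
  rw [glueSum_exists (Δ := Γ.union (struts 𝒱 (pairLabels lbl f))) s (fun i => P i f)
    fun i j g => h i j f g, Finset.smul_sum]

theorem strutSum_false {n : ℕ} {lbl : X → LegLabel Var}
    {P : ∀ _ : Fin n → X × X, Invol (Γ.Leg ⊕ Fin n × Bool) → Prop}
    (h : ∀ f g, ¬ P f g) : strutSum Γ lbl w n P = 0 := by
  refine Finset.sum_eq_zero fun f _ => ?_
  rw [glueSum, Finset.sum_eq_zero, smul_zero]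
  intro g hg
  simp only [Finset.mem_filter, Finset.mem_univ, true_and] at hg
  exact absurd hg (h f g)

/-- Extraction of the gluings of a leg `a` to a strut in `applyTerm`. -/
theorem strutSum_applyAdm_inr (hw : ∀ x y, w (x, y) = w (y, x)) (z : X) {A Z : Finset Γ.Leg}
    {g : Invol Γ.Leg} (lab : Γ.Leg → LegLabel Var) {a : Γ.Leg} (haA : a ∉ A) (haZ : a ∉ Z)
    (ha : g.1 a = a) (n : ℕ) :
    strutSum (Γ.withLabel lab) (varLabel X) w (n + 1)
      (fun f h => ApplyAdm (insert a A) g.1 Z (endsAt f z) h.1 ∧ ∃ e, h.1 (.inl a) = .inr e) =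
      (2 * (n + 1) : k) • ∑ y, w (z, y) •
        strutSum (Γ.withLabel (Function.update lab a (.var y.1))) (varLabel X) w n
          (fun f h => ApplyAdm A g.1 (if y = z then insert a Z else Z) (endsAt f z) h.1) := by
  refine strutSum_succ (Γ.withLabel lab) (varLabel X) hw n _ a (fun f h hh => hh.2) z _ ?_
  intro i b y
  by_cases hy : endOf y (!b) = z
  · rw [if_pos hy]
    refine Finset.sum_congr rfl fun f _ => ?_
    refine congrArg _ (Eq.symm ?_)
    refine glueSum_absorb Γ lab (Function.update lab a (.var (endOf y b).1)) a _ _ i b ?_ _ _ ?_ ?_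
      ?_
    · intro j
      simp [pairLabels]
    · exact fun h hh => hh.2
    · intro h h' hon hh
      have h1 : endsAt (i.insertNth y f) z (i, !b) := by
        rw [endsAt, Fin.insertNth_apply_same, hy]
      have h2 := applyAdm_absorb (Ze := endsAt (i.insertNth y f) z) haA haZ ha h1 hon hh
      have h3 : endsAt (i.insertNth y f) z (i, b) ↔ endOf y b = z := by
        rw [endsAt, Fin.insertNth_apply_same]
      have h4 : (fun e : Fin n × Bool => endsAt (i.insertNth y f) z (i.succAbove e.1, e.2)) =
          endsAt f z := by
        funext e
        rw [endsAt, Fin.insertNth_apply_succAbove]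
        rfl
      rw [h4] at h2
      simp only [h3] at h2
      refine h2.trans ?_
      exact ⟨fun h5 => ⟨⟨h5, _, hh⟩, hh⟩, fun h5 => h5.1.1⟩
    · intro h _ s _
      by_cases hs : s = a
      · rw [hs, Function.update_self, if_pos rfl]
        simp only [Fin.insertNth_apply_same, endOf]
        cases b <;> rfl
      · rw [Function.update_of_ne hs, if_neg hs]
  · rw [if_neg hy]
    refine Finset.sum_eq_zero fun f _ => ?_
    rw [glueSum, Finset.sum_eq_zero, smul_zero]
    intro h hh
    simp only [Finset.mem_filter, Finset.mem_univ, true_and] at hh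
    obtain ⟨⟨h1, -⟩, h2⟩ := hh
    rcases h1.2.1 a (Finset.mem_insert_self _ _) with ⟨c, _, h3⟩ | ⟨e, he, h3⟩
    · rw [h2] at h3
      cases h3
    · rw [h2] at h3
      have h3 := Sum.inr_injective h3
      rw [← h3, endsAt, Fin.insertNth_apply_same] at he
      exact absurd he hy

/-- Extraction of the gluings of a leg `a` to other legs in `applyTerm`. -/
theorem strutSum_applyAdm_inl (z : X) {A Z : Finset Γ.Leg}
    {g : Invol Γ.Leg} (lab : Γ.Leg → LegLabel Var) {a : Γ.Leg} (haA : a ∉ A) (haZ : a ∉ Z)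
    (ha : g.1 a = a) (hZ : ∀ c ∈ Z, g.1 c = c ∧ c ∉ A) (n : ℕ) :
    strutSum (Γ.withLabel lab) (varLabel X) w n
      (fun f h => ApplyAdm (insert a A) g.1 Z (endsAt f z) h.1 ∧ ¬ ∃ e, h.1 (.inl a) = .inr e) =
      ∑ c ∈ Z, strutSum (Γ.withLabel lab) (varLabel X) w n
        (fun f h => ApplyAdm A (pairUp g a c).1 (Z.erase c) (endsAt f z) h.1) := by
  have hpair : ∀ c ∈ Z, ∀ (f : Fin n → X × X) (h : Invol (Γ.Leg ⊕ Fin n × Bool)),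
      ApplyAdm A (pairUp g a c).1 (Z.erase c) (endsAt f z) h.1 ↔
      ApplyAdm (insert a A) g.1 Z (endsAt f z) h.1 ∧ h.1 (.inl a) = .inl c :=
    fun c hc f h => applyAdm_pairUp haA ha (hZ c hc).1 hc (hZ c hc).2 (ne_of_mem_of_not_mem hc haZ)
  rw [Finset.sum_congr rfl fun c hc => strutSum_congr (Γ := Γ.withLabel lab) (hpair c hc),
    ← strutSum_exists]
  · refine strutSum_congr (Γ := Γ.withLabel lab) fun f h => ⟨?_, ?_⟩
    · rintro ⟨h1, h2⟩
      rcases h1.2.1 a (Finset.mem_insert_self _ _) with ⟨c, hc, h3⟩ | ⟨e, _, h3⟩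
      · exact ⟨c, hc, h1, h3⟩
      · exact absurd ⟨e, h3⟩ h2
    · rintro ⟨c, _, h1, h2⟩
      refine ⟨h1, ?_⟩
      rintro ⟨e, he⟩
      rw [h2] at he
      cases he
  · rintro c c' f h ⟨_, h1⟩ ⟨_, h2⟩
    rw [h1] at h2
    exact Sum.inl_injective h2

/-- Gluing `a` to a leg in `Z` uses up no strut. Gluing it to a strut leaves one strut less, and `a`
with the label `y` of the far end; for `y = z` it becomes a target of the legs in `A`. -/
theorem applyTerm_succ [CharZero k] (hw : ∀ x y, w (x, y) = w (y, x)) (z : X)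
    {A Z : Finset Γ.Leg} {g : Invol Γ.Leg} (lab : Γ.Leg → LegLabel Var) {a : Γ.Leg} (haA : a ∉ A)
    (haZ : a ∉ Z) (ha : g.1 a = a) (hZ : ∀ c ∈ Z, g.1 c = c ∧ c ∉ A) (n : ℕ) :
    applyTerm Γ w z (insert a A) g lab Z (n + 1) =
      ∑ c ∈ Z, applyTerm Γ w z A (pairUp g a c) lab (Z.erase c) (n + 1) +
      ∑ y, (2 * w (z, y)) • applyTerm Γ w z A g (Function.update lab a (.var y.1))
        (if y = z then insert a Z else Z) n := by
  have h1 : strutSum (Γ.withLabel lab) (varLabel X) w (n + 1)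
      (fun f h => ApplyAdm (insert a A) g.1 Z (endsAt f z) h.1) = _ :=
    (strutSum_congr (Γ := Γ.withLabel lab) fun f h => (by tauto :
      ApplyAdm (insert a A) g.1 Z (endsAt f z) h.1 ↔
      (ApplyAdm (insert a A) g.1 Z (endsAt f z) h.1 ∧ ¬ ∃ e, h.1 (.inl a) = .inr e) ∨
      (ApplyAdm (insert a A) g.1 Z (endsAt f z) h.1 ∧ ∃ e, h.1 (.inl a) = .inr e))).trans
    (strutSum_add (Γ := Γ.withLabel lab) fun f h hh => hh.1.2 hh.2.2)
  rw [strutSum_applyAdm_inl z lab haA haZ ha hZ, strutSum_applyAdm_inr hw z lab haA haZ ha] at h1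
  rw [applyTerm, h1, smul_add, factorial_succ_smul]
  simp only [applyTerm, Finset.smul_sum, smul_smul]
  refine congrArg _ (Finset.sum_congr rfl fun y _ => ?_)
  congr 1
  ring

theorem applyTerm_zero (z : X) {A Z : Finset Γ.Leg} {g : Invol Γ.Leg}
    (lab : Γ.Leg → LegLabel Var) {a : Γ.Leg} (haA : a ∉ A)
    (haZ : a ∉ Z) (ha : g.1 a = a) (hZ : ∀ c ∈ Z, g.1 c = c ∧ c ∉ A) :
    applyTerm Γ w z (insert a A) g lab Z 0 =
      ∑ c ∈ Z, applyTerm Γ w z A (pairUp g a c) lab (Z.erase c) 0 := by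
  have h1 : strutSum (Γ.withLabel lab) (varLabel X) w 0
      (fun f h => ApplyAdm (insert a A) g.1 Z (endsAt f z) h.1) = _ :=
    (strutSum_congr (Γ := Γ.withLabel lab) fun f h => (by
      refine ⟨fun h => ⟨h, ?_⟩, fun h => h.1⟩
      rintro ⟨⟨e, _⟩, _⟩
      exact e.elim0 :
      ApplyAdm (insert a A) g.1 Z (endsAt f z) h.1 ↔
      (ApplyAdm (insert a A) g.1 Z (endsAt f z) h.1 ∧ ¬ ∃ e, h.1 (.inl a) = .inr e))).trans
    (strutSum_applyAdm_inl z lab haA haZ ha hZ 0)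
  rw [applyTerm, h1, Finset.smul_sum]
  rfl

/-- Each of the `2 n` ends of struts stays free or uses up a leg in `S`. -/
theorem le_of_adm {S : Type} [Finite S] {n : ℕ} (h : Invol (S ⊕ Fin n × Bool))
    (hh : ∀ e, h.1 (.inr e) = .inr e ∨ ∃ s, h.1 (.inr e) = .inl s) :
    n ≤ Nat.card {t // h.1 t = t} + Nat.card S := by
  have hex : ∀ e, ∃ t : {t // h.1 t = t} ⊕ S, Sum.elim (fun t => h.1 t.1) .inl t =
      h.1 (.inr e) := fun e =>
    (hh e).elim (fun he => ⟨.inl ⟨_, he⟩, rfl⟩) fun ⟨s, hs⟩ => ⟨.inr s, hs.symm⟩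
  choose φ hφ using hex
  have := Nat.card_le_card_of_injective φ fun e e' he => by
    have h1 := hφ e
    rw [he, hφ e'] at h1
    have h2 := congrArg h.1 h1
    rw [h.2, h.2] at h2
    exact (Sum.inr_injective h2).symm
  rw [Nat.card_sum, Nat.card_prod, Nat.card_fin] at this
  simp at this
  omega

theorem locallyFinite_strutSum {lbl : X → LegLabel Var} (r : ℕ → k)
    {P : ∀ n, ∀ _ : Fin n → X × X, Invol (Γ.Leg ⊕ Fin n × Bool) → Prop}
    (hP : ∀ n f h, P n f h → ∀ e, h.1 (.inr e) = .inr e ∨ ∃ s, h.1 (.inr e) = .inl s) :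
    LocallyFinite fun n => r n • strutSum Γ lbl w n (P n) := by
  refine locallyFinite_of_legs (Nat.card Γ.Leg) fun n Δ h => ?_
  rw [smul_apply] at h
  obtain ⟨f, _, hf⟩ := exists_of_sum_smul_ne_zero (right_ne_zero_of_mul h)
  obtain ⟨g, hg, hc⟩ := exists_of_glueSum_ne_zero hf
  rw [← Nat.card_congr (Quotient.exact hc).some.leg]
  exact le_of_adm g (hP n f g hg)

theorem locallyFinite_applyTerm (z : X) (A : Finset Γ.Leg) (g : Invol Γ.Leg)
    (lab : Γ.Leg → LegLabel Var) (Z : Finset Γ.Leg) :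
    LocallyFinite (applyTerm Γ w z A g lab Z) :=
  locallyFinite_strutSum (Γ := Γ.withLabel lab) _ fun _ _ _ hh e =>
    (hh.2.2.2 e).imp id fun ⟨a, _, ha⟩ => ⟨a, ha⟩

theorem locallyFinite_pairTerm (g : Invol Γ.Leg) (lab : Γ.Leg → LegLabel Var) :
    LocallyFinite (pairTerm Γ w g lab) :=
  locallyFinite_strutSum (Γ := Γ.withLabel lab) _ fun _ _ _ hh e =>
    Or.inr ((hh.2.1 e).imp fun _ hs => hs.2.2)

/-- The product and chain rules for a derivative of a function times an exponential. Summing over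
all numbers of struts absorbs the shift by one in `applyTerm_succ`, so the full exponential
reappears in the second sum. -/
theorem lsum_applyTerm_insert [CharZero k] (hw : ∀ x y, w (x, y) = w (y, x)) (z : X)
    {A Z : Finset Γ.Leg} {g : Invol Γ.Leg} (lab : Γ.Leg → LegLabel Var) {a : Γ.Leg} (haA : a ∉ A)
    (haZ : a ∉ Z) (ha : g.1 a = a) (hZ : ∀ c ∈ Z, g.1 c = c ∧ c ∉ A) :
    lsum (applyTerm Γ w z (insert a A) g lab Z) =
      ∑ c ∈ Z, lsum (applyTerm Γ w z A (pairUp g a c) lab (Z.erase c)) +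
      ∑ y, (2 * w (z, y)) • lsum (applyTerm Γ w z A g (Function.update lab a (.var y.1))
        (if y = z then insert a Z else Z)) := by
  have hf := locallyFinite_applyTerm (k := k) (w := w) (Γ := Γ) z
  have h1 := lsum_succ (hf (insert a A) g lab Z)
  rw [applyTerm_zero z lab haA haZ ha hZ] at h1
  rw [h1]
  simp only [applyTerm_succ hw z lab haA haZ ha hZ]
  rw [lsum_add (LocallyFinite.sum _ fun c _ => (hf A (pairUp g a c) lab (Z.erase c)).shift)
    (LocallyFinite.sum _ fun y _ => (hf A g _ _).smul _), lsum_sum _ fun c _ => (hf _ _ _ _).shift,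
    lsum_sum _ fun y _ => (hf A g _ _).smul _, ← add_assoc, ← Finset.sum_add_distrib]
  congr 1
  · exact Finset.sum_congr rfl fun c _ => (lsum_succ (hf _ _ _ _)).symm
  · exact Finset.sum_congr rfl fun y _ => lsum_smul _ _

theorem pairTerm_zero {g : Invol Γ.Leg} {lab : Γ.Leg → LegLabel Var} {a : Γ.Leg}
    (ha : g.1 a = a) {x : X} (hx : lab a = .var x.1) : pairTerm Γ w g lab 0 = 0 := by
  rw [pairTerm, strutSum_false (Γ := Γ.withLabel lab), smul_zero]
  intro f h hh
  obtain ⟨e, -⟩ := hh.2.2.2 a ha x.1 x.2 hx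
  exact e.1.elim0

/-- Extraction of the strut that is glued to a leg `a` in `pairTerm`. -/
theorem pairTerm_succ [CharZero k] (hw : ∀ x y, w (x, y) = w (y, x)) {g : Invol Γ.Leg}
    {lab : Γ.Leg → LegLabel Var} {a : Γ.Leg} (ha : g.1 a = a) {x : X} (hx : lab a = .var x.1)
    (n : ℕ) : pairTerm Γ w g lab (n + 1) = ∑ y, (2 * w (x, y)) •
      ∑ c with c ≠ a ∧ g.1 c = c ∧ lab c = .var y.1, pairTerm Γ w (pairUp g a c) lab n := by
  have h0 : strutSum (Γ.withLabel lab) (dualLabel X) w (n + 1)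
      (fun f h => PairAdm g.1 lab (endVar f) h.1) = (2 * (n + 1) : k) • ∑ y, w (x, y) •
      ∑ c with c ≠ a ∧ g.1 c = c ∧ lab c = .var y.1,
        strutSum (Γ.withLabel lab) (dualLabel X) w n
          (fun f h => PairAdm (pairUp g a c).1 lab (endVar f) h.1) := by
    -- The partner of `a` can be read off from the gluing. Hence the contributions of different legs
    -- `c` are disjoint.
    have hfix : ∀ c, g.1 c = c → c ≠ a → ∀ {n : ℕ} (f : Fin n → X × X) (h : Invol _),
        PairAdm (pairUp g a c).1 lab (endVar f) h.1 → h.1 (.inl a) = .inl c := by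
      intro c hc hca n f h hh
      rw [hh.1 a (by rw [pairUp_left ha hc]; exact hca), pairUp_left ha hc]
    refine strutSum_succ (Γ.withLabel lab) (dualLabel X) hw n _ a
      (fun f h hh => hh.2.2.2 a ha x.1 x.2 hx) x _ ?_
    intro i b y
    split_ifs with hy
    · have h1 : ∀ c ∈ (Finset.univ.filter fun c => c ≠ a ∧ g.1 c = c ∧ lab c = .var (endOf y b).1),
          strutSum (Γ.withLabel lab) (dualLabel X) w n
            (fun f h => PairAdm (pairUp g a c).1 lab (endVar f) h.1) =
          strutSum (Γ.withLabel lab) (dualLabel X) w n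
            (fun f h => PairAdm (pairUp g a c).1 lab (endVar f) h.1 ∧ h.1 (.inl a) = .inl c) := by
        intro c hc
        simp only [Finset.mem_filter, Finset.mem_univ, true_and] at hc
        exact strutSum_congr (Γ := Γ.withLabel lab) fun f h =>
          ⟨fun hh => ⟨hh, hfix c hc.2.1 hc.1 f h hh⟩, fun hh => hh.1⟩
      rw [Finset.sum_congr rfl h1, ← strutSum_exists, strutSum]
      · refine Finset.sum_congr rfl fun f _ => ?_
        refine congrArg _ (Eq.symm ?_)
        refine glueSum_absorb Γ lab lab a _ _ i b ?_ _ _ ?_ ?_ ?_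
        · intro j
          simp [pairLabels]
        · exact fun h hh => hh.2
        · intro h h' hon hh
          have h2 : endVar (i.insertNth y f) (i, b) = endOf y b := by
            rw [endVar, Fin.insertNth_apply_same]
          have h3 : endVar (i.insertNth y f) (i, !b) = x := by
            rw [endVar, Fin.insertNth_apply_same, hy]
          have h4 : (fun e : Fin n × Bool => endVar (i.insertNth y f) (i.succAbove e.1, e.2)) =
              endVar f := by
            funext e
            rw [endVar, Fin.insertNth_apply_succAbove]
            rfl
          have h5 := pairAdm_absorb (lab := lab) (labE := endVar (i.insertNth y f)) ha (by rw [h3, hx]) hon hh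
          rw [h4, h2] at h5
          rw [and_iff_left hh, ← h5]
          simp only [Finset.mem_filter, Finset.mem_univ, true_and]
          refine exists_congr fun c => ?_
          constructor
          · rintro ⟨⟨h6, h7, h8⟩, h9, -⟩
            exact ⟨h6, h7, h8, h9⟩
          · rintro ⟨h6, h7, h8, h9⟩
            exact ⟨⟨h6, h7, h8⟩, h9, hfix c h7 h6 f h h9⟩
        -- The absorbed leg `a` would need the label of the far end, but no label matters here,
        -- because `a` is glued to `c`.
        · rintro h ⟨c, hc, -, hac⟩ s hs
          rw [if_neg]
          rintro rfl
          simp only [Finset.mem_filter, Finset.mem_univ, true_and] at hc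
          rw [hs] at hac
          exact hc.1 (Sum.inl_injective hac).symm
      · rintro c c' f h ⟨_, h1⟩ ⟨_, h2⟩
        rw [h1] at h2
        exact Sum.inl_injective h2
    · refine Finset.sum_eq_zero fun f _ => ?_
      rw [glueSum, Finset.sum_eq_zero, smul_zero]
      intro h hh
      simp only [Finset.mem_filter, Finset.mem_univ, true_and] at hh
      obtain ⟨s, hs, hls, hes⟩ := hh.1.2.1 (i, !b)
      have h1 := congrArg h.1 hh.2
      rw [h.2, hes] at h1
      rw [← Sum.inl_injective h1, hx, endVar, Fin.insertNth_apply_same] at hls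
      exact absurd (Subtype.ext (LegLabel.var.inj hls).symm) hy
  rw [pairTerm, h0, factorial_succ_smul]
  simp only [pairTerm, Finset.smul_sum, smul_smul]
  refine Finset.sum_congr rfl fun y _ => Finset.sum_congr rfl fun c _ => ?_
  congr 1
  ring

/-- One step of the Wick expansion: `a` has to be glued to some strut, whose other end is glued to a
leg `c`. There is no term without struts. -/
theorem lsum_pairTerm [CharZero k] (hw : ∀ x y, w (x, y) = w (y, x)) {g : Invol Γ.Leg}
    {lab : Γ.Leg → LegLabel Var} {a : Γ.Leg} (ha : g.1 a = a) {x : X} (hx : lab a = .var x.1) :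
    lsum (pairTerm Γ w g lab) = ∑ y, (2 * w (x, y)) •
      ∑ c with c ≠ a ∧ g.1 c = c ∧ lab c = .var y.1, lsum (pairTerm Γ w (pairUp g a c) lab) := by
  have hf := locallyFinite_pairTerm (k := k) (w := w) (Γ := Γ)
  rw [lsum_succ (hf g lab), pairTerm_zero ha hx, zero_add]
  simp only [pairTerm_succ hw ha hx]
  rw [lsum_sum _ fun y _ => (LocallyFinite.sum _ fun c _ => hf _ lab).smul _]
  refine Finset.sum_congr rfl fun y _ => ?_
  rw [lsum_smul, lsum_sum _ fun c _ => hf _ lab]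

/-- Only the labels of legs that are not glued matter. -/
theorem pairTerm_congr {g : Invol Γ.Leg} {lab lab' : Γ.Leg → LegLabel Var}
    (h : ∀ s, g.1 s = s → lab s = lab' s) : pairTerm Γ w g lab = pairTerm Γ w g lab' := by
  funext n
  rw [pairTerm, pairTerm, strutSum, strutSum]
  refine congrArg _ (Finset.sum_congr rfl fun f _ => congrArg _ ?_)
  have hadm : ∀ h' : Invol (Γ.Leg ⊕ Fin n × Bool),
      PairAdm g.1 lab (endVar f) h'.1 ↔ PairAdm g.1 lab' (endVar f) h'.1 := by
    intro h'
    unfold PairAdm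
    refine and_congr Iff.rfl (and_congr ?_ (and_congr ?_ ?_))
    · refine forall_congr' fun e => exists_congr fun s => and_congr_right fun hs => ?_
      rw [h s hs]
    · refine forall_congr' fun s => forall_congr' fun hs => ?_
      rw [h s hs]
    · refine forall_congr' fun s => forall_congr' fun hs => ?_
      rw [h s hs]
  refine glueSum_eq (Γ := (Γ.withLabel lab').union (struts 𝒱 (pairLabels (dualLabel X) f)))
    (Δ := (Γ.withLabel lab).union (struts 𝒱 (pairLabels (dualLabel X) f))) _ _ (Equiv.refl _)
    (fun _ => rfl) (leg := id) Function.injective_id (Invol.one _) (fun s => ⟨s, rfl⟩)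
    (fun t ht => absurd rfl (ht t)) (fun _ _ t ht => absurd rfl (ht t)) ?_ ?_ ?_
  · intro h1 h2 hon _
    have : h2 = h1 := Subtype.ext (funext hon)
    rw [this, hadm]
  · rintro h1 hh (s | s) hs
    · refine (h s ?_).symm
      by_contra h3
      exact h3 (Sum.inl_injective ((hh.1 s h3).symm.trans hs))
    · rfl
  · intro h' _ e
    have hE : ∀ e, endsMap (Δ := (Γ.withLabel lab).union (struts 𝒱 (pairLabels (dualLabel X) f)))
        (Γ := (Γ.withLabel lab').union (struts 𝒱 (pairLabels (dualLabel X) f))) (Equiv.refl _)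
        (fun _ => rfl) id e = e := by
      rintro (e | e) <;> rfl
    rw [hE, hE]
    exact Walk.left _

end Terms

end FormalSum

end FormalDiagram

end

/-! ### Factoring out the exponential, and pairing as a gluing that extends a given one -/

noncomputable section

namespace FormalDiagram

open Classical Diagram Invol

/-- The extension of an involution by the identity. -/
def Invol.sumId {S : Type} (g : Invol S) (T : Type) : Invol (S ⊕ T) :=
  ⟨Sum.map g.1 id, by rintro (s | t) <;> simp [g.2]⟩

namespace Diagram

variable {𝒱 : VertexKinds} {L : Type*}

theorem glue_union_iso (Γ Δ : Diagram 𝒱 L) (g : Invol Γ.Leg) :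
    Nonempty (Iso ((Γ.glue g).union Δ) ((Γ.union Δ).glue (Invol.sumId g Δ.Leg))) := by
  obtain ⟨f⟩ := glue_one_iso ((Γ.glue g).union Δ)
  have hE1 : ∀ e, endsMap (Δ := (Γ.glue g).union Δ) (Γ := Γ.union Δ) (Equiv.refl _) (fun _ => rfl)
      (Sum.map Subtype.val id) (unionL (Γ.glue g) Δ e) =
      unionL Γ Δ (endsMap (Δ := Γ.glue g) (Γ := Γ) id (fun _ => rfl) Subtype.val e) := by
    rintro (⟨⟨v, i⟩, h⟩ | s) <;> rfl
  have hE2 : ∀ e, endsMap (Δ := (Γ.glue g).union Δ) (Γ := Γ.union Δ) (Equiv.refl _) (fun _ => rfl)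
      (Sum.map Subtype.val id) (unionR (Γ.glue g) Δ e) = unionR Γ Δ e := by
    rintro (⟨⟨v, i⟩, h⟩ | s) <;> rfl
  obtain ⟨f'⟩ := glue_iso (Γ := Γ.union Δ) (Δ := (Γ.glue g).union Δ) (Invol.sumId g Δ.Leg) (Invol.one _)
    (Equiv.refl _) (fun _ => rfl) (Sum.map Subtype.val id) (by
      rintro (s | t) _
      · exact congrArg Sum.inl s.2
      · rfl)
    (fun s t _ _ h => Function.Injective.sumMap Subtype.val_injective Function.injective_id h) (by
      rintro (s | t) h
      · exact ⟨.inl ⟨s, Sum.inl_injective h⟩, rfl, rfl⟩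
      · exact ⟨.inr t, rfl, rfl⟩)
    (by rintro (s | t) _ <;> rfl) (by
      intro e
      induction e using union_ends_cases with
      | hl e =>
        rw [union_mate_unionL, hE1, hE1]
        refine (glue_mate_walk Γ g e).map (unionL Γ Δ) (fun a => ?_) fun a => ?_
        · rw [← union_mate_unionL]
          exact Walk.left _
        · have : unionL Γ Δ (Sum.map id g.1 a) = Sum.map id (Invol.sumId g Δ.Leg).1 (unionL Γ Δ a) := by
            rcases a with ⟨⟨v, i⟩, h⟩ | s <;> rfl
          rw [this]
          exact Walk.right _
      | hr e =>
        rw [union_mate_unionR, hE2, hE2, ← union_mate_unionR]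
        exact Walk.left _)
    fun s h => absurd rfl h
  exact ⟨f.symm.trans f'⟩

end Diagram

namespace FormalSum

variable {k : Type*} [Field k] {𝒱 : VertexKinds} {Var : Type*} {X : Finset Var}

/-- Follow the edge of `Γ` at one end of a strut over `X`. It cannot lead to a flag. If it leads to
a free leg, this is the other end of the strut; if it leads to a glued leg, that leg is over `X` by
assumption. In both cases `Γ` already has a strut over `X`. -/
theorem substantialDiagram_glue {Γ : Diagram 𝒱 (LegLabel Var)} (h : SubstantialDiagram X Γ)
    (g : Invol Γ.Leg) (hg : ∀ s, g.1 s ≠ s → Over X (Γ.label s)) :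
    SubstantialDiagram X (Γ.glue g) := by
  rintro s t hst ⟨hs, ht⟩
  have hw := Walk.left (α := Γ.mate) (g := Sum.map id g.1) (.inr s.1)
  have key : ∀ e : (Γ.glue g).Ends, endsMap (Δ := Γ.glue g) (Γ := Γ) id (fun _ => rfl)
      Subtype.val e = Γ.mate (.inr s.1) → e = .inr t := by
    intro e he
    rw [← hst]
    refine (glue_mate_eq_of_walk Γ g (.inr s) e ?_ ?_).symm
    · rintro rfl
      exact Γ.mate_ne _ he.symm
    · rw [he]
      exact hw
  rcases hm : Γ.mate (.inr s.1) with p | u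
  · have := key (.inl p) (by rw [hm]; rfl)
    cases this
  · by_cases hu : g.1 u = u
    · have := key (.inr ⟨u, hu⟩) (by rw [hm]; rfl)
      rw [← Sum.inr_injective this] at ht
      exact h _ _ hm ⟨hs, ht⟩
    · exact h _ _ hm ⟨hs, hg u hu⟩

theorem applyAdm_empty {S E : Type} {g : Invol S} {Z : Finset S} {Ze : E → Prop}
    {h : Invol (S ⊕ E)} : ApplyAdm ∅ g.1 Z Ze h.1 ↔ h = Invol.sumId g E := by
  constructor
  · rintro ⟨h1, -, h3, h4⟩
    refine Subtype.ext (funext ?_)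
    rintro (s | e)
    · by_cases hs : g.1 s = s
      · refine ((h3 s (Finset.notMem_empty s) hs).resolve_right ?_).trans (congrArg Sum.inl hs.symm)
        rintro ⟨a, ha, -⟩
        exact Finset.notMem_empty a ha
      · exact h1 s hs
    · refine (h4 e).resolve_right ?_
      rintro ⟨a, ha, -⟩
      exact Finset.notMem_empty a ha
  · rintro rfl
    exact ⟨fun _ _ => rfl, fun a ha => absurd ha (Finset.notMem_empty a),
      fun s _ hs => Or.inl (congrArg Sum.inl hs), fun _ => Or.inl rfl⟩

/-- With no legs left to be glued, the gluing is `g` on `Γ` and trivial on the struts, so the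
exponential splits off. -/
theorem lsum_applyTerm_empty (Γ : Diagram 𝒱 (LegLabel Var)) (w : X × X → k) (z : X)
    (g : Invol Γ.Leg) (lab : Γ.Leg → LegLabel Var) (Z : Finset Γ.Leg) :
    lsum (applyTerm Γ w z ∅ g lab Z) = prod (single ((Γ.withLabel lab).glue g))
      (lsum (expTerm 𝒱 (varLabel X) w)) := by
  rw [(isFinitary_prod_right _).map_lsum (locallyFinite_expTerm _ _)]
  congr 1
  funext n
  rw [expTerm, (isFinitary_prod_right _).map_smul, (isFinitary_prod_right _).map_sum, applyTerm,
    strutSum]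
  refine congrArg _ (Finset.sum_congr rfl fun f _ => ?_)
  rw [(isFinitary_prod_right _).map_smul, prod_single]
  refine congrArg _ ?_
  rw [single_congr (glue_union_iso (Γ.withLabel lab) (struts 𝒱 (pairLabels (varLabel X) f)) g),
    glueSum]
  refine (Finset.sum_congr ?_ fun _ _ => rfl).trans (Finset.sum_singleton _ (Invol.sumId g _))
  ext h
  simp only [Finset.mem_filter, Finset.mem_univ, true_and, Finset.mem_singleton]
  exact applyAdm_empty

theorem restrict_dualClasses (w : X × X → k) :
    restrict (dualClasses 𝒱 X) (lsum (expTerm 𝒱 (dualLabel X) w)) =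
      lsum (expTerm 𝒱 (dualLabel X) w) := by
  refine restrict_eq_self fun c hc => ?_
  obtain ⟨n, hn⟩ := exists_ne_zero_of_lsum_ne_zero hc
  obtain ⟨f, rfl⟩ := exists_of_expTerm_ne_zero hn
  exact mk_mem_dualClasses.2 fun s => ⟨_, (endOf (f s.1) s.2).2, by
    obtain ⟨i, b⟩ := s
    cases b <;> rfl⟩

/-- The pairing with the exponential of a quadratic in the dual variables. -/
def pairExp (w : X × X → k) (F : FormalSum k 𝒱 (LegLabel Var)) : FormalSum k 𝒱 (LegLabel Var) :=
  pairing X (lsum (expTerm 𝒱 (dualLabel X) w)) (restrict (functionClasses 𝒱 X) F)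

/-- The restriction to substantial functions in `pairExp` ensures this for arguments of any kind. -/
theorem isFinitary_pairExp (w : X × X → k) :
    IsFinitary (pairExp w : FormalSum k 𝒱 (LegLabel Var) → _) := by
  have := (finitePairs_pairPred (𝒱 := 𝒱) X).isFinitary_right (lsum (expTerm 𝒱 (dualLabel X) w))
  rw [restrict_dualClasses] at this
  simp only [← pairing_eq_op] at this
  exact this

/-- Pairing the result of the gluing `g` with struts is the same as a single gluing of `Γ` to the
struts that extends `g`. -/
theorem pairExp_single (Γ : Diagram 𝒱 (LegLabel Var)) (w : X × X → k) (g : Invol Γ.Leg)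
    (lab : Γ.Leg → LegLabel Var) (h : ⟦(Γ.withLabel lab).glue g⟧ ∈ functionClasses 𝒱 X) :
    pairExp w (single ((Γ.withLabel lab).glue g)) = lsum (pairTerm Γ w g lab) := by
  have hfin := (finitePairs_pairPred (𝒱 := 𝒱) X).isFinitary_left (k := k)
    (single ((Γ.withLabel lab).glue g))
  rw [pairExp, pairing_eq_op, ← restrict_dualClasses, hfin.map_lsum (locallyFinite_expTerm _ _)]
  congr 1
  funext n
  rw [expTerm, hfin.map_smul, hfin.map_sum, pairTerm, strutSum]
  refine congrArg _ (Finset.sum_congr rfl fun f _ => ?_)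
  rw [hfin.map_smul, restrict_single (functionClasses 𝒱 X), if_pos h,
    restrict_single (dualClasses 𝒱 X), if_pos, op_single (natural_pairPred X)]
  swap
  · exact mk_mem_dualClasses.2 fun s => ⟨_, (endOf (f s.1) s.2).2, by
      obtain ⟨i, b⟩ := s
      cases b <;> rfl⟩
  refine congrArg _ ?_
  have hfun := (mk_mem_functionClasses.1 h).1
  have hend : ∀ e : Fin n × Bool, endOf (pairLabels (dualLabel X) f e.1) e.2 =
      .dual (endVar f e).1 := by
    rintro ⟨i, b⟩
    cases b <;> rfl
  -- Outside the image of the remaining legs there are just the legs that `g` glues, where every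
  -- admissible gluing agrees with `g`.
  have hfree : ∀ t, (∀ s : (Fin n × Bool) ⊕ {s // g.1 s = s},
      Sum.elim (Sum.inr : _ → Γ.Leg ⊕ Fin n × Bool) (fun s => Sum.inl s.1) s ≠ t) →
      ∃ s, g.1 s ≠ s ∧ t = .inl s := by
    rintro (s | e) ht
    · exact ⟨s, fun hs => ht (.inr ⟨s, hs⟩) rfl, rfl⟩
    · exact absurd rfl (ht (.inl e))
  refine glueSum_eq (Γ := (Γ.withLabel lab).union (struts 𝒱 (pairLabels (dualLabel X) f)))
    (Δ := (struts 𝒱 (pairLabels (dualLabel X) f)).union ((Γ.withLabel lab).glue g)) _ _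
    (Equiv.sumComm _ _) (by rintro (v | v) <;> rfl)
    (leg := Sum.elim Sum.inr fun s => Sum.inl s.1) ?_ (Invol.sumId g _) ?_ ?_ ?_ ?_ ?_ ?_
  · rintro (s | s) (t | t) e
    · exact congrArg _ (Sum.inr_injective e)
    · cases e
    · cases e
    · exact congrArg _ (Subtype.ext (Sum.inl_injective e))
  · rintro (e | s)
    · exact ⟨.inl e, rfl⟩
    · exact ⟨.inr s, congrArg Sum.inl s.2⟩
  · intro t ht
    obtain ⟨s, hs, rfl⟩ := hfree t ht
    exact fun e => hs (Sum.inl_injective e)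
  · intro h' hh t ht
    obtain ⟨s, hs, rfl⟩ := hfree t ht
    exact hh.1 s hs
  · intro h1 h2 hon hoff
    have honl : ∀ e, h2.1 (.inr e) = Sum.elim Sum.inr (fun s => Sum.inl s.1) (h1.1 (.inl e)) :=
      fun e => hon (.inl e)
    have honr : ∀ s hs, h2.1 (.inl s) =
        Sum.elim Sum.inr (fun s => Sum.inl s.1) (h1.1 (.inr ⟨s, hs⟩)) :=
      fun s hs => hon (.inr ⟨s, hs⟩)
    constructor
    · rintro ⟨⟨h3, -, h5⟩, h6⟩
      have hglued : ∀ s : {s // g.1 s = s}, ∀ e, h1.1 (.inr s) = .inl e →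
          lab s.1 = .var (endVar f e).1 := by
        intro s e he
        obtain ⟨t, ht, het⟩ := h3 e _ (hend e)
        rw [← he, h1.2] at het
        rw [Sum.inr_injective het]
        exact ht
      refine ⟨fun s hs => ?_, fun e => ?_, fun s hs hs' => ?_, fun s hs x hx hs' => ?_⟩
      · refine hoff _ ?_
        rintro (e | t) ht
        · cases ht
        · exact hs (Sum.inl_injective ht ▸ t.2)
      · obtain ⟨t, ht, het⟩ := h3 e _ (hend e)
        refine ⟨t.1, t.2, ht, ?_⟩
        rw [honl, het]
        rfl
      · rw [honr s hs]
        rcases h5 ⟨s, hs⟩ with h7 | ⟨e, h7⟩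
        · rw [h7]
          rfl
        · exact absurd (hglued _ _ h7) (hs' _ (endVar f e).2)
      · rcases h5 ⟨s, hs⟩ with h7 | ⟨e, h7⟩
        · exact absurd h7 (h6 ⟨s, hs⟩ x hx hs')
        · exact ⟨e, by rw [honr s hs, h7]; rfl⟩
    · rintro ⟨-, h3, h4, h5⟩
      refine ⟨⟨fun e x hx => ?_, fun e x hx => ?_, fun t => ?_⟩, fun t x hx ht hh => ?_⟩
      · have h6 := (hend e).symm.trans hx
        obtain ⟨s, hs, hls, hes⟩ := h3 e
        rw [LegLabel.dual.inj h6] at hls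
        refine ⟨⟨s, hs⟩, hls, ?_⟩
        rw [honl] at hes
        rcases h7 : h1.1 (.inl e) with e' | t
        · rw [h7] at hes
          cases hes
        · rw [h7] at hes
          exact congrArg _ (Subtype.ext (Sum.inl_injective hes))
      · have h6 := (hend e).symm.trans hx
        cases h6
      · by_cases h6 : ∃ x ∈ X, lab t.1 = .var x
        · obtain ⟨x, hx, ht⟩ := h6
          obtain ⟨e, he⟩ := h5 t.1 t.2 x hx ht
          rw [honr t.1 t.2] at he
          rcases h7 : h1.1 (.inr t) with e' | t'
          · exact Or.inr ⟨e', rfl⟩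
          · rw [h7] at he
            cases he
        · push Not at h6
          have he := h4 t.1 t.2 h6
          rw [honr t.1 t.2] at he
          rcases h7 : h1.1 (.inr t) with e' | t'
          · exact Or.inr ⟨e', rfl⟩
          · rw [h7] at he
            exact Or.inl (congrArg _ (Subtype.ext (Sum.inl_injective he)))
      · obtain ⟨e, he⟩ := h5 t.1 t.2 x hx ht
        rw [honr t.1 t.2, hh] at he
        cases he
  · rintro h' - (e | s) - <;> rfl
  · intro h' hoff e
    have hE1 : ∀ e, endsMap
        (Δ := (struts 𝒱 (pairLabels (dualLabel X) f)).union ((Γ.withLabel lab).glue g))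
        (Γ := (Γ.withLabel lab).union (struts 𝒱 (pairLabels (dualLabel X) f)))
        (Equiv.sumComm _ _) (by rintro (v | v) <;> rfl) (Sum.elim Sum.inr fun s => Sum.inl s.1)
        (unionL _ _ e) = unionR _ _ e := by
      rintro (⟨⟨v, i⟩, h⟩ | s) <;> rfl
    have hE2 : ∀ e, endsMap
        (Δ := (struts 𝒱 (pairLabels (dualLabel X) f)).union ((Γ.withLabel lab).glue g))
        (Γ := (Γ.withLabel lab).union (struts 𝒱 (pairLabels (dualLabel X) f)))
        (Equiv.sumComm _ _) (by rintro (v | v) <;> rfl) (Sum.elim Sum.inr fun s => Sum.inl s.1)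
        (unionR _ _ e) = unionL _ _ (endsMap (Δ := (Γ.withLabel lab).glue g)
          (Γ := Γ.withLabel lab) id (fun _ => rfl) Subtype.val e) := by
      rintro (⟨⟨v, i⟩, h⟩ | s) <;> rfl
    induction e using union_ends_cases with
    | hl e =>
      rw [union_mate_unionL, hE1, hE1, ← union_mate_unionR]
      exact Walk.left _
    | hr e =>
      rw [union_mate_unionR, hE2, hE2]
      refine (glue_mate_walk (Γ.withLabel lab) g e).map (unionL _ _) (fun a => ?_) fun a => ?_
      · rw [← union_mate_unionL]
        exact Walk.left _
      · rcases a with p | s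
        · exact Walk.refl _
        · by_cases hs : g.1 s = s
          · rw [Sum.map_inr, hs]
            exact Walk.refl _
          · have h1 : h'.1 (.inl s) = .inl (g.1 s) := by
              refine hoff _ ?_
              rintro (e | t) ht
              · cases ht
              · exact hs (Sum.inl_injective ht ▸ t.2)
            have h2 := Walk.right
              (α := ((Γ.withLabel lab).union (struts 𝒱 (pairLabels (dualLabel X) f))).mate)
              (g := Sum.map id h'.1) (.inr (.inl s))
            rw [Sum.map_inr, h1] at h2
            exact h2

end FormalSum

end FormalDiagram

end

/-! ### Integration by parts for a single diagram -/

noncomputable section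

namespace FormalDiagram

open Classical Diagram Invol

namespace FormalSum

variable {k : Type*} [Field k] [CharZero k] {𝒱 : VertexKinds} {Var : Type*} {X : Finset Var}

/-- Partial integration for a labeled diagram, the relation between gluing a leg `∂_z` to struts
before and after integration. -/
theorem sum_lsum_pairTerm_update {Γ : Diagram 𝒱 (LegLabel Var)} {w w' : X × X → k} (z : X)
    (hw' : ∀ x y, w' (x, y) = w' (y, x))
    (hww : ∀ y', ∑ y, 2 * w (z, y) * (2 * w' (y, y')) = if y' = z then -1 else 0)
    {h : Invol Γ.Leg} (lab : Γ.Leg → LegLabel Var) {a : Γ.Leg} (ha : h.1 a = a) :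
    ∑ y, (2 * w (z, y)) • lsum (pairTerm Γ w' h (Function.update lab a (.var y.1))) =
      - ∑ c with c ≠ a ∧ h.1 c = c ∧ lab c = .var z.1, lsum (pairTerm Γ w' (pairUp h a c) lab) := by
  -- Expand at `a`, with its temporary label `y`. After `a` has been glued to `c`, this label has no
  -- influence any more.
  have h1 : ∀ y : X, lsum (pairTerm Γ w' h (Function.update lab a (.var y.1))) =
      ∑ y' : X, (2 * w' (y, y')) • ∑ c with c ≠ a ∧ h.1 c = c ∧ lab c = .var y'.1,
        lsum (pairTerm Γ w' (pairUp h a c) lab) := by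
    intro y
    rw [lsum_pairTerm hw' (x := y) ha (Function.update_self _ _ _)]
    refine Finset.sum_congr rfl fun y' _ => ?_
    congr 1
    refine Finset.sum_congr ?_ fun c hc => ?_
    · ext c
      simp only [Finset.mem_filter, Finset.mem_univ, true_and]
      refine and_congr_right fun hca => ?_
      rw [Function.update_of_ne hca]
    · simp only [Finset.mem_filter, Finset.mem_univ, true_and] at hc
      congr 1
      refine pairTerm_congr fun s hs => Function.update_of_ne ?_ _ _
      rintro rfl
      rw [pairUp_left ha hc.2.1] at hs
      exact hc.1 hs
  simp only [h1, Finset.smul_sum (r := (2 * w (z, _))), smul_smul]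
  rw [Finset.sum_comm]
  -- The sum over `y` is the product of the two matrices, which is minus the identity; only the
  -- partners `c` labeled `z` survive.
  simp only [← Finset.sum_smul, hww]
  rw [Finset.sum_eq_single z]
  · rw [if_pos rfl, neg_one_smul]
  · intro y' _ hy'
    rw [if_neg hy', zero_smul]
  · exact fun h => absurd (Finset.mem_univ _) h

/-- The gluings that contribute to the divergence after one more leg has been glued. -/
theorem sum_divAdm_insert {M : Type*} [AddCommGroup M] {S : Type} [Finite S] {A Z : Finset S}
    {g : Invol S} {lab : S → LegLabel Var} {z : Var} {a : S} (F : Invol S → M) (haA : a ∉ A)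
    (ha : g.1 a = a) (hla : lab a ≠ .var z) (hZ : ∀ c ∈ Z, g.1 c = c ∧ c ∉ A ∧ c ≠ a ∧
      lab c = .var z) (hA : ∀ s ∈ A, lab s ≠ .var z) [Fintype S] :
    ∑ h : Invol S with DivAdm A g.1 lab z Z h.1,
      ∑ c with c ≠ a ∧ h.1 c = c ∧ lab c = .var z, F (pairUp h a c) =
    ∑ c ∈ Z, ∑ h : Invol S with DivAdm A (pairUp g a c).1 lab z (Z.erase c) h.1, F h +
    ∑ h : Invol S with DivAdm (insert a A) g.1 lab z Z h.1, F h := by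
  have hfixa : ∀ h : Invol S, DivAdm A g.1 lab z Z h.1 → h.1 a = a := fun h hh =>
    hh.apply_eq_self ha haA (Or.inl hla)
  -- When `c ∈ Z`, both `a` and `c` are left free by all gluings that are admissible for `A`, and
  -- can be joined afterwards.
  have e1 : ∀ c ∈ Z, ∑ h : Invol S with DivAdm A (pairUp g a c).1 lab z (Z.erase c) h.1, F h =
      ∑ h : Invol S with DivAdm A g.1 lab z Z h.1, F (pairUp h a c) := by
    intro c hc
    obtain ⟨hgc, hcA, hca, hlc⟩ := hZ c hc
    refine (sum_pairUp a c _ _ F ?_ ?_ ?_).symm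
    · exact fun h hh => ⟨hfixa h hh, hh.apply_eq_self hgc hcA (Or.inr hc)⟩
    · intro h hh
      rw [hh.1 a (by rw [pairUp_left ha hgc]; exact hca), pairUp_left ha hgc]
    · exact fun h h1 h2 => divAdm_pairUp haA hcA ha hgc hca h1 h2
  -- The gluings that include `a` are sorted by its partner `c`, which lies outside `Z`. It need not
  -- be free for a given `h`, hence the extra condition.
  have e2 : ∑ h : Invol S with DivAdm (insert a A) g.1 lab z Z h.1, F h =
      ∑ c with c ∉ Z ∧ c ≠ a ∧ lab c = .var z,
        ∑ h : Invol S with DivAdm A g.1 lab z Z h.1 ∧ h.1 c = c, F (pairUp h a c) := by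
    rw [← Finset.sum_fiberwise_of_maps_to (g := fun h : Invol S => h.1 a)
      (t := Finset.univ.filter fun c => c ∉ Z ∧ c ≠ a ∧ lab c = .var z)]
    · refine Finset.sum_congr rfl fun c hc => ?_
      simp only [Finset.mem_filter, Finset.mem_univ, true_and] at hc
      refine (Finset.sum_congr ?_ fun _ _ => rfl).trans
        ((sum_pairUp a c (fun h => DivAdm A g.1 lab z Z h.1 ∧ h.1 c = c)
          (fun h => DivAdm (insert a A) g.1 lab z Z h.1 ∧ h.1 a = c) F ?_ ?_ ?_).symm.trans
          (Finset.sum_congr ?_ fun _ _ => rfl))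
      rotate_right
      · ext h
        simp only [Finset.mem_filter, Finset.mem_univ, true_and]
      · ext h
        simp only [Finset.mem_filter, Finset.mem_univ, true_and]
      · exact fun h hh => ⟨hfixa h hh.1, hh.2⟩
      · exact fun h hh => hh.2
      · intro h h1 h2
        have h3 := divAdm_insert (g := g) (Z := Z) haA (fun h3 => hA c h3 hc.2.2) ha hc.2.1 hla h1 h2
        rw [pairUp_left h1 h2, and_iff_left h2, and_iff_left rfl, ← h3]
        exact ⟨fun h4 => ⟨h4, hc.2.2, hc.1⟩, fun h4 => h4.1⟩
    · intro h hh
      simp only [Finset.mem_filter, Finset.mem_univ, true_and] at hh ⊢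
      obtain ⟨h1, h2, h3⟩ := hh.2.1 a (Finset.mem_insert_self _ _)
      exact ⟨h3, fun h4 => hla (h4 ▸ h2), h2⟩
  have e3 : ∀ (s : Finset S) (q : Invol S → Prop), ∑ c ∈ s, ∑ h : Invol S with
      q h ∧ h.1 c = c, F (pairUp h a c) =
      ∑ h : Invol S with q h, ∑ c ∈ s with h.1 c = c, F (pairUp h a c) := by
    intro s q
    simp only [Finset.sum_filter, ite_and]
    rw [Finset.sum_comm]
    refine Finset.sum_congr rfl fun h _ => ?_
    split_ifs <;> simp
  have e4 : ∀ c ∈ Z, ∑ h : Invol S with DivAdm A g.1 lab z Z h.1, F (pairUp h a c) =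
      ∑ h : Invol S with DivAdm A g.1 lab z Z h.1 ∧ h.1 c = c, F (pairUp h a c) := by
    intro c hc
    refine Finset.sum_congr (Finset.filter_congr fun h _ => ?_) fun _ _ => rfl
    exact ⟨fun hh => ⟨hh, hh.apply_eq_self (hZ c hc).1 (hZ c hc).2.1 (Or.inr hc)⟩, fun hh => hh.1⟩
  rw [Finset.sum_congr rfl fun c hc => (e1 c hc).trans (e4 c hc), e2, e3, e3,
    ← Finset.sum_add_distrib]
  refine Finset.sum_congr rfl fun h _ => ?_
  -- For fixed `h`, the possible partners of `a` are divided into those in `Z` and the others.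
  rw [← Finset.sum_union]
  · refine Finset.sum_congr ?_ fun _ _ => rfl
    ext c
    simp only [Finset.mem_filter, Finset.mem_univ, true_and, Finset.mem_union]
    constructor
    · rintro ⟨h1, h2, h3⟩
      by_cases h4 : c ∈ Z
      · exact Or.inl ⟨h4, h2⟩
      · exact Or.inr ⟨⟨h4, h1, h3⟩, h2⟩
    · rintro (⟨h1, h2⟩ | ⟨⟨h1, h3, h4⟩, h2⟩)
      · exact ⟨(hZ c h1).2.2.1, h2, (hZ c h1).2.2.2⟩
      · exact ⟨h3, h2, h4⟩
  · refine Finset.disjoint_left.2 fun c h1 h2 => ?_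
    simp only [Finset.mem_filter, Finset.mem_univ, true_and] at h1 h2
    exact h2.1.1 h1.1

/-- Partial integration for a diagram, with part of the legs glued already. -/
theorem exists_applyTerm_eq_prod {Γ : Diagram 𝒱 (LegLabel Var)} (hΓ : SubstantialDiagram X Γ)
    {w w' : X × X → k} (z : X) (hw : ∀ x y, w (x, y) = w (y, x))
    (hw' : ∀ x y, w' (x, y) = w' (y, x))
    (hww : ∀ y', ∑ y, 2 * w (z, y) * (2 * w' (y, y')) = if y' = z then -1 else 0)
    (A : Finset Γ.Leg) : ∀ (g : Invol Γ.Leg) (lab : Γ.Leg → LegLabel Var) (Z : Finset Γ.Leg),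
      (∀ a ∈ A, g.1 a = a ∧ lab a = .dual z.1) → (∀ c ∈ Z, g.1 c = c ∧ lab c = .var z.1) →
      (∀ s ∉ A, g.1 s = s → ∃ x, lab s = .var x) →
      (∀ s, Over X (lab s) ↔ Over X (Γ.label s)) → (∀ s, g.1 s ≠ s → Over X (Γ.label s)) →
      ∃ P : FormalSum k 𝒱 (LegLabel Var), restrict (functionClasses 𝒱 X) P = P ∧
        lsum (applyTerm Γ w z A g lab Z) = prod P (lsum (expTerm 𝒱 (varLabel X) w)) ∧
        pairExp w' P = (-1 : k) ^ A.card • ∑ h : Invol Γ.Leg with DivAdm A g.1 lab z.1 Z h.1,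
          lsum (pairTerm Γ w' h lab) := by
  -- The gluing, the labels and the targets are quantified inside, because gluing a leg to `Z`
  -- changes `g` and `Z`, and gluing it to a strut changes the labels and possibly `Z`.
  induction A using Finset.induction_on with
  | empty =>
    intro g lab Z _ _ h3 h4 h5
    have hmem : ⟦(Γ.withLabel lab).glue g⟧ ∈ functionClasses 𝒱 X := by
      refine mk_mem_functionClasses.2 ⟨fun s => h3 s.1 (Finset.notMem_empty _) s.2, ?_⟩
      refine substantialDiagram_glue (Γ := Γ.withLabel lab) ?_ g fun s hs => (h4 s).2 (h5 s hs)
      intro s t hst hh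
      exact hΓ s t hst ⟨(h4 s).1 hh.1, (h4 t).1 hh.2⟩
    refine ⟨single ((Γ.withLabel lab).glue g), by rw [restrict_single, if_pos hmem],
      lsum_applyTerm_empty Γ w z g lab Z, ?_⟩
    rw [pairExp_single Γ w' g lab hmem, Finset.card_empty, pow_zero, one_smul]
    refine Eq.symm ((Finset.sum_congr ?_ fun _ _ => rfl).trans (Finset.sum_singleton _ g))
    ext h
    simp only [Finset.mem_filter, Finset.mem_univ, true_and, Finset.mem_singleton]
    constructor
    · rintro ⟨h6, -, h7⟩
      refine Subtype.ext (funext fun s => ?_)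
      by_cases hs : g.1 s = s
      · rw [hs]
        exact (h7 s (Finset.notMem_empty _) hs).resolve_right (Finset.notMem_empty _)
      · exact h6 s hs
    · rintro rfl
      exact ⟨fun _ _ => rfl, fun a ha => absurd ha (Finset.notMem_empty a),
        fun s _ hs => Or.inl hs⟩
  | insert a A haA ih =>
    intro g lab Z h1 h2 h3 h4 h5
    obtain ⟨ha, hla⟩ := h1 a (Finset.mem_insert_self _ _)
    have hvar : ∀ {s}, lab s = .dual z.1 → ∀ {x}, lab s ≠ .var x := by
      intro s hs x h
      rw [hs] at h
      cases h
    have haZ : a ∉ Z := fun h => hvar hla (h2 a h).2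
    have hAd : ∀ s ∈ A, lab s = .dual z.1 := fun s hs => (h1 s (Finset.mem_insert_of_mem hs)).2
    have hZA : ∀ c ∈ Z, c ∉ A := fun c hc hcA => hvar (hAd c hcA) (h2 c hc).2
    have hZa : ∀ c ∈ Z, c ≠ a := fun c hc => ne_of_mem_of_not_mem hc haZ
    have hov : Over X (.dual z.1) := ⟨z.1, z.2, Or.inr rfl⟩
    have hov' : ∀ y : X, Over X (.var y.1) := fun y => ⟨y.1, y.2, Or.inl rfl⟩
    -- The case in which `a` is glued to the target `c`.
    have IH1 : ∀ c : Z, _ := fun c => ih (pairUp g a c.1) lab (Z.erase c.1) (fun s hs => by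
        rw [pairUp_of_ne ha (h2 c c.2).1 (ne_of_mem_of_not_mem hs haA)
          (fun e => hZA c c.2 (e ▸ hs))]
        exact h1 s (Finset.mem_insert_of_mem hs)) (fun s hs => by
        obtain ⟨hs1, hs2⟩ := Finset.mem_erase.1 hs
        rw [pairUp_of_ne ha (h2 c c.2).1 (hZa s hs2) hs1]
        exact h2 s hs2) (fun s hs hgs => by
        have hsa : s ≠ a := by
          rintro rfl
          rw [pairUp_left ha (h2 c c.2).1] at hgs
          exact hZa c c.2 hgs
        have hsc : s ≠ c := by
          rintro rfl
          rw [pairUp_right ha (h2 c c.2).1] at hgs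
          exact hsa hgs.symm
        rw [pairUp_of_ne ha (h2 c c.2).1 hsa hsc] at hgs
        exact h3 s (by rw [Finset.mem_insert, not_or]; exact ⟨hsa, hs⟩) hgs) h4 (fun s hgs => by
        by_cases hsa : s = a
        · rw [hsa, ← h4, hla]
          exact hov
        by_cases hsc : s = c
        · rw [hsc, ← h4, (h2 c c.2).2]
          exact hov' z
        rw [pairUp_of_ne ha (h2 c c.2).1 hsa hsc] at hgs
        exact h5 s hgs)
    -- The case in which `a` is glued to a strut with far end `y` and takes its place.
    have IH2 : ∀ y : X, _ := fun y => ih g (Function.update lab a (.var y.1))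
        (if y = z then insert a Z else Z) (fun s hs => by
        rw [Function.update_of_ne (ne_of_mem_of_not_mem hs haA)]
        exact h1 s (Finset.mem_insert_of_mem hs)) (fun s hs => by
        have hZ : s ∈ Z → g.1 s = s ∧ Function.update lab a (.var y.1) s = .var z.1 := fun hs => by
          rw [Function.update_of_ne (hZa s hs)]
          exact h2 s hs
        split_ifs at hs with hy
        · rcases Finset.mem_insert.1 hs with rfl | hs
          · rw [Function.update_self, hy]
            exact ⟨ha, rfl⟩
          · exact hZ hs
        · exact hZ hs) (fun s hs hgs => by
        by_cases hsa : s = a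
        · rw [hsa, Function.update_self]
          exact ⟨_, rfl⟩
        · rw [Function.update_of_ne hsa]
          exact h3 s (by rw [Finset.mem_insert, not_or]; exact ⟨hsa, hs⟩) hgs) (fun s => by
        by_cases hsa : s = a
        · rw [hsa, Function.update_self, ← h4, hla]
          exact ⟨fun _ => hov, fun _ => hov' y⟩
        · rw [Function.update_of_ne hsa]
          exact h4 s) h5
    choose P1 hP1 hV1 hE1 using IH1
    choose P2 hP2 hV2 hE2 using IH2
    have hr := isFinitary_restrict (k := k) (functionClasses 𝒱 X)
    have hp := isFinitary_prod_left (lsum (expTerm 𝒱 (varLabel X) w))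
    have he := isFinitary_pairExp (𝒱 := 𝒱) w'
    refine ⟨∑ c : Z, P1 c + ∑ y, (2 * w (z, y)) • P2 y, ?_, ?_, ?_⟩
    · simp only [hr.map_add, hr.map_sum, hr.map_smul, hP1, hP2]
    · rw [lsum_applyTerm_insert hw z lab haA haZ ha fun c hc => ⟨(h2 c hc).1, hZA c hc⟩,
        hp.map_add, hp.map_sum, hp.map_sum, ← Finset.sum_coe_sort Z]
      refine congrArg₂ _ (Finset.sum_congr rfl fun c _ => hV1 c) ?_
      exact Finset.sum_congr rfl fun y _ => by rw [hp.map_smul, ← hV2 y]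
    · have hdiv : ∀ (y : X) (h : Invol Γ.Leg), DivAdm A g.1 (Function.update lab a (.var y.1)) z.1
          (if y = z then insert a Z else Z) h.1 ↔ DivAdm A g.1 lab z.1 Z h.1 := by
        intro y h
        have := divAdm_update (A := A) (Z := Z) (g := g) (h := h) (z := z.1) (a := a)
          (lab := lab) (hvar hla) y.1
        rw [← this]
        simp only [Subtype.ext_iff]
      rw [he.map_add, he.map_sum, he.map_sum]
      simp only [he.map_smul, hE1, hE2, hdiv]
      -- The gluings of struts to `a` before and after integration combine to joining `a` to another
      -- `z`-leg, with a minus sign.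
      have e1 : ∑ y : X, (2 * w (z, y)) • (-1 : k) ^ A.card •
          ∑ h : Invol Γ.Leg with DivAdm A g.1 lab z.1 Z h.1,
            lsum (pairTerm Γ w' h (Function.update lab a (.var y.1))) =
          -((-1 : k) ^ A.card • ∑ h : Invol Γ.Leg with DivAdm A g.1 lab z.1 Z h.1,
            ∑ c with c ≠ a ∧ h.1 c = c ∧ lab c = .var z.1,
              lsum (pairTerm Γ w' (pairUp h a c) lab)) := by
        simp only [smul_comm (2 * w (z, _)) ((-1 : k) ^ A.card)]
        rw [← Finset.smul_sum, ← smul_neg]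
        refine congrArg _ ?_
        simp only [Finset.smul_sum (r := (2 * w (z, _)))]
        rw [Finset.sum_comm, ← Finset.sum_neg_distrib]
        refine Finset.sum_congr rfl fun h hh => ?_
        simp only [Finset.mem_filter, Finset.mem_univ, true_and] at hh
        exact sum_lsum_pairTerm_update z hw' hww lab (hh.apply_eq_self ha haA (Or.inl (hvar hla)))
      -- The part of the negative sum with partners in `Z` cancels the contribution of `P1`. The
      -- rest is the sum for `insert a A`, and its minus sign accounts for the additional leg.
      rw [e1, sum_divAdm_insert (fun h => lsum (pairTerm Γ w' h lab)) haA ha (hvar hla)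
        (fun c hc => ⟨(h2 c hc).1, hZA c hc, hZa c hc, (h2 c hc).2⟩) (fun s hs => hvar (hAd s hs)),
        ← Finset.smul_sum, Finset.sum_coe_sort Z fun c =>
          ∑ h : Invol Γ.Leg with DivAdm A (pairUp g a c).1 lab z.1 (Z.erase c) h.1,
            lsum (pairTerm Γ w' h lab), Finset.card_insert_of_notMem haA, pow_succ, mul_neg_one,
        neg_smul, smul_add]
      abel

end FormalSum

end FormalDiagram

end

/-! ### Application and divergence of an operator as instances of admissible gluings -/

noncomputable section

namespace FormalDiagram

open Classical Diagram Invol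

namespace FormalSum

section

variable {𝒱 : VertexKinds} {Var : Type*}

/-- The legs of the operator that have to be glued. -/
def operatorLegs (z : Var) (Γ Δ : Diagram 𝒱 (LegLabel Var)) : Finset (Γ.union Δ).Leg :=
  Finset.univ.filter fun s => ∃ t, s = .inl t ∧ Γ.label t = .dual z

/-- The legs of the function to which they can be glued. -/
def functionLegs (z : Var) (Γ Δ : Diagram 𝒱 (LegLabel Var)) : Finset (Γ.union Δ).Leg :=
  Finset.univ.filter fun s => ∃ t, s = .inr t ∧ Δ.label t = .var z

variable {z : Var} {Γ Δ : Diagram 𝒱 (LegLabel Var)}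

theorem inl_mem_operatorLegs {s : Γ.Leg} :
    (.inl s : Γ.Leg ⊕ Δ.Leg) ∈ operatorLegs z Γ Δ ↔ Γ.label s = .dual z := by
  rw [operatorLegs, Finset.mem_filter]
  constructor
  · rintro ⟨-, t, ht, h⟩
    rwa [Sum.inl_injective ht]
  · exact fun h => ⟨Finset.mem_univ _, s, rfl, h⟩

theorem inr_notMem_operatorLegs {t : Δ.Leg} :
    (.inr t : Γ.Leg ⊕ Δ.Leg) ∉ operatorLegs z Γ Δ := by
  rw [operatorLegs, Finset.mem_filter]
  rintro ⟨-, s, hs, -⟩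
  cases hs

theorem inr_mem_functionLegs {t : Δ.Leg} :
    (.inr t : Γ.Leg ⊕ Δ.Leg) ∈ functionLegs z Γ Δ ↔ Δ.label t = .var z := by
  rw [functionLegs, Finset.mem_filter]
  constructor
  · rintro ⟨-, s, hs, h⟩
    rwa [Sum.inr_injective hs]
  · exact fun h => ⟨Finset.mem_univ _, t, rfl, h⟩

theorem inl_notMem_functionLegs {s : Γ.Leg} :
    (.inl s : Γ.Leg ⊕ Δ.Leg) ∉ functionLegs z Γ Δ := by
  rw [functionLegs, Finset.mem_filter]
  rintro ⟨-, t, ht, -⟩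
  cases ht

theorem card_operatorLegs {l : ℕ} (h : OperatorDiagram z l Γ) :
    (operatorLegs z Γ Δ).card = l := by
  rw [← h.2, ← Nat.card_eq_finsetCard]
  refine (Nat.card_congr (Equiv.ofBijective
    (fun s : {s // Γ.label s = .dual z} => (⟨.inl s.1, inl_mem_operatorLegs.2 s.2⟩ :
      operatorLegs z Γ Δ)) ⟨?_, ?_⟩)).symm
  · intro s t h
    exact Subtype.ext (Sum.inl_injective (congrArg Subtype.val h))
  · rintro ⟨s | t, hs⟩
    · exact ⟨⟨s, inl_mem_operatorLegs.1 hs⟩, rfl⟩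
    · exact absurd hs inr_notMem_operatorLegs

theorem OperatorDiagram.label_eq {l : ℕ} (h : OperatorDiagram z l Γ) (s : Γ.Leg) :
    Γ.label s = .dual z ∨ ∃ x, Γ.label s = .var x := by
  rcases hs : Γ.label s with x | x
  · exact Or.inr ⟨x, rfl⟩
  · exact Or.inl (by rw [h.1 s x hs])

/-- The initial state of the induction: nothing is glued, and the targets are the `z`-legs of the
function and of the struts. The `z`-legs of the operator itself are not among them. -/
theorem applyAdm_operatorLegs {l : ℕ} (hΓ : OperatorDiagram z l Γ) {E : Type}
    {Ze : E → Prop} {lE : E → LegLabel Var} (hE : ∀ e, Ze e ↔ lE e = .var z)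
    (h : Invol ((Γ.Leg ⊕ Δ.Leg) ⊕ E)) (h' : Invol (Γ.Leg ⊕ (Δ.Leg ⊕ E)))
    (hh : ∀ s, h'.1 (Equiv.sumAssoc _ _ _ s) = Equiv.sumAssoc _ _ _ (h.1 s)) :
    ApplyAdm (operatorLegs z Γ Δ) (Invol.one _).1 (functionLegs z Γ Δ) Ze h.1 ↔
      ApplyPred Var Γ.Leg (Δ.Leg ⊕ E) Γ.label (Sum.elim Δ.label lE) h'.1 := by
  have h1 : ∀ s, h'.1 (.inl s) = Equiv.sumAssoc _ _ _ (h.1 (.inl (.inl s))) :=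
    fun s => hh (.inl (.inl s))
  have h2 : ∀ t, h'.1 (.inr (.inl t)) = Equiv.sumAssoc _ _ _ (h.1 (.inl (.inr t))) :=
    fun t => hh (.inl (.inr t))
  have h3 : ∀ e, h'.1 (.inr (.inr e)) = Equiv.sumAssoc _ _ _ (h.1 (.inr e)) :=
    fun e => hh (.inr e)
  have hinj := (Equiv.sumAssoc Γ.Leg Δ.Leg E).injective
  constructor
  · rintro ⟨-, h4, h5, h6⟩
    refine ⟨fun s x hs => ?_, fun s x hs => ?_, ?_⟩
    · have hx := hΓ.1 s x hs
      subst hx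
      rw [h1]
      rcases h4 (.inl s) (inl_mem_operatorLegs.2 hs) with ⟨c, hc, h7⟩ | ⟨e, he, h7⟩
      · rcases c with c | c
        · exact absurd hc inl_notMem_functionLegs
        · exact ⟨.inl c, inr_mem_functionLegs.1 hc, by rw [h7]; rfl⟩
      · exact ⟨.inr e, (hE e).1 he, by rw [h7]; rfl⟩
    · have hns : (.inl s : Γ.Leg ⊕ Δ.Leg) ∉ operatorLegs z Γ Δ := by
        rw [inl_mem_operatorLegs, hs]
        exact fun h => by cases h
      rcases h5 (.inl s) hns rfl with h7 | ⟨a, ha, h7⟩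
      · rw [h1, h7]
        rfl
      · have h8 := congrArg h.1 h7
        rw [h.2] at h8
        rcases h4 a ha with ⟨c, hc, h9⟩ | ⟨e, _, h9⟩
        · rw [h9] at h8
          rw [← Sum.inl_injective h8] at hc
          exact absurd hc inl_notMem_functionLegs
        · rw [h9] at h8
          cases h8
    · have hA : ∀ a ∈ operatorLegs z Γ Δ, ∃ s, a = .inl s := by
        rintro (s | t) ha
        · exact ⟨s, rfl⟩
        · exact absurd ha inr_notMem_operatorLegs
      rintro (t | e)
      · rcases h5 (.inr t) inr_notMem_operatorLegs rfl with h7 | ⟨a, ha, h7⟩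
        · exact Or.inl (by rw [h2, h7]; rfl)
        · obtain ⟨s, rfl⟩ := hA a ha
          exact Or.inr ⟨s, by rw [h2, h7]; rfl⟩
      · rcases h6 e with h7 | ⟨a, ha, h7⟩
        · exact Or.inl (by rw [h3, h7]; rfl)
        · obtain ⟨s, rfl⟩ := hA a ha
          exact Or.inr ⟨s, by rw [h3, h7]; rfl⟩
  · rintro ⟨h4, h5, h6⟩
    have hd : ∀ s t, h'.1 (.inr t) = .inl s → Γ.label s = .dual z := by
      intro s t hst
      refine (hΓ.label_eq s).resolve_right ?_
      rintro ⟨x, hx⟩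
      have h7 := h5 s x hx
      rw [← hst, h'.2, hst] at h7
      cases h7
    refine ⟨fun s hs => absurd rfl hs, ?_, ?_, ?_⟩
    · rintro (s | t) hs
      · obtain ⟨t, ht, h7⟩ := h4 s z (inl_mem_operatorLegs.1 hs)
        rw [h1] at h7
        rcases t with t | e
        · exact Or.inl ⟨.inr t, inr_mem_functionLegs.2 ht, hinj h7⟩
        · exact Or.inr ⟨e, (hE e).2 ht, hinj h7⟩
      · exact absurd hs inr_notMem_operatorLegs
    · rintro (s | t) hs -
      · rw [inl_mem_operatorLegs] at hs
        obtain ⟨x, hx⟩ := (hΓ.label_eq s).resolve_left hs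
        have h7 := h5 s x hx
        rw [h1] at h7
        exact Or.inl (hinj h7)
      · rcases h6 (.inl t) with h7 | ⟨s, h7⟩
        · rw [h2] at h7
          exact Or.inl (hinj h7)
        · refine Or.inr ⟨.inl s, inl_mem_operatorLegs.2 (hd s _ h7), ?_⟩
          rw [h2] at h7
          exact hinj h7
    · intro e
      rcases h6 (.inr e) with h7 | ⟨s, h7⟩
      · rw [h3] at h7
        exact Or.inl (hinj h7)
      · refine Or.inr ⟨.inl s, inl_mem_operatorLegs.2 (hd s _ h7), ?_⟩
        rw [h3] at h7
        exact hinj h7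

/-- Since `Z` contains all `z`-legs of the function, `DivAdm` leaves just the `z`-legs of the
operator as targets, as in the divergence. -/
theorem divAdm_operatorLegs (h : Invol Γ.Leg) (h' : Invol (Γ.Leg ⊕ Δ.Leg))
    (hh : ∀ s, h'.1 (.inl s) = .inl (h.1 s)) (hr : ∀ t, h'.1 (.inr t) = .inr t) :
    IsDivGluing z Γ h ↔ DivAdm (operatorLegs z Γ Δ) (Invol.one _).1 (Γ.union Δ).label z
      (functionLegs z Γ Δ) h'.1 := by
  constructor
  · rintro ⟨h1, h2⟩
    refine ⟨fun s hs => absurd rfl hs, ?_, ?_⟩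
    · rintro (s | t) hs
      · rw [hh]
        exact ⟨rfl, h1 s (inl_mem_operatorLegs.1 hs), inl_notMem_functionLegs⟩
      · exact absurd hs inr_notMem_operatorLegs
    · rintro (s | t) hs -
      · rw [inl_mem_operatorLegs] at hs
        rw [hh, inl_mem_operatorLegs]
        exact (h2 s hs).imp (congrArg _) id
      · exact Or.inl (hr t)
  · rintro ⟨-, h2, h3⟩
    refine ⟨fun s hs => ?_, fun s hs => ?_⟩
    · have := (h2 (.inl s) (inl_mem_operatorLegs.2 hs)).2.1
      rwa [hh] at this
    · have := h3 (.inl s) (fun h => hs (inl_mem_operatorLegs.1 h)) rfl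
      rw [hh, inl_mem_operatorLegs] at this
      exact this.imp (fun h => Sum.inl_injective h) id

theorem divAdm_inr {h : Invol (Γ.Leg ⊕ Δ.Leg)} (hh : DivAdm (operatorLegs z Γ Δ) (Invol.one _).1
    (Γ.union Δ).label z (functionLegs z Γ Δ) h.1) (t : Δ.Leg) : h.1 (.inr t) = .inr t := by
  refine hh.apply_eq_self (g := Invol.one _) rfl inr_notMem_operatorLegs ?_
  by_cases ht : Δ.label t = .var z
  · exact Or.inr (inr_mem_functionLegs.2 ht)
  · exact Or.inl ht

end

variable {k : Type*} [Field k] {𝒱 : VertexKinds} {Var : Type*} {X : Finset Var}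

theorem substantialDiagram_union {Γ Δ : Diagram 𝒱 (LegLabel Var)} (hΓ : SubstantialDiagram X Γ)
    (hΔ : SubstantialDiagram X Δ) : SubstantialDiagram X (Γ.union Δ) := by
  rintro (s | s) t hst
  · have h2 := hst.symm.trans (union_mate_unionL Γ Δ (.inr s))
    rcases hm : Γ.mate (.inr s) with p | t'
    · rw [hm] at h2
      cases h2
    · rw [hm] at h2
      rw [Sum.inr_injective h2]
      exact hΓ s t' hm
  · have h2 := hst.symm.trans (union_mate_unionR Γ Δ (.inr s))
    rcases hm : Δ.mate (.inr s) with p | t'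
    · rw [hm] at h2
      cases h2
    · rw [hm] at h2
      rw [Sum.inr_injective h2]
      exact hΔ s t' hm

theorem mk_union_mem_functionClasses {Γ Δ : Diagram 𝒱 (LegLabel Var)}
    (hΓ : ⟦Γ⟧ ∈ functionClasses 𝒱 X) (hΔ : ⟦Δ⟧ ∈ functionClasses 𝒱 X) :
    ⟦Γ.union Δ⟧ ∈ functionClasses 𝒱 X := by
  rw [mk_mem_functionClasses] at hΓ hΔ ⊢
  refine ⟨?_, substantialDiagram_union hΓ.2 hΔ.2⟩
  rintro (s | t)
  · exact hΓ.1 s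
  · exact hΔ.1 t

theorem mk_glue_mem_functionClasses {z : X} {l : ℕ} {Γ : Diagram 𝒱 (LegLabel Var)}
    (hΓ : ⟦Γ⟧ ∈ operatorClasses 𝒱 X z.1 l) (g : Invol Γ.Leg) (hg : IsDivGluing z.1 Γ g) :
    ⟦Γ.glue g⟧ ∈ functionClasses 𝒱 X := by
  rw [mk_mem_operatorClasses] at hΓ
  rw [mk_mem_functionClasses]
  refine ⟨fun s => ?_, substantialDiagram_glue hΓ.2 g fun s hs => ?_⟩
  · refine (hΓ.1.label_eq s.1).resolve_left fun h => ?_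
    have h1 := hg.1 s.1 h
    rw [s.2, h] at h1
    cases h1
  · by_cases h : Γ.label s = .dual z.1
    · exact ⟨z.1, z.2, Or.inr h⟩
    · have h1 := hg.1 _ ((hg.2 s h).resolve_left hs)
      rw [g.2] at h1
      exact ⟨z.1, z.2, Or.inl h1⟩

theorem isFinitary_apply_right {z : X} {l : ℕ} {D : FormalSum k 𝒱 (LegLabel Var)}
    (hD : restrict (operatorClasses 𝒱 X z.1 l) D = D) : IsFinitary fun F => apply D F := by
  have := (finitePairs_applyPred (𝒱 := 𝒱) X z.1 l).isFinitary_right D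
  simp only [restrict_univ, hD] at this
  exact this

theorem isFinitary_apply_left (z : X) (l : ℕ) (F : FormalSum k 𝒱 (LegLabel Var)) :
    IsFinitary fun D => apply (restrict (operatorClasses 𝒱 X z.1 l) D) F := by
  have := (finitePairs_applyPred (𝒱 := 𝒱) X z.1 l).isFinitary_left F
  simp only [restrict_univ] at this
  exact this

/-- The operator acts on function and struts together. Associativity of the union regroups operator
and function into one diagram, to which the struts are glued. -/
theorem apply_single {z : X} {l : ℕ} {Γ : Diagram 𝒱 (LegLabel Var)}
    (hΓ : ⟦Γ⟧ ∈ operatorClasses 𝒱 X z.1 l) (Δ : Diagram 𝒱 (LegLabel Var)) (w : X × X → k) :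
    apply (single Γ) (prod (single Δ) (lsum (expTerm 𝒱 (varLabel X) w))) =
      lsum (applyTerm (Γ.union Δ) w z (operatorLegs z.1 Γ Δ) (Invol.one _) (Γ.union Δ).label
        (functionLegs z.1 Γ Δ)) := by
  have hfin := (isFinitary_apply_right (k := k) (z := z) (l := l) (D := single Γ)
    (by rw [restrict_single, if_pos hΓ])).comp (isFinitary_prod_right (single Δ))
  refine (hfin.map_lsum (locallyFinite_expTerm _ _)).trans ?_
  congr 1
  funext n
  rw [expTerm, hfin.map_smul, hfin.map_sum, applyTerm, strutSum]
  refine congrArg _ (Finset.sum_congr rfl fun f _ => ?_)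
  rw [hfin.map_smul, prod_single, apply_eq_op, op_single natural_applyPred]
  refine congrArg _ (Eq.symm ?_)
  refine glueSum_eq_of_iso (unionAssocIso Γ Δ (struts 𝒱 (pairLabels (varLabel X) f))) _ _
    fun h h' hh => applyAdm_operatorLegs (mk_mem_operatorClasses.1 hΓ).1 ?_ h h' hh
  rintro ⟨i, b⟩
  cases b
  · exact ⟨fun h => congrArg (fun x : X => LegLabel.var x.1) h,
      fun h => Subtype.ext (LegLabel.var.inj h)⟩
  · exact ⟨fun h => congrArg (fun x : X => LegLabel.var x.1) h,
      fun h => Subtype.ext (LegLabel.var.inj h)⟩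

theorem divergence_single (z : Var) (Γ : Diagram 𝒱 (LegLabel Var)) :
    divergence z (single Γ) = (glueSum Γ (IsDivGluing z Γ) : FormalSum k 𝒱 (LegLabel Var)) := by
  rw [divergence_eq_unop, unop_single (natural_isDivGluing z)]

/-- Gluings within `Γ` are gluings of the union that leave the legs of `Δ` free; `divAdm_inr` says
that the latter condition is automatic. -/
theorem prod_divergence_single (z : Var) (Γ Δ : Diagram 𝒱 (LegLabel Var)) :
    prod (divergence z (single Γ)) (single Δ) =
      (∑ h : Invol (Γ.union Δ).Leg with DivAdm (operatorLegs z Γ Δ) (Invol.one _).1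
        (Γ.union Δ).label z (functionLegs z Γ Δ) h.1, single ((Γ.union Δ).glue h) :
        FormalSum k 𝒱 (LegLabel Var)) := by
  rw [divergence_single, glueSum, (isFinitary_prod_left _).map_sum]
  refine Invol.sum_extend (φ := (Sum.inl : Γ.Leg → Γ.Leg ⊕ Δ.Leg)) Sum.inl_injective (Invol.one _)
    (fun s => ⟨s, rfl⟩) _ _ _ _ ?_ ?_ ?_
  · rintro h hh (s | t) ht
    · exact absurd rfl (ht s)
    · exact divAdm_inr hh t
  · exact fun h h' hon hoff => divAdm_operatorLegs h h' hon fun t => hoff _ fun s hs => by cases hs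
  · intro h h' hon hoff _
    rw [prod_single, single_congr (glue_union_iso Γ Δ h)]
    have : h' = Invol.sumId h Δ.Leg := by
      refine Subtype.ext (funext ?_)
      rintro (s | t)
      · exact hon s
      · exact hoff _ fun s hs => by cases hs
    rw [this]

/-- Partial integration for single diagrams. -/
theorem exists_apply_single [CharZero k] {z : X} {l : ℕ} {Γ Δ : Diagram 𝒱 (LegLabel Var)}
    (hΓ : ⟦Γ⟧ ∈ operatorClasses 𝒱 X z.1 l) (hΔ : ⟦Δ⟧ ∈ functionClasses 𝒱 X)
    {w w' : X × X → k} (hw : ∀ x y, w (x, y) = w (y, x))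
    (hw' : ∀ x y, w' (x, y) = w' (y, x))
    (hww : ∀ y', ∑ y, 2 * w (z, y) * (2 * w' (y, y')) = if y' = z then -1 else 0) :
    ∃ P : FormalSum k 𝒱 (LegLabel Var), restrict (functionClasses 𝒱 X) P = P ∧
      apply (single Γ) (prod (single Δ) (lsum (expTerm 𝒱 (varLabel X) w))) =
        prod P (lsum (expTerm 𝒱 (varLabel X) w)) ∧
      pairExp w' P = (-1 : k) ^ l • pairExp w' (prod (divergence z.1 (single Γ)) (single Δ)) := by
  have hop := (mk_mem_operatorClasses.1 hΓ)
  have hfu := (mk_mem_functionClasses.1 hΔ)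
  obtain ⟨P, h1, h2, h3⟩ := exists_applyTerm_eq_prod (substantialDiagram_union hop.2 hfu.2) z hw hw' hww (operatorLegs z.1 Γ Δ)
    (Invol.one _) (Γ.union Δ).label (functionLegs z.1 Γ Δ) (by
      rintro (s | t) hs
      · exact ⟨rfl, (inl_mem_operatorLegs (Γ := Γ) (Δ := Δ)).1 hs⟩
      · exact absurd hs inr_notMem_operatorLegs) (by
      rintro (s | t) hs
      · exact absurd hs inl_notMem_functionLegs
      · exact ⟨rfl, (inr_mem_functionLegs (Γ := Γ) (Δ := Δ)).1 hs⟩) (by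
      rintro (s | t) hs -
      · exact (hop.1.label_eq s).resolve_left fun h => hs (inl_mem_operatorLegs.2 h)
      · exact hfu.1 t) (fun _ => Iff.rfl) (fun s hs => absurd rfl hs)
  refine ⟨P, h1, (apply_single hΓ Δ w).trans h2, h3.trans ?_⟩
  rw [card_operatorLegs hop.1, prod_divergence_single, (isFinitary_pairExp w').map_sum]
  refine congrArg _ (Finset.sum_congr rfl fun h hh => ?_)
  simp only [Finset.mem_filter, Finset.mem_univ, true_and] at hh
  refine (pairExp_single (Γ.union Δ) w' h (Γ.union Δ).label ?_).symm
  -- The gluing `h` comes from a divergence gluing of `Γ` alone. Hence its result is a substantial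
  -- function, as `pairExp_single` requires.
  have hl : ∀ s, ∃ s', h.1 (.inl s) = .inl s' := by
    intro s
    rcases hs : h.1 (.inl s) with s' | t
    · exact ⟨s', rfl⟩
    · have := congrArg h.1 hs
      rw [h.2, divAdm_inr hh t] at this
      cases this
  choose h0 hh0 using hl
  have hinv : ∀ s, h0 (h0 s) = s := fun s => Sum.inl_injective (β := Δ.Leg) (by
    rw [← hh0, ← hh0, h.2])
  have hdiv : IsDivGluing z.1 Γ ⟨h0, hinv⟩ :=
    (divAdm_operatorLegs (Δ := Δ) ⟨h0, hinv⟩ h hh0 (divAdm_inr hh)).2 hh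
  have he : h = Invol.sumId (⟨h0, hinv⟩ : Invol Γ.Leg) Δ.Leg := by
    refine Subtype.ext (funext ?_)
    rintro (s | t)
    · exact hh0 s
    · exact divAdm_inr hh t
  have h4 := mk_union_mem_functionClasses (mk_glue_mem_functionClasses hΓ _ hdiv) hΔ
  rw [he]
  rwa [Quotient.sound (glue_union_iso Γ Δ ⟨h0, hinv⟩)] at h4

end FormalSum

end FormalDiagram

end

/-! ### Integration by parts for formal sums, before relations -/

noncomputable section

namespace FormalDiagram

open Classical Diagram Invol

namespace FormalSum

variable {k : Type*} [Field k] {𝒱 : VertexKinds} {Var : Type*} {X : Finset Var}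

theorem expTerm_zero (w : X × X → k) :
    expTerm 𝒱 (varLabel X) w 0 = single (Diagram.empty 𝒱 (LegLabel Var)) := by
  rw [expTerm, Nat.factorial_zero, Nat.cast_one, inv_one, one_smul, Fintype.sum_unique,
    Fin.prod_univ_zero, one_smul]
  exact (single_congr (empty_iso _)).symm

/-- The strut with index `0` is over `X`, whatever `Γ` is. -/
theorem mk_union_struts_notMem {Γ : Diagram 𝒱 (LegLabel Var)} {n : ℕ} (f : Fin (n + 1) → X × X) :
    ⟦Γ.union (struts 𝒱 (pairLabels (varLabel X) f))⟧ ∉ functionClasses 𝒱 X := by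
  rw [mk_mem_functionClasses]
  rintro ⟨-, h⟩
  refine h (.inr (0, false)) (.inr (0, true))
    (union_mate_unionR Γ (struts 𝒱 (pairLabels (varLabel X) f)) (.inr (0, false))) ⟨?_, ?_⟩
  · exact ⟨_, (f 0).1.2, Or.inl rfl⟩
  · exact ⟨_, (f 0).2.2, Or.inl rfl⟩

/-- The substantial part of a Gaussian. -/
theorem restrict_prod_exp {P : FormalSum k 𝒱 (LegLabel Var)}
    (hP : restrict (functionClasses 𝒱 X) P = P) (w : X × X → k) :
    restrict (functionClasses 𝒱 X) (prod P (lsum (expTerm 𝒱 (varLabel X) w))) = P := by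
  have hr := isFinitary_restrict (k := k) (functionClasses 𝒱 X)
  have hp := isFinitary_prod_left (lsum (expTerm 𝒱 (varLabel X) w))
  have := (hr.comp (hp.comp hr)).ext hr (fun Γ => ?_) P
  · rwa [hP] at this
  · rw [restrict_single]
    split_ifs with h
    · have hq := hr.comp (isFinitary_prod_right (single Γ))
      refine (hq.map_lsum (locallyFinite_expTerm _ _)).trans ?_
      -- Only the term of the exponential without struts has a substantial part.
      rw [lsum_eq_zero_term]
      · rw [expTerm_zero, prod_single, ← single_congr (union_empty_iso Γ (Diagram.empty 𝒱 _)
          (hv := inferInstanceAs (IsEmpty Empty)) (hl := inferInstanceAs (IsEmpty Empty))),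
          restrict_single, if_pos h]
      · intro n
        rw [expTerm, hq.map_smul, hq.map_sum, Finset.sum_eq_zero, smul_zero]
        intro f _
        rw [hq.map_smul, prod_single, restrict_single, if_neg (mk_union_struts_notMem f), smul_zero]
    · rw [hp.map_zero, hr.map_zero]

/-- Partial integration of Gaussians, before relations are taken into account. -/
theorem apply_prod_exp [CharZero k] {z : X} {l : ℕ} {w w' : X × X → k}
    (hw : ∀ x y, w (x, y) = w (y, x)) (hw' : ∀ x y, w' (x, y) = w' (y, x))
    (hww : ∀ y', ∑ y, 2 * w (z, y) * (2 * w' (y, y')) = if y' = z then -1 else 0)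
    {D P : FormalSum k 𝒱 (LegLabel Var)} (hD : restrict (operatorClasses 𝒱 X z.1 l) D = D)
    (hP : restrict (functionClasses 𝒱 X) P = P) :
    prod (restrict (functionClasses 𝒱 X)
      (apply D (prod P (lsum (expTerm 𝒱 (varLabel X) w))))) (lsum (expTerm 𝒱 (varLabel X) w)) =
      apply D (prod P (lsum (expTerm 𝒱 (varLabel X) w))) ∧
    pairExp w' (restrict (functionClasses 𝒱 X)
      (apply D (prod P (lsum (expTerm 𝒱 (varLabel X) w))))) =
      (-1 : k) ^ l • pairExp w' (prod (divergence z.1 D) P) := by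
  have hr := isFinitary_restrict (k := k) (functionClasses 𝒱 X)
  have hp := isFinitary_prod_left (lsum (expTerm 𝒱 (varLabel X) w))
  have he := isFinitary_pairExp (𝒱 := 𝒱) w'
  have haD := fun F => isFinitary_apply_left (k := k) (𝒱 := 𝒱) z l F
  have hdiv := isFinitary_divergence (k := k) (𝒱 := 𝒱) X z.1 l
  have hone : ∀ Γ Δ : Diagram 𝒱 (LegLabel Var), ⟦Γ⟧ ∈ operatorClasses 𝒱 X z.1 l →
      ⟦Δ⟧ ∈ functionClasses 𝒱 X → _ ∧ _ := fun Γ Δ hΓ hΔ => by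
    obtain ⟨P, h1, h2, h3⟩ := exists_apply_single (k := k) hΓ hΔ hw hw' hww
    -- The factor `P`, so far only known to exist, is the substantial part of the result. This
    -- expresses it by finitary operators, and so the statement can be extended from single diagrams
    -- to formal sums.
    have h4 : restrict (functionClasses 𝒱 X) (apply (single Γ)
        (prod (single Δ) (lsum (expTerm 𝒱 (varLabel X) w)))) = P := by
      rw [h2, restrict_prod_exp h1]
    rw [← h4] at h2 h3
    exact ⟨h2.symm, h3⟩
  -- Extension in the function, for a fixed operator diagram; the extension in the operator follows.
  have hΓ : ∀ Γ : Diagram 𝒱 (LegLabel Var), ⟦Γ⟧ ∈ operatorClasses 𝒱 X z.1 l →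
      prod (restrict (functionClasses 𝒱 X) (apply (single Γ)
        (prod P (lsum (expTerm 𝒱 (varLabel X) w))))) (lsum (expTerm 𝒱 (varLabel X) w)) =
        apply (single Γ) (prod P (lsum (expTerm 𝒱 (varLabel X) w))) ∧
      pairExp w' (restrict (functionClasses 𝒱 X)
        (apply (single Γ) (prod P (lsum (expTerm 𝒱 (varLabel X) w))))) =
        (-1 : k) ^ l • pairExp w' (prod (divergence z.1 (single Γ)) P) := by
    intro Γ hΓ
    have ha := (isFinitary_apply_right (k := k) (z := z) (l := l) (D := single Γ)
      (by rw [restrict_single, if_pos hΓ])).comp (hp.comp hr)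
    constructor
    · have := ((hp.comp hr).comp ha).ext ha (fun Δ => ?_) P
      · rwa [hP] at this
      · rw [restrict_single]
        split_ifs with hΔ
        · exact (hone Γ Δ hΓ hΔ).1
        · have := ha.map_zero
          rw [hr.map_zero] at this
          rw [this, hr.map_zero, hp.map_zero]
    · have := ((he.comp hr).comp ha).ext
        (((he.comp (isFinitary_prod_right (divergence z.1 (single Γ)))).comp hr).smul
          ((-1 : k) ^ l)) (fun Δ => ?_) P
      · rwa [hP] at this
      · rw [restrict_single]
        split_ifs with hΔ
        · exact (hone Γ Δ hΓ hΔ).2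
        · have := ha.map_zero
          rw [hr.map_zero] at this
          rw [this, hr.map_zero, he.map_zero, (isFinitary_prod_right _).map_zero, he.map_zero,
            smul_zero]
  have ha := haD (prod P (lsum (expTerm 𝒱 (varLabel X) w)))
  constructor
  · have := ((hp.comp hr).comp ha).ext ha (fun Γ => ?_) D
    · rwa [hD] at this
    · rw [restrict_single (operatorClasses 𝒱 X z.1 l)]
      split_ifs with h
      · exact (hΓ Γ h).1
      · have := ha.map_zero
        rw [(isFinitary_restrict _).map_zero] at this
        rw [this, hr.map_zero, hp.map_zero]
  · have := ((he.comp hr).comp ha).ext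
      (((he.comp (isFinitary_prod_left P)).comp hdiv).smul ((-1 : k) ^ l)) (fun Γ => ?_) D
    · rwa [hD] at this
    · rw [restrict_single (operatorClasses 𝒱 X z.1 l)]
      split_ifs with h
      · exact (hΓ Γ h).2
      · have h1 := ha.map_zero
        have h2 := hdiv.map_zero
        rw [(isFinitary_restrict _).map_zero] at h1 h2
        rw [h1, h2, hr.map_zero, he.map_zero, (isFinitary_prod_left _).map_zero, he.map_zero,
          smul_zero]

/-- The divergence has used up all legs `∂_z`, and as only legs over `X` are glued, no strut over
`X` arises. -/
theorem restrict_prod_divergence {z : X} {l : ℕ} {D P : FormalSum k 𝒱 (LegLabel Var)}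
    (hD : restrict (operatorClasses 𝒱 X z.1 l) D = D)
    (hP : restrict (functionClasses 𝒱 X) P = P) :
    restrict (functionClasses 𝒱 X) (prod (divergence z.1 D) P) = prod (divergence z.1 D) P := by
  refine restrict_eq_self fun c hc => ?_
  obtain ⟨Γ, Δ, h1, h2, rfl⟩ := exists_of_prod_ne_zero hc
  rw [divergence_eq_unop] at h1
  obtain ⟨Θ, h3, g, hg, h4⟩ := exists_of_unop_ne_zero h1
  rw [← hD] at h3
  rw [← hP] at h2
  have h5 := mk_glue_mem_functionClasses (mem_of_restrict_ne_zero h3) g hg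
  rw [h4] at h5
  exact mk_union_mem_functionClasses h5 (mem_of_restrict_ne_zero h2)

end FormalSum

end FormalDiagram

end

noncomputable section

namespace FormalDiagram

open Classical Diagram Invol

/-- Used to list all that can be reached from an end, and so to exclude or identify its mate. -/
theorem Diagram.Walk.mem_of_closed {E : Type*} {α g : E → E} {S : Set E}
    (h : ∀ a ∈ S, α a ∈ S ∧ g a ∈ S) {a b : E} (w : Walk α g a b) (ha : a ∈ S) : b ∈ S := by
  induction w with
  | refl => exact ha
  | tail _ h2 ih =>
    rcases h2 with rfl | rfl
    · exact (h _ ih).1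
    · exact (h _ ih).2

/-- The involution that corresponds to `g` under a bijection. -/
def Invol.conj {S T : Type} (σ : S ≃ T) : Invol S ≃ Invol T where
  toFun g := ⟨fun t => σ (g.1 (σ.symm t)), fun t => by simp [g.2]⟩
  invFun g := ⟨fun s => σ.symm (g.1 (σ s)), fun s => by simp [g.2]⟩
  left_inv g := Subtype.ext (funext fun s => by simp)
  right_inv g := Subtype.ext (funext fun s => by simp)

/-! ### Insertion of diagrams in contexts -/

variable {𝒱 : VertexKinds} {L : Type*} {n : ℕ}

/-- Relabeling commutes with gluing. -/
def glueMapLabelIso {L' : Type*} (f : L → L') (Γ : Diagram 𝒱 L) (g : Invol Γ.Leg) :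
    Iso ((Γ.mapLabel f).glue g) ((Γ.glue g).mapLabel f) where
  vert := Equiv.refl _
  leg := Equiv.refl _
  kind_eq _ := rfl
  label_eq _ := rfl
  mate_eq e := by
    have h : ∀ e, endsMap (Δ := (Γ.mapLabel f).glue g) (Γ := (Γ.glue g).mapLabel f)
        (Equiv.refl _) (fun _ => rfl) (Equiv.refl _) e = e := by
      rintro (⟨⟨v, i⟩, h⟩ | s) <;> rfl
    have h2 := glue_mate_eq_of_walk (Γ.mapLabel f) g e ((Γ.glue g).mate e) ((Γ.glue g).mate_ne e)
      (glue_mate_walk Γ g e)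
    change (Γ.glue g).mate (endsMap (Δ := (Γ.mapLabel f).glue g) (Γ := (Γ.glue g).mapLabel f)
        (Equiv.refl _) (fun _ => rfl) (Equiv.refl _) e) =
      endsMap (Δ := (Γ.mapLabel f).glue g) (Γ := (Γ.glue g).mapLabel f)
        (Equiv.refl _) (fun _ => rfl) (Equiv.refl _) (((Γ.mapLabel f).glue g).mate e)
    rw [h, h, h2]

/-- The legs of a context that are not meant for insertion, indexed by `U`. -/
structure OuterLegs (C : Diagram 𝒱 (Fin n ⊕ L)) (U : Type) where
  emb : U → C.Leg
  lab : U → L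
  inj : Function.Injective emb
  label_eq : ∀ u, C.label (emb u) = .inr (lab u)
  surj : ∀ t a, C.label t = .inr a → ∃ u, emb u = t

namespace OuterLegs

/-- All legs with the appropriate labels. -/
def all (C : Diagram 𝒱 (Fin n ⊕ L)) : OuterLegs C {t : C.Leg // ∃ a, C.label t = .inr a} where
  emb := Subtype.val
  lab u := u.2.choose
  inj := Subtype.val_injective
  label_eq u := u.2.choose_spec
  surj t a h := ⟨⟨t, a, h⟩, rfl⟩

/-- The outer legs of a disjoint union with a diagram without inner legs. -/
def union {C : Diagram 𝒱 (Fin n ⊕ L)} {U : Type} (o : OuterLegs C U) (Γ : Diagram 𝒱 L) :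
    OuterLegs ((Γ.mapLabel Sum.inr).union C) (Γ.Leg ⊕ U) where
  emb := Sum.map id o.emb
  lab := Sum.elim Γ.label o.lab
  inj := Function.Injective.sumMap Function.injective_id o.inj
  label_eq := by
    rintro (s | u)
    · rfl
    · exact o.label_eq u
  surj := by
    rintro (s | t) a h
    · exact ⟨.inl s, rfl⟩
    · obtain ⟨u, rfl⟩ := o.surj t a h
      exact ⟨.inr u, rfl⟩

variable {C : Diagram 𝒱 (Fin n ⊕ L)} {U : Type} (o : OuterLegs C U)

theorem label_cases (t : C.Leg) : (∃ i, C.label t = .inl i) ∨ ∃ u, o.emb u = t := by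
  rcases h : C.label t with i | a
  · exact Or.inl ⟨i, rfl⟩
  · exact Or.inr (o.surj t a h)

theorem emb_ne {t : C.Leg} {i : Fin n} (h : C.label t = .inl i) (u : U) : o.emb u ≠ t := by
  rintro rfl
  rw [o.label_eq] at h
  cases h

/-- A gluing of outer legs. -/
def gluing (H : Invol U) : Invol C.Leg :=
  ⟨Invol.extend o.emb id H.1, Invol.extend_extend o.inj (Invol.one _) (fun u => ⟨u, rfl⟩) H⟩

theorem gluing_emb (H : Invol U) (u : U) : (o.gluing H).1 (o.emb u) = o.emb (H.1 u) :=
  Invol.extend_apply o.inj _ _ _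

theorem gluing_inner (H : Invol U) {t : C.Leg} {i : Fin n} (h : C.label t = .inl i) :
    (o.gluing H).1 t = t :=
  Invol.extend_off o.emb id H.1 (o.emb_ne h)

end OuterLegs

/-- The gluing of a diagram to the inner legs of a context. -/
def InsertionGluing (Γ : Diagram 𝒱 (Fin n)) (C : Diagram 𝒱 (Fin n ⊕ L))
    (g : Invol (Γ.Leg ⊕ C.Leg)) : Prop :=
  (∀ s : Γ.Leg, ∃ t : C.Leg, C.label t = .inl (Γ.label s) ∧ g.1 (.inl s) = .inr t) ∧
  (∀ t : C.Leg, ∀ i, C.label t = .inl i → ∃ s : Γ.Leg, g.1 (.inr t) = .inl s) ∧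
  (∀ t : C.Leg, ∀ a, C.label t = .inr a → g.1 (.inr t) = .inr t)

/-- `Δ` is the result of the insertion of `Γ` in `C`, where `σ` is the correspondence between the
legs of `Δ` and the outer legs of `C`. -/
structure Inserts {U : Type} (Γ : Diagram 𝒱 (Fin n)) {C : Diagram 𝒱 (Fin n ⊕ L)}
    (o : OuterLegs C U) (Δ : Diagram 𝒱 L) (σ : Δ.Leg ≃ U) : Prop where
  label_eq : ∀ s, o.lab (σ s) = Δ.label s
  edge : ∃ g : Invol (Γ.Leg ⊕ C.Leg), InsertionGluing Γ C g ∧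
    ∃ (vert : Δ.Vert ≃ Γ.Vert ⊕ C.Vert)
      (kind_eq : ∀ v, ((Γ.mapLabel Sum.inl).union C).kind (vert v) = Δ.kind v), ∀ e,
      ((Γ.mapLabel Sum.inl).union C).GlueWalk g
        (endsMap (Γ := (Γ.mapLabel Sum.inl).union C) vert kind_eq
          (fun s => .inr (o.emb (σ s))) e)
        (endsMap (Γ := (Γ.mapLabel Sum.inl).union C) vert kind_eq
          (fun s => .inr (o.emb (σ s))) (Δ.mate e))

namespace Inserts

variable {Γ : Diagram 𝒱 (Fin n)} {C : Diagram 𝒱 (Fin n ⊕ L)} {Δ : Diagram 𝒱 L} {U : Type}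

/-- The legs that survive an insertion are the outer legs of the context. Their index type `U` does
not depend on `Γ`, so gluings of the results for all diagrams of a relation can be compared in it.
-/
theorem exists_of_isInsertion (o : OuterLegs C U) (h : IsInsertion Γ C Δ) :
    ∃ σ, Inserts Γ o Δ σ := by
  obtain ⟨g, h1, h2, h3, ⟨f⟩⟩ := h
  have hfree : ∀ s : Δ.Leg, ∃ u, (f.leg.symm s).1 = .inr (o.emb u) := by
    intro s
    have hs := (f.leg.symm s).2
    rcases hr : (f.leg.symm s).1 with r | t
    · obtain ⟨t, -, ht⟩ := h1 r
      rw [hr, ht] at hs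
      cases hs
    · rcases o.label_cases t with ⟨i, hi⟩ | ⟨u, rfl⟩
      · obtain ⟨r, hr'⟩ := h2 t i hi
        rw [hr, hr'] at hs
        cases hs
      · exact ⟨u, rfl⟩
  choose σ hσ using hfree
  have hbij : Function.Bijective σ := by
    constructor
    · intro s s' e
      refine f.leg.symm.injective (Subtype.ext ?_)
      rw [hσ, hσ, e]
    · intro u
      refine ⟨f.leg ⟨.inr (o.emb u), h3 _ _ (o.label_eq u)⟩, o.inj ?_⟩
      have := hσ (f.leg ⟨.inr (o.emb u), h3 _ _ (o.label_eq u)⟩)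
      rw [Equiv.symm_apply_apply] at this
      exact (Sum.inr_injective this).symm
  refine ⟨Equiv.ofBijective σ hbij, fun s => ?_, g, ⟨h1, h2, h3⟩, f.vert.symm, f.symm.kind_eq,
    fun e => ?_⟩
  · have h4 := f.symm.label_eq s
    have h5 : ((Γ.mapLabel Sum.inl).union C).label (f.leg.symm s).1 = .inr (Δ.label s) := h4
    rw [hσ] at h5
    have h6 : (Sum.inr (o.lab (σ s)) : Fin n ⊕ L) = .inr (Δ.label s) :=
      (o.label_eq (σ s)).symm.trans h5
    exact Sum.inr_injective h6
  · have h4 := glue_mate_walk ((Γ.mapLabel Sum.inl).union C) g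
      (endsMap (Δ := Δ.mapLabel Sum.inr) (Γ := ((Γ.mapLabel Sum.inl).union C).glue g)
        f.symm.vert f.symm.kind_eq f.symm.leg e)
    rw [f.symm.mate_endsMap] at h4
    have hE : ∀ e : Δ.Ends, endsMap (Δ := ((Γ.mapLabel Sum.inl).union C).glue g)
        (Γ := (Γ.mapLabel Sum.inl).union C) id (fun _ => rfl) Subtype.val
        (endsMap (Δ := Δ.mapLabel Sum.inr) (Γ := ((Γ.mapLabel Sum.inl).union C).glue g)
        f.symm.vert f.symm.kind_eq f.symm.leg e) =
        endsMap (Δ := Δ) (Γ := (Γ.mapLabel Sum.inl).union C) f.vert.symm f.symm.kind_eq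
          (fun s => .inr (o.emb (Equiv.ofBijective σ hbij s))) e := by
      rintro (e | s)
      · rfl
      · exact congrArg Sum.inr (hσ s)
    rw [hE, hE] at h4
    exact h4

/-- The additional diagram `Θ` is made part of the context, and all of its legs are outer legs. -/
theorem union {o : OuterLegs C U} {σ : Δ.Leg ≃ U} (h : Inserts Γ o Δ σ) (Θ : Diagram 𝒱 L) :
    Inserts Γ (o.union Θ) (Θ.union Δ) (Equiv.sumCongr (Equiv.refl _) σ) := by
  obtain ⟨h0, g, ⟨h1, h2, h3⟩, vert, kind_eq, hedge⟩ := h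
  let ι : Γ.Leg ⊕ C.Leg → Γ.Leg ⊕ (Θ.Leg ⊕ C.Leg) := Sum.map id Sum.inr
  have hι : Function.Injective ι :=
    Function.Injective.sumMap Function.injective_id Sum.inr_injective
  let g' : Invol (Γ.Leg ⊕ (Θ.Leg ⊕ C.Leg)) :=
    ⟨Invol.extend ι id g.1, Invol.extend_extend hι (Invol.one _) (fun u => ⟨u, rfl⟩) g⟩
  have hg' : ∀ s, g'.1 (ι s) = ι (g.1 s) := Invol.extend_apply hι _ _
  have hg'' : ∀ s : Θ.Leg, g'.1 (.inr (.inl s)) = .inr (.inl s) := fun s =>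
    Invol.extend_off ι id g.1 (by rintro (t | t) h <;> cases h)
  let vert' : Θ.Vert ⊕ Δ.Vert ≃ Γ.Vert ⊕ (Θ.Vert ⊕ C.Vert) :=
    (Equiv.sumCongr (Equiv.refl _) vert).trans
      ((Equiv.sumAssoc _ _ _).symm.trans ((Equiv.sumCongr (Equiv.sumComm _ _)
        (Equiv.refl _)).trans (Equiv.sumAssoc _ _ _)))
  have hvr : ∀ v, vert' (.inr v) = Sum.map id Sum.inr (vert v) := by
    intro v
    change (Equiv.sumAssoc _ _ _) ((Equiv.sumCongr (Equiv.sumComm _ _) (Equiv.refl _))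
      ((Equiv.sumAssoc Θ.Vert Γ.Vert C.Vert).symm (.inr (vert v)))) = _
    rcases vert v with v | v <;> rfl
  have hkind' : ∀ v, ((Γ.mapLabel Sum.inl).union ((Θ.mapLabel Sum.inr).union C)).kind
      (Sum.map id Sum.inr v) = ((Γ.mapLabel Sum.inl).union C).kind v := by
    rintro (v | v) <;> rfl
  have hkind : ∀ v, ((Γ.mapLabel Sum.inl).union ((Θ.mapLabel Sum.inr).union C)).kind (vert' v) =
      (Θ.union Δ).kind v := by
    rintro (v | v)
    · rfl
    · rw [hvr, hkind', kind_eq]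
      rfl
  refine ⟨?_, g', ⟨fun s => ?_, ?_, ?_⟩, vert', hkind, fun e => ?_⟩
  · rintro (s | s)
    · rfl
    · exact h0 s
  · obtain ⟨t, ht, hst⟩ := h1 s
    exact ⟨.inr t, ht, (hg' (.inl s)).trans (by rw [hst]; rfl)⟩
  · rintro (t | t) i hi
    · cases hi
    · obtain ⟨s, hs⟩ := h2 t i hi
      exact ⟨s, (hg' (.inr t)).trans (by rw [hs]; rfl)⟩
  · rintro (t | t) a ha
    · exact hg'' t
    · exact (hg' (.inr t)).trans (by rw [h3 t a ha]; rfl)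
  · set M := endsMap (Δ := Θ.union Δ)
      (Γ := (Γ.mapLabel Sum.inl).union ((Θ.mapLabel Sum.inr).union C)) vert' hkind
      (fun s => .inr ((o.union Θ).emb (Equiv.sumCongr (Equiv.refl _) σ s)))
    let N : ((Γ.mapLabel Sum.inl).union C).Ends →
        ((Γ.mapLabel Sum.inl).union ((Θ.mapLabel Sum.inr).union C)).Ends :=
      endsMap (Δ := (Γ.mapLabel Sum.inl).union C)
        (Γ := (Γ.mapLabel Sum.inl).union ((Θ.mapLabel Sum.inr).union C)) (Sum.map id Sum.inr)
        hkind' ι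
    have hM1 : ∀ e : Θ.Ends, M (unionL Θ Δ e) =
        unionR (Γ.mapLabel Sum.inl) ((Θ.mapLabel Sum.inr).union C)
          (unionL (Θ.mapLabel Sum.inr) C e) := by
      rintro (⟨⟨v, i⟩, h⟩ | s) <;> rfl
    have hM2 : ∀ e : Δ.Ends, M (unionR Θ Δ e) = N (endsMap (Δ := Δ)
        (Γ := (Γ.mapLabel Sum.inl).union C) vert kind_eq (fun s => .inr (o.emb (σ s))) e) := by
      rintro (⟨⟨v, i⟩, h⟩ | s)
      · exact congrArg Sum.inl (Subtype.ext (Prod.ext (hvr v) rfl))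
      · rfl
    have hN1 : ∀ e : Γ.Ends, N (unionL (Γ.mapLabel Sum.inl) C e) = unionL (Γ.mapLabel Sum.inl)
        ((Θ.mapLabel Sum.inr).union C) e := by
      rintro (⟨⟨v, i⟩, h⟩ | s) <;> rfl
    have hN2 : ∀ e : C.Ends, N (unionR (Γ.mapLabel Sum.inl) C e) = unionR (Γ.mapLabel Sum.inl)
        ((Θ.mapLabel Sum.inr).union C) (unionR (Θ.mapLabel Sum.inr) C e) := by
      rintro (⟨⟨v, i⟩, h⟩ | s) <;> rfl
    induction e using union_ends_cases with
    | hl e =>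
      rw [union_mate_unionL, hM1, hM1]
      have := Walk.left (α := ((Γ.mapLabel Sum.inl).union ((Θ.mapLabel Sum.inr).union C)).mate)
        (g := Sum.map id g'.1) (unionR (Γ.mapLabel Sum.inl) ((Θ.mapLabel Sum.inr).union C)
          (unionL (Θ.mapLabel Sum.inr) C e))
      rw [union_mate_unionR, union_mate_unionL] at this
      exact this
    | hr e =>
      rw [union_mate_unionR, hM2, hM2]
      refine (hedge e).map N (fun a => ?_) fun a => ?_
      · have : ((Γ.mapLabel Sum.inl).union ((Θ.mapLabel Sum.inr).union C)).mate (N a) =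
            N (((Γ.mapLabel Sum.inl).union C).mate a) := by
          induction a using union_ends_cases with
          | hl a => rw [hN1, union_mate_unionL, union_mate_unionL, hN1]
          | hr a =>
            rw [hN2, union_mate_unionR, union_mate_unionR, union_mate_unionR, hN2]
        rw [← this]
        exact Walk.left _
      · have : N (Sum.map id g.1 a) = Sum.map id g'.1 (N a) := by
          rcases a with p | s
          · rfl
          · exact congrArg Sum.inr (hg' s).symm
        rw [this]
        exact Walk.right _

/-- Insertion glues the inner legs of the context and `H` glues outer legs. These are different
legs, so the order is irrelevant, and the second gluing can be carried out in the context. -/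
theorem glue {o : OuterLegs C U} {σ : Δ.Leg ≃ U} (h : Inserts Γ o Δ σ) (H : Invol U) :
    IsInsertion Γ (C.glue (o.gluing H)) (Δ.glue ((Invol.conj σ).symm H)) := by
  obtain ⟨h0, g, ⟨h1, h2, h3⟩, vert, kind_eq, hedge⟩ := h
  have hH : ∀ t i, C.label t = .inl i → (o.gluing H).1 t = t := fun t i => o.gluing_inner H
  have hcases : ∀ e, (∃ s, e = .inl s) ∨ (∃ t i, C.label t = .inl i ∧ e = .inr t) ∨
      ∃ u, e = (.inr (o.emb u) : Γ.Leg ⊕ C.Leg) := by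
    rintro (s | t)
    · exact Or.inl ⟨s, rfl⟩
    · rcases o.label_cases t with ⟨i, hi⟩ | ⟨u, rfl⟩
      · exact Or.inr (Or.inl ⟨t, i, hi, rfl⟩)
      · exact Or.inr (Or.inr ⟨u, rfl⟩)
  have hgu : ∀ u, g.1 (.inr (o.emb u)) = .inr (o.emb u) := fun u => h3 _ _ (o.label_eq u)
  have hGinl : ∀ s, Sum.map id (o.gluing H).1 (g.1 (.inl s)) = g.1 (.inl s) := by
    intro s
    obtain ⟨t, ht, hst⟩ := h1 s
    rw [hst, Sum.map_inr, hH t _ ht]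
  -- Both gluings at once. The results of the two orders are compared with the result of `G`, in
  -- `i1` and `i2`.
  let G : Invol (Γ.Leg ⊕ C.Leg) := ⟨fun e => g.1 (Sum.map id (o.gluing H).1 e), by
    intro e
    beta_reduce
    rcases hcases e with ⟨s, rfl⟩ | ⟨t, i, hi, rfl⟩ | ⟨u, rfl⟩
    · rw [Sum.map_inl, id, hGinl, g.2]
    · obtain ⟨s, hs⟩ := h2 t i hi
      rw [Sum.map_inr, hH t i hi, hs, Sum.map_inl, id, ← hs, g.2]
    · rw [Sum.map_inr, o.gluing_emb, hgu, Sum.map_inr, o.gluing_emb, H.2, hgu]⟩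
  have hGs : ∀ s, G.1 (.inl s) = g.1 (.inl s) := fun _ => rfl
  have hGt : ∀ t i, C.label t = .inl i → G.1 (.inr t) = g.1 (.inr t) := fun t i hi => by
    change g.1 (.inr ((o.gluing H).1 t)) = _
    rw [hH t i hi]
  have hGu : ∀ u, G.1 (.inr (o.emb u)) = .inr (o.emb (H.1 u)) := fun u => by
    change g.1 (.inr ((o.gluing H).1 (o.emb u))) = _
    rw [o.gluing_emb, hgu]
  have hex : ∀ e : Γ.Leg ⊕ {t // (o.gluing H).1 t = t}, ∃ e' : Γ.Leg ⊕ {t // (o.gluing H).1 t = t},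
      g.1 (Sum.map id Subtype.val e) = Sum.map id Subtype.val e' := by
    rintro (s | ⟨t, ht⟩)
    · obtain ⟨t, ht, hst⟩ := h1 s
      exact ⟨.inr ⟨t, hH t _ ht⟩, hst⟩
    · rcases o.label_cases t with ⟨i, hi⟩ | ⟨u, rfl⟩
      · obtain ⟨s, hs⟩ := h2 t i hi
        exact ⟨.inl s, hs⟩
      · exact ⟨.inr ⟨_, ht⟩, hgu u⟩
  choose g' hg' using hex
  have hval : Function.Injective (Sum.map id Subtype.val :
      Γ.Leg ⊕ {t // (o.gluing H).1 t = t} → Γ.Leg ⊕ C.Leg) :=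
    Function.Injective.sumMap Function.injective_id Subtype.val_injective
  have hinv : ∀ e, g' (g' e) = e := fun e => hval (by rw [← hg', ← hg', g.2])
  have hgG : ∀ e : Γ.Leg ⊕ {t // (o.gluing H).1 t = t},
      G.1 (Sum.map id Subtype.val e) = Sum.map id Subtype.val (g' e) := by
    rintro (s | t)
    · exact hg' (.inl s)
    · rw [← hg' (.inr t)]
      change g.1 (.inr ((o.gluing H).1 t.1)) = _
      rw [t.2]
      rfl
  refine ⟨⟨g', hinv⟩, ?_, ?_, ?_, ?_⟩
  · intro s
    obtain ⟨t, ht, hst⟩ := h1 s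
    refine ⟨⟨t, hH t _ ht⟩, ht, hval ?_⟩
    rw [← hg']
    exact hst
  · intro t i hi
    obtain ⟨s, hs⟩ := h2 t.1 i hi
    refine ⟨s, hval ?_⟩
    rw [← hg']
    exact hs
  · intro t a ha
    refine hval ?_
    rw [← hg']
    exact h3 t.1 a ha
  · have i1 : Nonempty (Iso (((Γ.mapLabel Sum.inl).union (C.glue (o.gluing H))).glue ⟨g', hinv⟩)
        (((Γ.mapLabel Sum.inl).union C).glue G)) := by
      refine glue_iso (Γ := (Γ.mapLabel Sum.inl).union C)
        (Δ := (Γ.mapLabel Sum.inl).union (C.glue (o.gluing H))) G ⟨g', hinv⟩ (Equiv.refl _)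
        (fun _ => rfl) (Sum.map id Subtype.val) ?_ ?_ ?_ ?_ ?_ ?_
      · intro e he
        rw [hgG]
        exact congrArg _ he
      · exact fun s t _ _ e => hval e
      · intro e he
        rcases hcases e with ⟨s, rfl⟩ | ⟨t, i, hi, rfl⟩ | ⟨u, rfl⟩
        · obtain ⟨t, ht, hst⟩ := h1 s
          rw [hGs, hst] at he
          cases he
        · obtain ⟨s, hs⟩ := h2 t i hi
          rw [hGt t i hi, hs] at he
          cases he
        · have h5 : (o.gluing H).1 (o.emb u) = o.emb u := by
            rw [o.gluing_emb]
            rw [hGu] at he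
            exact Sum.inr_injective he
          exact ⟨.inr ⟨_, h5⟩, hval (by rw [← hg']; exact hgu u), rfl⟩
      · rintro (s | t) _ <;> rfl
      · intro e
        have hE1 : ∀ e, endsMap (Δ := (Γ.mapLabel Sum.inl).union (C.glue (o.gluing H)))
            (Γ := (Γ.mapLabel Sum.inl).union C) (Equiv.refl _) (fun _ => rfl)
            (Sum.map id Subtype.val) (unionL _ _ e) = unionL _ _ e := by
          rintro (⟨⟨v, i⟩, h⟩ | s) <;> rfl
        have hE2 : ∀ e, endsMap (Δ := (Γ.mapLabel Sum.inl).union (C.glue (o.gluing H)))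
            (Γ := (Γ.mapLabel Sum.inl).union C) (Equiv.refl _) (fun _ => rfl)
            (Sum.map id Subtype.val) (unionR _ _ e) = unionR _ _
            (endsMap (Δ := C.glue (o.gluing H)) (Γ := C) id (fun _ => rfl) Subtype.val e) := by
          rintro (⟨⟨v, i⟩, h⟩ | s) <;> rfl
        induction e using union_ends_cases with
        | hl e =>
          rw [union_mate_unionL, hE1, hE1, ← union_mate_unionL]
          exact Walk.left _
        | hr e =>
          rw [union_mate_unionR, hE2, hE2]
          refine (glue_mate_walk C _ e).map (unionR _ _) (fun a => ?_) fun a => ?_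
          · rw [← union_mate_unionR]
            exact Walk.left _
          · rcases a with p | t
            · exact Walk.refl _
            · rcases o.label_cases t with ⟨i, hi⟩ | ⟨u, rfl⟩
              · rw [Sum.map_inr, hH t i hi]
                exact Walk.refl _
              · have h5 := Walk.right (α := ((Γ.mapLabel Sum.inl).union C).mate)
                  (g := Sum.map id G.1) (.inr (.inr (o.emb u)))
                rw [Sum.map_inr, hGu] at h5
                rw [Sum.map_inr, o.gluing_emb]
                exact h5
      · intro e _
        rw [← hgG]
        exact Walk.right (Sum.inr _)
    have i2 : Nonempty (Iso ((Δ.mapLabel Sum.inr).glue ((Invol.conj σ).symm H))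
        (((Γ.mapLabel Sum.inl).union C).glue G)) := by
      have hc : ∀ s, σ (((Invol.conj σ).symm H).1 s) = H.1 (σ s) :=
        fun s => σ.apply_symm_apply _
      refine glue_iso (Γ := (Γ.mapLabel Sum.inl).union C) (Δ := Δ.mapLabel Sum.inr) G
        ((Invol.conj σ).symm H) vert kind_eq (fun s => .inr (o.emb (σ s))) ?_ ?_ ?_ ?_ ?_ ?_
      · intro s hs
        rw [hGu, ← hc, hs]
      · exact fun s t _ _ e => σ.injective (o.inj (Sum.inr_injective e))
      · intro e he
        rcases hcases e with ⟨s, rfl⟩ | ⟨t, i, hi, rfl⟩ | ⟨u, rfl⟩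
        · obtain ⟨t, ht, hst⟩ := h1 s
          rw [hGs, hst] at he
          cases he
        · obtain ⟨s, hs⟩ := h2 t i hi
          rw [hGt t i hi, hs] at he
          cases he
        · rw [hGu] at he
          refine ⟨σ.symm u, σ.injective ?_, ?_⟩
          · rw [hc, Equiv.apply_symm_apply]
            exact o.inj (Sum.inr_injective he)
          · rw [Equiv.apply_symm_apply]
      · intro s _
        exact (o.label_eq _).trans (congrArg Sum.inr (h0 s))
      · intro e
        refine (hedge e).map (fun a => a) (fun a => Walk.left _) fun a => ?_
        rcases a with p | a
        · exact Walk.refl _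
        · rcases hcases a with ⟨s, rfl⟩ | ⟨t, i, hi, rfl⟩ | ⟨u, rfl⟩
          · exact Walk.right (α := ((Γ.mapLabel Sum.inl).union C).mate) (g := Sum.map id G.1)
              (.inr (.inl s))
          · have h5 := Walk.right (α := ((Γ.mapLabel Sum.inl).union C).mate)
              (g := Sum.map id G.1) (.inr (.inr t))
            rw [Sum.map_inr, hGt t i hi] at h5
            exact h5
          · rw [Sum.map_inr, hgu]
            exact Walk.refl _
      · intro s _
        rw [hc, ← hGu]
        exact Walk.right (Sum.inr _)
    exact ⟨(i1.some.trans i2.some.symm).trans (glueMapLabelIso Sum.inr Δ _)⟩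

/-- The struts of the result of an insertion are those of the context. -/
theorem mate_iff {o : OuterLegs C U} {σ : Δ.Leg ≃ U} (h : Inserts Γ o Δ σ)
    (hΓ : ∀ s t : Γ.Leg, Γ.mate (.inr s) ≠ .inr t) (s s' : Δ.Leg) :
    Δ.mate (.inr s) = .inr s' ↔ C.mate (.inr (o.emb (σ s))) = .inr (o.emb (σ s')) := by
  obtain ⟨h0, g, ⟨h1, h2, h3⟩, vert, kind_eq, hedge⟩ := h
  have hgu : ∀ u, g.1 (.inr (o.emb u)) = .inr (o.emb u) := fun u => h3 _ _ (o.label_eq u)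
  have hinj : Function.Injective (endsMap (Δ := Δ) (Γ := (Γ.mapLabel Sum.inl).union C) vert kind_eq
      (fun s => .inr (o.emb (σ s)))) := endsMap_injective kind_eq vert.injective
    fun s t e => σ.injective (o.inj (Sum.inr_injective e))
  have hmC : ∀ e : C.Ends, ((Γ.mapLabel Sum.inl).union C).mate (unionR _ _ e) =
      unionR _ _ (C.mate e) := union_mate_unionR _ _
  have hmΓ : ∀ e : Γ.Ends, ((Γ.mapLabel Sum.inl).union C).mate (unionL _ _ e) =
      unionL (Γ.mapLabel Sum.inl) C (Γ.mate e) := union_mate_unionL (Γ.mapLabel Sum.inl) C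
  have hW := hedge (.inr s)
  constructor
  · intro hm
    rw [hm] at hW
    have hW : ((Γ.mapLabel Sum.inl).union C).GlueWalk g
      (unionR (Γ.mapLabel Sum.inl) C (.inr (o.emb (σ s))))
      (unionR (Γ.mapLabel Sum.inl) C (.inr (o.emb (σ s')))) := hW
    have hne : s' ≠ s := by
      rintro rfl
      exact Δ.mate_ne _ hm
    have hne' : o.emb (σ s') ≠ o.emb (σ s) := fun e => hne (σ.injective (o.inj e))
    -- The edge of the context leads to a flag, to an inner leg, or to an outer leg. From an inner
    -- leg one comes to a leg of `Γ` and on to a flag, because `Γ` has no struts. Hence only in the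
    -- last case can another outer leg be reached, and it is the one found directly.
    rcases hc : C.mate (.inr (o.emb (σ s))) with p | t
    · have hcp := congrArg C.mate hc
      rw [C.mate_mate] at hcp
      have := hW.mem_of_closed (S := {unionR (Γ.mapLabel Sum.inl) C (.inr (o.emb (σ s))),
        unionR (Γ.mapLabel Sum.inl) C (.inl p)}) (by
          rintro e (rfl | rfl)
          · rw [hmC, hc]
            exact ⟨Or.inr rfl, Or.inl (congrArg Sum.inr (hgu _))⟩
          · rw [hmC, ← hcp]
            exact ⟨Or.inl rfl, Or.inr rfl⟩) (Or.inl rfl)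
      rcases this with e | e
      · exact absurd (Sum.inr_injective (Sum.inr_injective e)) hne'
      · cases e
    · have hct := congrArg C.mate hc
      rw [C.mate_mate] at hct
      rcases o.label_cases t with ⟨i, hi⟩ | ⟨u, rfl⟩
      · obtain ⟨r, hr⟩ := h2 t i hi
        have hr' : g.1 (.inl r) = .inr t := by rw [← hr, g.2]
        rcases hr'' : Γ.mate (.inr r) with q | r'
        · have hq := congrArg Γ.mate hr''
          rw [Γ.mate_mate] at hq
          have := hW.mem_of_closed (S := {unionR (Γ.mapLabel Sum.inl) C (.inr (o.emb (σ s))),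
            unionR (Γ.mapLabel Sum.inl) C (.inr t), unionL (Γ.mapLabel Sum.inl) C (.inr r),
            unionL (Γ.mapLabel Sum.inl) C (.inl q)}) (by
              rintro e (rfl | rfl | rfl | rfl)
              · rw [hmC, hc]
                exact ⟨Or.inr (Or.inl rfl), Or.inl (congrArg Sum.inr (hgu _))⟩
              · rw [hmC, ← hct]
                exact ⟨Or.inl rfl, Or.inr (Or.inr (Or.inl (congrArg Sum.inr hr)))⟩
              · rw [hmΓ, hr'']
                exact ⟨Or.inr (Or.inr (Or.inr rfl)), Or.inr (Or.inl (congrArg Sum.inr hr'))⟩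
              · rw [hmΓ, ← hq]
                exact ⟨Or.inr (Or.inr (Or.inl rfl)), Or.inr (Or.inr (Or.inr rfl))⟩) (Or.inl rfl)
          rcases this with e | e | e | e
          · exact absurd (Sum.inr_injective (Sum.inr_injective e)) hne'
          · exact absurd (Sum.inr_injective (Sum.inr_injective e)) (o.emb_ne hi _)
          · cases e
          · cases e
        · exact absurd hr'' (hΓ r r')
      · have := hW.mem_of_closed (S := {unionR (Γ.mapLabel Sum.inl) C (.inr (o.emb (σ s))),
          unionR (Γ.mapLabel Sum.inl) C (.inr (o.emb u))}) (by
          rintro e (rfl | rfl)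
          · rw [hmC, hc]
            exact ⟨Or.inr rfl, Or.inl (congrArg Sum.inr (hgu _))⟩
          · rw [hmC, ← hct]
            exact ⟨Or.inl rfl, Or.inr (congrArg Sum.inr (hgu _))⟩) (Or.inl rfl)
        rcases this with e | e
        · exact absurd (Sum.inr_injective (Sum.inr_injective e)) hne'
        · rw [Sum.inr_injective (Sum.inr_injective e)]
  · intro hc
    have hct := congrArg C.mate hc
    rw [C.mate_mate] at hct
    have := hW.mem_of_closed (S := {unionR (Γ.mapLabel Sum.inl) C (.inr (o.emb (σ s))),
      unionR (Γ.mapLabel Sum.inl) C (.inr (o.emb (σ s')))}) (by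
      rintro e (rfl | rfl)
      · rw [hmC, hc]
        exact ⟨Or.inr rfl, Or.inl (congrArg Sum.inr (hgu _))⟩
      · rw [hmC, ← hct]
        exact ⟨Or.inl rfl, Or.inr (congrArg Sum.inr (hgu _))⟩) (Or.inl rfl)
    rcases this with e | e
    · exact absurd (hinj (a₂ := .inr s) e) (Δ.mate_ne _)
    · exact hinj (a₂ := .inr s') e

end Inserts

end FormalDiagram

end

noncomputable section

namespace FormalDiagram

open Classical Diagram Invol

namespace FormalSum

variable {k : Type*} [Field k] {𝒱 : VertexKinds} {L : Type*} {ℛ : Set (InternalRelation k 𝒱)}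

/-! ### Equality modulo relations -/

/-- The formal sums that are equal to `0` modulo the relations. -/
def negligible (ℛ : Set (InternalRelation k 𝒱)) (L : Type*) : Submodule k (FormalSum k 𝒱 L) where
  carrier := {F | EqMod ℛ F 0}
  add_mem' := by
    intro F G hF hG T
    obtain ⟨r, hr, h⟩ := hF T
    obtain ⟨s, hs, h'⟩ := hG T
    refine ⟨r + s, add_mem hr hs, fun c hc => ?_⟩
    have h1 := h c hc
    have h2 := h' c hc
    rw [zero_apply, sub_zero] at h1 h2 ⊢
    rw [add_apply, add_apply, h1, h2]
  zero_mem' := fun T => ⟨0, zero_mem _, fun c _ => sub_self _⟩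
  smul_mem' := by
    intro a F hF T
    obtain ⟨r, hr, h⟩ := hF T
    refine ⟨a • r, Submodule.smul_mem _ a hr, fun c hc => ?_⟩
    have h1 := h c hc
    rw [zero_apply, sub_zero] at h1 ⊢
    rw [smul_apply, smul_apply, h1]

theorem eqMod_iff {F F' : FormalSum k 𝒱 L} : EqMod ℛ F F' ↔ F - F' ∈ negligible ℛ L := by
  change _ ↔ EqMod ℛ (F - F') 0
  simp only [EqMod, sub_apply, zero_apply, sub_zero]

theorem _root_.FormalDiagram.EqMod.refl (F : FormalSum k 𝒱 L) : EqMod ℛ F F :=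
  eqMod_iff.2 (by rw [sub_self]; exact zero_mem _)

theorem _root_.FormalDiagram.EqMod.symm {F F' : FormalSum k 𝒱 L} (h : EqMod ℛ F F') :
    EqMod ℛ F' F :=
  eqMod_iff.2 (by rw [← neg_sub]; exact neg_mem (eqMod_iff.1 h))

theorem _root_.FormalDiagram.EqMod.trans {F F' F'' : FormalSum k 𝒱 L} (h : EqMod ℛ F F')
    (h' : EqMod ℛ F' F'') : EqMod ℛ F F'' :=
  eqMod_iff.2 (by
    rw [← sub_add_sub_cancel F F' F'']
    exact add_mem (eqMod_iff.1 h) (eqMod_iff.1 h'))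

theorem _root_.FormalDiagram.EqMod.smul {F F' : FormalSum k 𝒱 L} (h : EqMod ℛ F F') (a : k) :
    EqMod ℛ (a • F) (a • F') :=
  eqMod_iff.2 (by
    rw [← smul_sub]
    exact Submodule.smul_mem _ a (eqMod_iff.1 h))

theorem relationSpan_le_negligible : relationSpan ℛ L ≤ negligible ℛ L := fun F hF _ =>
  ⟨F, hF, fun _ _ => sub_zero _⟩

namespace IsFinitary

variable {Φ : FormalSum k 𝒱 L → FormalSum k 𝒱 L}

theorem exists_finset (hΦ : IsFinitary Φ) (T : Finset (DiagramClass 𝒱 L)) :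
    ∃ S : Finset (DiagramClass 𝒱 L), ∀ F F' : FormalSum k 𝒱 L, (∀ a ∈ S, F a = F' a) →
      ∀ c ∈ T, Φ F c = Φ F' c := by
  choose S hS using hΦ.apply_eq
  refine ⟨T.biUnion S, fun F F' h c hc => ?_⟩
  rw [hS c F, hS c F']
  exact Finset.sum_congr rfl fun a ha => by rw [h a (Finset.mem_biUnion.2 ⟨c, hc, ha⟩)]

/-- Equality modulo relations is tested on finite sets of diagrams, and for each of these a finitary
operator needs only finitely many coefficients of its argument; in this sense it is continuous. -/
theorem mem_negligible_of_eqOn {F : FormalSum k 𝒱 L} (hΦ : IsFinitary Φ)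
    (h : ∀ S : Finset (DiagramClass 𝒱 L), ∃ F', (∀ a ∈ S, F a = F' a) ∧ Φ F' ∈ negligible ℛ L) :
    Φ F ∈ negligible ℛ L := by
  intro T
  obtain ⟨S, hS⟩ := hΦ.exists_finset T
  obtain ⟨F', h1, h2⟩ := h S
  obtain ⟨r, hr, h3⟩ := h2 T
  exact ⟨r, hr, fun c hc => by rw [hS F F' h1 c hc, h3 c hc]⟩

/-- Finitary operators that are negligible for all diagrams are negligible. -/
theorem mem_negligible_of_single (hΦ : IsFinitary Φ) (h : ∀ Γ, Φ (single Γ) ∈ negligible ℛ L)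
    (F : FormalSum k 𝒱 L) : Φ F ∈ negligible ℛ L := by
  refine hΦ.mem_negligible_of_eqOn fun S => ⟨∑ a ∈ S, F a • single a.out, fun c hc => ?_, ?_⟩
  · rw [sum_apply, Finset.sum_eq_single c]
    · rw [smul_apply, single_apply, if_pos (Quotient.out_eq c), mul_one]
    · intro b _ hb
      rw [smul_apply, single_apply, if_neg, mul_zero]
      rwa [Quotient.out_eq]
    · exact fun h' => absurd hc h'
  · rw [hΦ.map_sum]
    refine sum_mem fun a _ => ?_
    rw [hΦ.map_smul]
    exact Submodule.smul_mem _ _ (h _)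

/-- Finitary operators that are compatible with the consequences of single relations are
compatible with equality modulo relations. -/
theorem eqMod (hΦ : IsFinitary Φ)
    (h : ∀ ρ ∈ ℛ, ∀ (C : Diagram 𝒱 (Fin ρ.n ⊕ L)) (Δ : Diagram 𝒱 (Fin ρ.n) → Diagram 𝒱 L),
      (∀ Γ ∈ ρ.comb.support, IsInsertion Γ C (Δ Γ)) →
      Φ (ρ.comb.sum fun Γ a => a • single (Δ Γ)) ∈ negligible ℛ L)
    {F F' : FormalSum k 𝒱 L} (hF : EqMod ℛ F F') : EqMod ℛ (Φ F) (Φ F') := by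
  rw [eqMod_iff] at hF ⊢
  rw [← hΦ.map_sub]
  refine hΦ.mem_negligible_of_eqOn fun S => ?_
  obtain ⟨r, hr, h1⟩ := hF S
  refine ⟨r, fun a ha => by rw [← h1 a ha, zero_apply, sub_zero], ?_⟩
  clear h1
  induction hr using Submodule.span_induction with
  | mem r hr =>
    obtain ⟨ρ, hρ, C, Δ, hΔ, rfl⟩ := hr
    exact h ρ hρ C Δ hΔ
  | zero =>
    rw [hΦ.map_zero]
    exact zero_mem _
  | add r s _ _ hr hs =>
    rw [hΦ.map_add]
    exact add_mem hr hs
  | smul a r _ hr =>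
    rw [hΦ.map_smul]
    exact Submodule.smul_mem _ a hr

end IsFinitary

/-! ### Compatibility of operations with relations -/

/-- For each gluing `H` of the outer legs, the terms of the relation glued according to `H` form a
consequence of the same relation, in the glued context. -/
theorem sum_glueSum_mem {ρ : InternalRelation k 𝒱} (hρ : ρ ∈ ℛ) {C : Diagram 𝒱 (Fin ρ.n ⊕ L)}
    {U : Type} [Finite U] (o : OuterLegs C U) {Δ : Diagram 𝒱 (Fin ρ.n) → Diagram 𝒱 L}
    (σ : ∀ Γ ∈ ρ.comb.support, (Δ Γ).Leg ≃ U) (hσ : ∀ Γ h, Inserts Γ o (Δ Γ) (σ Γ h))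
    (Q : ∀ Γ, Invol (Δ Γ).Leg → Prop) (Q' : Invol U → Prop)
    (hQ : ∀ Γ h g, Q Γ g ↔ Q' (Invol.conj (σ Γ h) g)) :
    (ρ.comb.sum fun Γ a => a • glueSum (Δ Γ) (Q Γ)) ∈ relationSpan ℛ L := by
  let Δ' : Invol U → Diagram 𝒱 (Fin ρ.n) → Diagram 𝒱 L := fun H Γ =>
    if h : Γ ∈ ρ.comb.support then (Δ Γ).glue ((Invol.conj (σ Γ h)).symm H) else empty 𝒱 L
  have h1 : (ρ.comb.sum fun Γ a => a • glueSum (Δ Γ) (Q Γ)) =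
      ∑ H with Q' H, ρ.comb.sum fun Γ a => a • (single (Δ' H Γ) : FormalSum k 𝒱 L) := by
    simp only [Finsupp.sum]
    rw [Finset.sum_comm]
    refine Finset.sum_congr rfl fun Γ hΓ => ?_
    rw [← Finset.smul_sum, glueSum]
    congr 1
    refine Finset.sum_equiv (Invol.conj (σ Γ hΓ)) (fun g => ?_) fun g _ => ?_
    · simp only [Finset.mem_filter, Finset.mem_univ, true_and]
      exact hQ Γ hΓ g
    · simp only [Δ', dif_pos hΓ, Equiv.symm_apply_apply]
  rw [h1]
  refine sum_mem fun H _ => Submodule.subset_span ⟨ρ, hρ, C.glue (o.gluing H), Δ' H,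
    fun Γ hΓ => ?_, rfl⟩
  simp only [Δ', dif_pos hΓ]
  exact (hσ Γ hΓ).glue H

/-- The condition `𝒢` sees only legs and labels, and these are the same for all terms of a relation
in a given context. -/
theorem sum_opSum_mem {𝒢 : GluePred L} (h𝒢 : 𝒢.Natural) (Θ : Diagram 𝒱 L)
    {ρ : InternalRelation k 𝒱} (hρ : ρ ∈ ℛ) {C : Diagram 𝒱 (Fin ρ.n ⊕ L)}
    {Δ : Diagram 𝒱 (Fin ρ.n) → Diagram 𝒱 L} (hΔ : ∀ Γ ∈ ρ.comb.support, IsInsertion Γ C (Δ Γ)) :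
    (ρ.comb.sum fun Γ a => a • opSum 𝒢 Θ (Δ Γ)) ∈ relationSpan ℛ L := by
  have := C.finite_leg
  have := Θ.finite_leg
  choose σ hσ using fun Γ hΓ => Inserts.exists_of_isInsertion (.all C) (hΔ Γ hΓ)
  refine sum_glueSum_mem (Δ := fun Γ => Θ.union (Δ Γ)) hρ ((OuterLegs.all C).union Θ)
    (fun Γ hΓ => Equiv.sumCongr (Equiv.refl _) (σ Γ hΓ)) (fun Γ hΓ => (hσ Γ hΓ).union Θ) _
    (fun H => 𝒢 Θ.Leg _ Θ.label (OuterLegs.all C).lab H.1) fun Γ hΓ g => ?_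
  refine h𝒢.iff (Equiv.refl _) (σ Γ hΓ) (fun _ => rfl) (hσ Γ hΓ).label_eq fun e => ?_
  exact congrArg (Sum.map (Equiv.refl _) (σ Γ hΓ)) (congrArg g.1
    ((Equiv.sumCongr (Equiv.refl _) (σ Γ hΓ)).symm_apply_apply e))

/-- Sets of diagrams of which relations do not lead out. -/
def Saturated (ℛ : Set (InternalRelation k 𝒱)) (ℬ : Set (DiagramClass 𝒱 L)) : Prop :=
  ∀ ρ ∈ ℛ, ∀ (C : Diagram 𝒱 (Fin ρ.n ⊕ L)) (Δ : Diagram 𝒱 (Fin ρ.n) → Diagram 𝒱 L),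
    (∀ Γ ∈ ρ.comb.support, IsInsertion Γ C (Δ Γ)) →
    ∀ Γ ∈ ρ.comb.support, ∀ Γ' ∈ ρ.comb.support, ⟦Δ Γ⟧ ∈ ℬ → ⟦Δ Γ'⟧ ∈ ℬ

theorem saturated_univ : Saturated ℛ (Set.univ : Set (DiagramClass 𝒱 L)) :=
  fun _ _ _ _ _ _ _ _ _ _ => trivial

/-- All terms of a relation in a given context have the same labels and, as relations are strutless,
the same struts. -/
theorem saturated_functionClasses {Var : Type*} (X : Finset Var) :
    Saturated ℛ (functionClasses 𝒱 X) := by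
  intro ρ _ C Δ hΔ Γ hΓ Γ' hΓ' h
  obtain ⟨σ, hσ⟩ := Inserts.exists_of_isInsertion (.all C) (hΔ Γ hΓ)
  obtain ⟨σ', hσ'⟩ := Inserts.exists_of_isInsertion (.all C) (hΔ Γ' hΓ')
  have hl : ∀ s, (Δ Γ').label s = (Δ Γ).label (σ.symm (σ' s)) := fun s => by
    rw [← hσ.label_eq, Equiv.apply_symm_apply, hσ'.label_eq]
  rw [mk_mem_functionClasses] at h ⊢
  refine ⟨fun s => ?_, fun s t hst => ?_⟩
  · rw [hl]
    exact h.1 _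
  · rw [hl, hl]
    refine h.2 _ _ ?_
    rw [hσ.mate_iff (ρ.strutless Γ hΓ), Equiv.apply_symm_apply, Equiv.apply_symm_apply]
    exact (hσ'.mate_iff (ρ.strutless Γ' hΓ') s t).1 hst

/-- By saturation, a consequence of a relation is either kept as a whole or dropped as a whole. -/
theorem _root_.FormalDiagram.EqMod.restrict {ℬ : Set (DiagramClass 𝒱 L)} (hℬ : Saturated ℛ ℬ)
    {F F' : FormalSum k 𝒱 L} (h : EqMod ℛ F F') : EqMod ℛ (restrict ℬ F) (restrict ℬ F') := by
  have hr := isFinitary_restrict (k := k) ℬ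
  refine hr.eqMod (fun ρ hρ C Δ hΔ => ?_) h
  have h1 : (ρ.comb.sum fun Γ a => a • single (Δ Γ)) ∈ relationSpan ℛ L :=
    Submodule.subset_span ⟨ρ, hρ, C, Δ, hΔ, rfl⟩
  rw [Finsupp.sum] at h1 ⊢
  simp only [hr.map_sum, hr.map_smul, restrict_single]
  by_cases h : ∃ Γ ∈ ρ.comb.support, ⟦Δ Γ⟧ ∈ ℬ
  · obtain ⟨Γ, hΓ, h⟩ := h
    rw [Finset.sum_congr rfl fun Γ' hΓ' => by rw [if_pos (hℬ ρ hρ C Δ hΔ Γ hΓ Γ' hΓ' h)]]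
    exact relationSpan_le_negligible h1
  · push Not at h
    rw [Finset.sum_eq_zero fun Γ hΓ => by rw [if_neg (h Γ hΓ), smul_zero]]
    exact zero_mem _

/-- Finitarity in both arguments reduces this to a single diagram glued to a single consequence of a
relation, where `sum_opSum_mem` applies. -/
theorem FinitePairs.eqMod {𝒢 : GluePred L} (h𝒢 : 𝒢.Natural) {𝒜 ℬ : Set (DiagramClass 𝒱 L)}
    (hf : FinitePairs 𝒢 𝒜 ℬ) (hℬ : Saturated ℛ ℬ) (D : FormalSum k 𝒱 L) {F F' : FormalSum k 𝒱 L}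
    (h : EqMod ℛ F F') :
    EqMod ℛ (op 𝒢 (restrict 𝒜 D) (restrict ℬ F)) (op 𝒢 (restrict 𝒜 D) (restrict ℬ F')) := by
  refine (hf.isFinitary_right D).eqMod (fun ρ hρ C Δ hΔ => ?_) h
  refine (hf.isFinitary_left _).mem_negligible_of_single (fun Θ => ?_) D
  have hr := hf.isFinitary_right (single Θ : FormalSum k 𝒱 L)
  by_cases hΘ : ⟦Θ⟧ ∈ 𝒜
  swap
  · have h0 := (hf.isFinitary_left (k := k)
      (ρ.comb.sum fun Γ a => a • single (Δ Γ))).map_zero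
    rw [(isFinitary_restrict 𝒜).map_zero] at h0
    rw [restrict_single, if_neg hΘ, h0]
    exact zero_mem _
  rw [restrict_single, if_pos hΘ] at hr ⊢
  rw [Finsupp.sum, hr.map_sum]
  have hs : ∀ (a : k) Γ, op 𝒢 (single Θ) (restrict ℬ (a • single Γ)) =
      a • op 𝒢 (single Θ) (restrict ℬ (single Γ)) := fun a Γ => hr.map_smul a (single Γ)
  simp only [hs, restrict_single]
  by_cases h : ∃ Γ ∈ ρ.comb.support, ⟦Δ Γ⟧ ∈ ℬ
  · obtain ⟨Γ, hΓ, h⟩ := h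
    have h1 := sum_opSum_mem h𝒢 Θ hρ hΔ
    rw [Finsupp.sum] at h1
    refine relationSpan_le_negligible ?_
    rw [Finset.sum_congr rfl fun Γ' hΓ' => by
      rw [if_pos (hℬ ρ hρ C Δ hΔ Γ hΓ Γ' hΓ' h), op_single h𝒢]]
    exact h1
  · push Not at h
    have h0 := hr.map_zero
    rw [(isFinitary_restrict ℬ).map_zero] at h0
    rw [Finset.sum_eq_zero fun Γ hΓ => by rw [if_neg (h Γ hΓ), h0, smul_zero]]
    exact zero_mem _

end FormalSum

end FormalDiagram

end

noncomputable section

namespace FormalDiagram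

open Classical Diagram Invol

/-- The involution that exchanges two points. -/
def Invol.swap {T : Type} (s t : T) : Invol T :=
  ⟨Equiv.swap s t, (Equiv.swap s t).symm_apply_apply⟩

namespace Invol

variable {T : Type} {s t r : T}

theorem swap_left : (Invol.swap s t).1 s = t := Equiv.swap_apply_left s t

theorem swap_right : (Invol.swap s t).1 t = s := Equiv.swap_apply_right s t

theorem swap_of_ne (hs : r ≠ s) (ht : r ≠ t) : (Invol.swap s t).1 r = r :=
  Equiv.swap_apply_of_ne_of_ne hs ht

theorem swap_comm : Invol.swap s t = Invol.swap t s :=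
  Subtype.ext (congrArg (fun e : T ≃ T => (e : T → T)) (Equiv.swap_comm s t))

theorem map_swap {T' : Type} {φ : T → T'} (hφ : Function.Injective φ) (s t r : T) :
    φ ((Invol.swap s t).1 r) = (Invol.swap (φ s) (φ t)).1 (φ r) := by
  change φ (Equiv.swap s t r) = Equiv.swap (φ s) (φ t) (φ r)
  exact hφ.map_swap s t r

end Invol

namespace FormalSum

/-! ### Removal of struts -/

section RemoveStrut

variable {k : Type*} [Field k] {𝒱 : VertexKinds} {L : Type*}

/-- Gluing the two ends of a strut, whose labels are `a` and `b`, to each other. -/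
def StrutGluing (a b : L) (Γ : Diagram 𝒱 L) (g : Invol Γ.Leg) : Prop :=
  ∃ s t, Γ.mate (.inr s) = .inr t ∧ Γ.label s = a ∧ Γ.label t = b ∧ g = Invol.swap s t

theorem naturalGluing_strutGluing (a b : L) :
    NaturalGluing (StrutGluing a b : ∀ Γ : Diagram 𝒱 L, Invol Γ.Leg → Prop) := by
  rintro Γ Δ f g h hgh ⟨s, t, hst, ha, hb, hg⟩
  refine ⟨f.leg s, f.leg t, (Iso.mate_leg f s t).2 hst, (f.label_eq s).trans ha,
    (f.label_eq t).trans hb, Subtype.ext (funext fun r => ?_)⟩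
  obtain ⟨r, rfl⟩ := f.leg.surjective r
  rw [hgh, hg, Invol.map_swap f.leg.injective]

theorem isFinitary_removeStrut (a b : L) : IsFinitary (unop (StrutGluing a b) :
    FormalSum k 𝒱 L → FormalSum k 𝒱 L) := by
  have : IsFinitary (fun F : FormalSum k 𝒱 L => unop (StrutGluing a b) (restrict Set.univ F)) := by
    refine isFinitary_unop fun Θ => ⟨Nat.card Θ.Leg + (1 + 1), Set.range Θ.label ∪ {a, b},
      (Set.finite_range _).union (by simp), fun Γ _ g hg f => ?_⟩
    obtain ⟨s, t, hst, ha, hb, hg⟩ := hg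
    have := Γ.finite_leg
    constructor
    · have h1 := card_le_of_glued g (fun e => e = s) fun e he => by
        rw [hg] at he ⊢
        by_cases hs : e = s
        · exact Or.inl hs
        · by_cases ht : e = t
          · exact Or.inr (by rw [ht, Invol.swap_right])
          · exact absurd (Invol.swap_of_ne hs ht) he
      have : Nat.card {e // e = s} = 1 := Nat.card_eq_one_iff_unique.2
        ⟨⟨fun e e' => Subtype.ext (e.2.trans e'.2.symm)⟩, ⟨⟨s, rfl⟩⟩⟩
      rw [this] at h1
      exact h1.trans (Nat.add_le_add_right (Nat.card_congr f.leg).le _)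
    · intro r
      by_cases hs : r = s
      · exact Or.inr (by simp [hs, ha])
      · by_cases ht : r = t
        · exact Or.inr (by simp [ht, hb])
        · exact Or.inl ⟨f.leg ⟨r, by rw [hg, Invol.swap_of_ne hs ht]⟩,
            f.label_eq _⟩
  simp only [restrict_univ] at this
  exact this

/-- A strut whose ends are joined closes up to a circle, which is not recorded; so removal of a
strut is a gluing of outer legs. By `Inserts.mate_iff` the same struts are present in all terms of a
relation. The operation serves to detect the matrix of a Gaussian. -/
theorem eqMod_removeStrut {ℛ : Set (InternalRelation k 𝒱)} (a b : L) {F F' : FormalSum k 𝒱 L}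
    (h : EqMod ℛ F F') : EqMod ℛ (unop (StrutGluing a b) F) (unop (StrutGluing a b) F') := by
  have hu := isFinitary_removeStrut (k := k) (𝒱 := 𝒱) a b
  refine hu.eqMod (fun ρ hρ C Δ hΔ => relationSpan_le_negligible ?_) h
  have := C.finite_leg
  choose σ hσ using fun Γ hΓ => Inserts.exists_of_isInsertion (.all C) (hΔ Γ hΓ)
  rw [Finsupp.sum, hu.map_sum]
  simp only [hu.map_smul, unop_single (naturalGluing_strutGluing a b)]
  refine sum_glueSum_mem hρ (.all C) σ hσ _ (fun H => ∃ u v,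
    C.mate (.inr ((OuterLegs.all C).emb u)) = .inr ((OuterLegs.all C).emb v) ∧
    (OuterLegs.all C).lab u = a ∧ (OuterLegs.all C).lab v = b ∧ H = Invol.swap u v)
    fun Γ hΓ g => ?_
  constructor
  · rintro ⟨s, t, hst, ha, hb, hg⟩
    refine ⟨σ Γ hΓ s, σ Γ hΓ t, ((hσ Γ hΓ).mate_iff (ρ.strutless Γ hΓ) s t).1 hst,
      ((hσ Γ hΓ).label_eq s).trans ha, ((hσ Γ hΓ).label_eq t).trans hb,
      Subtype.ext (funext fun u => ?_)⟩
    change σ Γ hΓ (g.1 ((σ Γ hΓ).symm u)) = _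
    rw [hg, Invol.map_swap (σ Γ hΓ).injective, Equiv.apply_symm_apply]
  · rintro ⟨u, v, huv, ha, hb, hg⟩
    obtain ⟨s, rfl⟩ := (σ Γ hΓ).surjective u
    obtain ⟨t, rfl⟩ := (σ Γ hΓ).surjective v
    refine ⟨s, t, ((hσ Γ hΓ).mate_iff (ρ.strutless Γ hΓ) s t).2 huv,
      ((hσ Γ hΓ).label_eq s).symm.trans ha, ((hσ Γ hΓ).label_eq t).symm.trans hb,
      Subtype.ext (funext fun r => (σ Γ hΓ).injective ?_)⟩
    have h1 : σ Γ hΓ (g.1 ((σ Γ hΓ).symm (σ Γ hΓ r))) = _ :=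
      congrFun (congrArg Subtype.val hg) (σ Γ hΓ r)
    rw [Equiv.symm_apply_apply] at h1
    rw [h1, Invol.map_swap (σ Γ hΓ).injective]

end RemoveStrut

variable {k : Type*} [Field k] {𝒱 : VertexKinds} {Var : Type*} {X : Finset Var}

/-- The substantial diagram `Γ` contains no strut over `X`, so the strut to be removed is one of the
additional ones. -/
theorem StrutGluing.exists_of_union {Γ : Diagram 𝒱 (LegLabel Var)}
    (hΓ : ⟦Γ⟧ ∈ functionClasses 𝒱 X) {n : ℕ} {f : Fin n → X × X} {x y : X}
    {g : Invol (Γ.union (struts 𝒱 (pairLabels (varLabel X) f))).Leg}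
    (hg : StrutGluing (.var x.1) (.var y.1) (Γ.union (struts 𝒱 (pairLabels (varLabel X) f))) g) :
    ∃ i, g = Invol.swap (.inr (i, false)) (.inr (i, true)) ∧ (f i = (x, y) ∨ f i = (y, x)) := by
  obtain ⟨s, t, hst, ha, hb, hg⟩ := hg
  rcases s with s | ⟨i, b⟩
  · have h1 := union_mate_unionL Γ (struts 𝒱 (pairLabels (varLabel X) f)) (.inr s)
    have h2 := h1.symm.trans hst
    rcases h3 : Γ.mate (.inr s) with p | t'
    · rw [h3] at h2
      cases h2
    · rw [h3] at h2
      obtain rfl : .inl t' = t := Sum.inr_injective h2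
      exact absurd ⟨⟨x.1, x.2, Or.inl ha⟩, ⟨y.1, y.2, Or.inl hb⟩⟩
        ((mk_mem_functionClasses.1 hΓ).2 s t' h3)
  · have h1 := union_mate_unionR Γ (struts 𝒱 (pairLabels (varLabel X) f)) (.inr (i, b))
    obtain rfl : .inr (i, !b) = t := Sum.inr_injective (h1.symm.trans hst)
    refine ⟨i, ?_, ?_⟩
    · rw [hg]
      cases b
      · rfl
      · exact Invol.swap_comm
    · have hv : ∀ u v : X, varLabel X u = .var v.1 → u = v := fun u v h =>
        Subtype.ext (LegLabel.var.inj h)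
      cases b
      · exact Or.inl (Prod.ext (hv _ _ ha) (hv _ _ hb))
      · exact Or.inr (Prod.ext (hv _ _ hb) (hv _ _ ha))

/-- The strut `j` is still present after the removal of the strut `i`. -/
theorem glue_struts_notMem {Γ : Diagram 𝒱 (LegLabel Var)} {n : ℕ} {f : Fin n → X × X} {i j : Fin n}
    (hij : j ≠ i) {g : Invol (Γ.union (struts 𝒱 (pairLabels (varLabel X) f))).Leg}
    (hg : g = Invol.swap (.inr (i, false)) (.inr (i, true))) :
    ⟦(Γ.union (struts 𝒱 (pairLabels (varLabel X) f))).glue g⟧ ∉ functionClasses 𝒱 X := by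
  rw [mk_mem_functionClasses]
  rintro ⟨-, h⟩
  have hfree : ∀ b, g.1 (.inr (j, b)) = .inr (j, b) := fun b => by
    rw [hg]
    refine Invol.swap_of_ne ?_ ?_ <;>
    exact fun e => hij (congrArg Prod.fst (Sum.inr_injective e))
  refine h ⟨_, hfree false⟩ ⟨_, hfree true⟩ (glue_mate_eq_of_walk _ _ _ _ ?_ ?_)
    ⟨⟨_, (f j).1.2, Or.inl rfl⟩, ⟨_, (f j).2.2, Or.inl rfl⟩⟩
  · intro e
    have := congrArg Subtype.val (Sum.inr_injective e)
    cases Sum.inr_injective this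
  · have h1 := Walk.left (α := (Γ.union (struts 𝒱 (pairLabels (varLabel X) f))).mate)
      (g := Sum.map id g.1) (unionR Γ (struts 𝒱 (pairLabels (varLabel X) f)) (.inr (j, false)))
    rw [union_mate_unionR] at h1
    exact h1

theorem glue_strut_iso {Γ : Diagram 𝒱 (LegLabel Var)} {f : Fin 1 → X × X}
    {g : Invol (Γ.union (struts 𝒱 (pairLabels (varLabel X) f))).Leg}
    (hg : g = Invol.swap (.inr (0, false)) (.inr (0, true))) :
    Nonempty (Iso Γ ((Γ.union (struts 𝒱 (pairLabels (varLabel X) f))).glue g)) := by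
  obtain ⟨i1⟩ := glue_one_iso Γ
  obtain ⟨i2⟩ := glue_iso (Γ := Γ.union (struts 𝒱 (pairLabels (varLabel X) f))) (Δ := Γ) g
    (Invol.one _) (Equiv.sumEmpty _ _).symm (fun _ => rfl) Sum.inl
    (fun s _ => by rw [hg]; exact Invol.swap_of_ne (by simp) (by simp))
    (fun s t _ _ e => Sum.inl_injective e) (fun t ht => by
      rcases t with t | ⟨i, b⟩
      · exact ⟨t, rfl, rfl⟩
      · rw [Subsingleton.elim i 0, hg] at ht
        cases b
        · rw [Invol.swap_left] at ht
          cases Sum.inr_injective ht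
        · rw [Invol.swap_right] at ht
          cases Sum.inr_injective ht)
    (fun _ _ => rfl) (fun e => by
      have h1 := Walk.left (α := (Γ.union (struts 𝒱 (pairLabels (varLabel X) f))).mate)
        (g := Sum.map id g.1) (unionL Γ (struts 𝒱 (pairLabels (varLabel X) f)) e)
      rw [union_mate_unionL] at h1
      exact h1)
    (fun s hs => absurd rfl hs)
  exact ⟨i1.symm.trans i2⟩

/-- There is at most one such gluing: for `x = y` both orientations of the strut satisfy the
condition, but they define the same involution. -/
theorem glueSum_strutGluing {Γ : Diagram 𝒱 (LegLabel Var)} (hΓ : ⟦Γ⟧ ∈ functionClasses 𝒱 X)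
    (f : Fin 1 → X × X) (x y : X) :
    (glueSum (Γ.union (struts 𝒱 (pairLabels (varLabel X) f)))
      (StrutGluing (.var x.1) (.var y.1) _) : FormalSum k 𝒱 (LegLabel Var)) =
      if f 0 = (x, y) ∨ f 0 = (y, x) then single Γ else 0 := by
  split_ifs with h
  · rw [glueSum, Finset.sum_eq_single (Invol.swap (.inr (0, false)) (.inr (0, true)))]
    · exact (single_congr (glue_strut_iso rfl)).symm
    · intro g' hg' hne
      obtain ⟨i, hi, -⟩ := StrutGluing.exists_of_union hΓ (Finset.mem_filter.1 hg').2
      rw [Subsingleton.elim i 0] at hi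
      exact absurd hi hne
    · intro hg
      refine absurd (Finset.mem_filter.2 ⟨Finset.mem_univ _, ?_⟩) hg
      rcases h with h | h
      · refine ⟨.inr (0, false), .inr (0, true), union_mate_unionR Γ
          (struts 𝒱 (pairLabels (varLabel X) f)) (.inr (0, false)), ?_, ?_, rfl⟩
        · exact congrArg (fun p : X × X => LegLabel.var p.1.1) h
        · exact congrArg (fun p : X × X => LegLabel.var p.2.1) h
      · refine ⟨.inr (0, true), .inr (0, false), union_mate_unionR Γ
          (struts 𝒱 (pairLabels (varLabel X) f)) (.inr (0, true)), ?_, ?_, Invol.swap_comm⟩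
        · exact congrArg (fun p : X × X => LegLabel.var p.2.1) h
        · exact congrArg (fun p : X × X => LegLabel.var p.1.1) h
  · rw [glueSum, Finset.sum_eq_zero]
    intro g hg
    obtain ⟨i, -, hi⟩ := StrutGluing.exists_of_union hΓ (Finset.mem_filter.1 hg).2
    rw [Subsingleton.elim i 0] at hi
    exact absurd hi h

/-- The removal of a strut from a Gaussian. -/
theorem restrict_removeStrut_prod_exp {P : FormalSum k 𝒱 (LegLabel Var)}
    (hP : restrict (functionClasses 𝒱 X) P = P) (w : X × X → k) (x y : X) :
    restrict (functionClasses 𝒱 X) (unop (StrutGluing (.var x.1) (.var y.1))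
      (prod P (lsum (expTerm 𝒱 (varLabel X) w)))) =
      (∑ p with p = (x, y) ∨ p = (y, x), w p) • P := by
  have hr := isFinitary_restrict (k := k) (functionClasses 𝒱 X)
  have hu := hr.comp (isFinitary_removeStrut (k := k) (𝒱 := 𝒱) (LegLabel.var x.1) (.var y.1))
  have hp := isFinitary_prod_left (lsum (expTerm 𝒱 (varLabel X) w))
  have := ((hu.comp hp).comp hr).ext (hr.smul (∑ p with p = (x, y) ∨ p = (y, x), w p))
    (fun Γ => ?_) P
  · rwa [hP] at this
  rw [restrict_single]
  split_ifs with h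
  swap
  · rw [hp.map_zero, hu.map_zero, smul_zero]
  have hq := hu.comp (isFinitary_prod_right (single Γ))
  have hn : ∀ n, restrict (functionClasses 𝒱 X) (unop (StrutGluing (.var x.1) (.var y.1))
      (prod (single Γ) (expTerm 𝒱 (varLabel X) w n))) = (Nat.factorial n : k)⁻¹ •
      ∑ f : Fin n → X × X, (∏ i, w (f i)) • restrict (functionClasses 𝒱 X)
        (glueSum (Γ.union (struts 𝒱 (pairLabels (varLabel X) f)))
          (StrutGluing (.var x.1) (.var y.1) _)) := by
    intro n
    rw [expTerm, hq.map_smul, hq.map_sum]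
    refine congrArg _ (Finset.sum_congr rfl fun f _ => ?_)
    rw [hq.map_smul, prod_single, unop_single (naturalGluing_strutGluing _ _)]
  have h1 : restrict (functionClasses 𝒱 X) (unop (StrutGluing (.var x.1) (.var y.1))
      (prod (single Γ) (expTerm 𝒱 (varLabel X) w 1))) =
      (∑ p with p = (x, y) ∨ p = (y, x), w p) • single Γ := by
    rw [hn, Nat.factorial_one, Nat.cast_one, inv_one, one_smul, Finset.sum_filter,
      ← (Equiv.funUnique (Fin 1) (X × X)).sum_comp, Finset.sum_smul]
    refine Finset.sum_congr rfl fun f _ => ?_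
    rw [glueSum_strutGluing h, Fin.prod_univ_one]
    by_cases h2 : f 0 = (x, y) ∨ f 0 = (y, x)
    · rw [if_pos h2, restrict_single, if_pos h]
      exact congrArg (· • single Γ) (if_pos h2).symm
    · rw [if_neg h2, hr.map_zero, smul_zero]
      exact (zero_smul k (single Γ)).symm.trans (congrArg (· • single Γ) (if_neg h2).symm)
  refine (hq.map_lsum (locallyFinite_expTerm _ _)).trans ?_
  funext c
  -- Without struts in the exponential there is nothing to remove, and with two or more some strut
  -- over `X` is left. So only one term contributes to the substantial part.
  rw [lsum_apply, finsum_eq_single _ 1]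
  · rw [h1]
  · intro n hn1
    rw [hn, Finset.sum_eq_zero, smul_zero, zero_apply]
    intro f _
    rw [glueSum, hr.map_sum, Finset.sum_eq_zero, smul_zero]
    intro g hg
    obtain ⟨i, hi, -⟩ := StrutGluing.exists_of_union h (Finset.mem_filter.1 hg).2
    obtain ⟨j, hj⟩ : ∃ j, j ≠ i := by
      have : Nontrivial (Fin n) := by
        have := i.pos
        exact Fin.nontrivial_iff_two_le.2 (by omega)
      exact exists_ne i
    rw [restrict_single, if_neg (glue_struts_notMem hj hi)]

end FormalSum

end FormalDiagram

end

noncomputable section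

namespace FormalDiagram

open Classical Diagram Invol

namespace FormalSum

variable {k : Type*} [Field k] {𝒱 : VertexKinds} {Var : Type*} {X : Finset Var}
  {ℛ : Set (InternalRelation k 𝒱)}

/-! ### Gaussians and their integrals -/

/-- The weights of the struts in the exponent of a Gaussian. -/
def weight (Λ : Matrix X X k) (p : X × X) : k := 1 / 2 * Λ p.1 p.2

/-- The weights of the struts in the exponent of a Gaussian integral. -/
def dualWeight (Λ : Matrix X X k) (p : X × X) : k := -(1 / 2) * Λ⁻¹ p.1 p.2

theorem exp_quadratic (Λ : Matrix X X k) :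
    exp ((1 / 2 : k) • quadratic 𝒱 Λ) = lsum (expTerm 𝒱 (varLabel X) (weight Λ)) := by
  rw [← exp_eq_lsum, quadratic, Finset.smul_sum, Fintype.sum_prod_type]
  refine congrArg exp (Finset.sum_congr rfl fun x _ => ?_)
  rw [Finset.smul_sum]
  exact Finset.sum_congr rfl fun y _ => smul_smul _ _ _

theorem exp_dualQuadratic (Λ : Matrix X X k) :
    exp (-(1 / 2 : k) • dualQuadratic 𝒱 Λ⁻¹) = lsum (expTerm 𝒱 (dualLabel X) (dualWeight Λ)) := by
  rw [← exp_eq_lsum, dualQuadratic, Finset.smul_sum, Fintype.sum_prod_type]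
  refine congrArg exp (Finset.sum_congr rfl fun x _ => ?_)
  rw [Finset.smul_sum]
  exact Finset.sum_congr rfl fun y _ => smul_smul _ _ _

/-- This is `Λ * Λ⁻¹ = 1`, with the sign of the exponent in the integral; the factors `2` cancel the
factors `1 / 2` in both exponents. -/
theorem sum_weight_mul_dualWeight [CharZero k] {Λ : Matrix X X k} (h : IsUnit Λ) (z y' : X) :
    ∑ y, 2 * weight Λ (z, y) * (2 * dualWeight Λ (y, y')) = if y' = z then -1 else 0 := by
  have h1 := congrFun (congrFun (Matrix.mul_nonsing_inv Λ ((Matrix.isUnit_iff_isUnit_det Λ).1 h)) z)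
    y'
  rw [Matrix.mul_apply, Matrix.one_apply] at h1
  have h2 : ∀ y, 2 * weight Λ (z, y) * (2 * dualWeight Λ (y, y')) = -(Λ z y * Λ⁻¹ y y') := by
    intro y
    rw [weight, dualWeight]
    ring
  rw [Finset.sum_congr rfl fun y _ => h2 y, Finset.sum_neg_distrib, h1]
  by_cases h3 : z = y'
  · rw [if_pos h3, if_pos h3.symm]
  · rw [if_neg h3, if_neg (Ne.symm h3), neg_zero]

theorem dualWeight_symm {Λ : Matrix X X k} (h : Λ.IsSymm) (x y : X) :
    dualWeight Λ (x, y) = dualWeight Λ (y, x) := by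
  have h1 : Λ⁻¹.transpose = Λ⁻¹ := by rw [Matrix.transpose_nonsing_inv, h.eq]
  rw [dualWeight, dualWeight]
  exact congrArg _ (congrFun (congrFun h1 y) x)

theorem eqMod_pairExp (w : X × X → k) {F F' : FormalSum k 𝒱 (LegLabel Var)} (h : EqMod ℛ F F') :
    EqMod ℛ (pairExp w F) (pairExp w F') := by
  have := (finitePairs_pairPred (𝒱 := 𝒱) X).eqMod (natural_pairPred X)
    (saturated_functionClasses X) (lsum (expTerm 𝒱 (dualLabel X) w)) h
  rw [restrict_dualClasses, ← pairing_eq_op, ← pairing_eq_op] at this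
  exact this

theorem eqMod_prod {L : Type*} (D : FormalSum k 𝒱 L) {F F' : FormalSum k 𝒱 L} (h : EqMod ℛ F F') :
    EqMod ℛ (prod D F) (prod D F') := by
  have := finitePairs_unionPred.eqMod natural_unionPred saturated_univ D h
  simp only [restrict_univ, ← prod_eq_op] at this
  exact this

theorem eqMod_apply {z : X} {l : ℕ} {D : FormalSum k 𝒱 (LegLabel Var)}
    (hD : restrict (operatorClasses 𝒱 X z.1 l) D = D) {F F' : FormalSum k 𝒱 (LegLabel Var)}
    (h : EqMod ℛ F F') : EqMod ℛ (apply D F) (apply D F') := by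
  have := (finitePairs_applyPred (𝒱 := 𝒱) X z.1 l).eqMod natural_applyPred saturated_univ D h
  simp only [restrict_univ, hD, ← apply_eq_op] at this
  exact this

namespace IsGaussianWith

variable {G P P' : FormalSum k 𝒱 (LegLabel Var)} {Λ Λ' : Matrix X X k}

theorem restrict_eq (h : IsGaussianWith ℛ X G P Λ) : restrict (functionClasses 𝒱 X) P = P :=
  restrict_functionClasses h.isFunction h.substantial

theorem eqMod (h : IsGaussianWith ℛ X G P Λ) :
    EqMod ℛ G (prod P (lsum (expTerm 𝒱 (varLabel X) (weight Λ)))) := by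
  rw [← exp_quadratic]
  exact h.eq

theorem mk_of_restrict (hΛ : Λ.IsSymm) (hΛ' : IsUnit Λ)
    (hP : restrict (functionClasses 𝒱 X) P = P)
    (h : EqMod ℛ G (prod P (lsum (expTerm 𝒱 (varLabel X) (weight Λ))))) :
    IsGaussianWith ℛ X G P Λ where
  symm := hΛ
  nondegenerate := hΛ'
  isFunction Γ hΓ := by
    rw [← hP] at hΓ
    exact (mk_mem_functionClasses.1 (mem_of_restrict_ne_zero hΓ)).1
  substantial Γ hΓ := by
    rw [← hP] at hΓ
    exact (mk_mem_functionClasses.1 (mem_of_restrict_ne_zero hΓ)).2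
  eq := by rwa [exp_quadratic]

theorem pairing_eq (h : IsGaussianWith ℛ X G P Λ) :
    pairing X (exp (-(1 / 2 : k) • dualQuadratic 𝒱 Λ⁻¹)) P = pairExp (dualWeight Λ) P := by
  rw [exp_dualQuadratic, pairExp, h.restrict_eq]

/-- The integral of a Gaussian is well-defined modulo the relations. -/
theorem eqMod_integral [CharZero k] (h : IsGaussianWith ℛ X G P Λ)
    (h' : IsGaussianWith ℛ X G P' Λ') :
    EqMod ℛ (pairExp (dualWeight Λ) P) (pairExp (dualWeight Λ') P') := by
  have h1 := h.eqMod.symm.trans h'.eqMod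
  -- Comparison of substantial parts: `P` and `P'` agree modulo the relations.
  have h2 := h1.restrict (saturated_functionClasses X)
  rw [restrict_prod_exp h.restrict_eq, restrict_prod_exp h'.restrict_eq] at h2
  by_cases hΛ : Λ = Λ'
  · subst hΛ
    exact eqMod_pairExp _ h2
  obtain ⟨x, y, hxy⟩ : ∃ x y, Λ x y ≠ Λ' x y := by
    by_contra hc
    push Not at hc
    exact hΛ (Matrix.ext hc)
  -- Comparison after removal of a strut `x — y` yields multiples of `P` and `P'` that differ by the
  -- factors `Λ x y` and `Λ' x y`. The set `S` of orientations has one or two elements, according to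
  -- whether `x = y`.
  have h3 := (eqMod_removeStrut (.var x.1) (.var y.1) h1).restrict (saturated_functionClasses X)
  rw [restrict_removeStrut_prod_exp h.restrict_eq, restrict_removeStrut_prod_exp h'.restrict_eq]
    at h3
  set S := Finset.univ.filter fun p : X × X => p = (x, y) ∨ p = (y, x) with hS
  have hsum : ∀ M : Matrix X X k, M.IsSymm → ∑ p ∈ S, weight M p = S.card * (1 / 2) * M x y := by
    intro M hM
    rw [Finset.sum_congr rfl (g := fun _ => 1 / 2 * M x y), Finset.sum_const, nsmul_eq_mul,
      mul_assoc]
    intro p hp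
    rcases (Finset.mem_filter.1 hp).2 with rfl | rfl
    · rfl
    · exact congrArg _ (hM.apply x y)
  rw [hsum Λ h.symm, hsum Λ' h'.symm] at h3
  have hcard : (S.card : k) * (1 / 2) * Λ x y - S.card * (1 / 2) * Λ' x y ≠ 0 := by
    rw [← mul_sub]
    refine mul_ne_zero (mul_ne_zero ?_ (by norm_num)) (sub_ne_zero.2 hxy)
    rw [Nat.cast_ne_zero]
    exact Finset.card_ne_zero_of_mem (Finset.mem_filter.2 ⟨Finset.mem_univ (x, y), Or.inl rfl⟩)
  -- As `P'` may be replaced by `P`, a nonzero multiple of `P` is negligible. So `P` and `P'` are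
  -- negligible, and with them both integrals.
  have h4 := eqMod_iff.1 (h3.trans (h2.symm.smul _))
  rw [← sub_smul] at h4
  have h5 : EqMod ℛ P 0 := (Submodule.smul_mem_iff (negligible ℛ (LegLabel Var)) hcard).1 h4
  have h6 := eqMod_pairExp (dualWeight Λ) h5
  have h7 := eqMod_pairExp (dualWeight Λ') (h2.symm.trans h5)
  rw [(isFinitary_pairExp _).map_zero] at h6 h7
  exact h6.trans h7.symm

/-- Partial integration. -/
theorem exists_apply_divergence [CharZero k] (h : IsGaussianWith ℛ X G P Λ) {z : X} {l : ℕ}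
    {D : FormalSum k 𝒱 (LegLabel Var)} (hDl : D.IsOperator z.1 l) (hD : D.IsSubstantial X) :
    ∃ A B, IsGaussianWith ℛ X (apply D G) A Λ ∧
      IsGaussianWith ℛ X (prod (divergence z.1 D) G) B Λ ∧
      pairExp (dualWeight Λ) A = (-1 : k) ^ l • pairExp (dualWeight Λ) B := by
  have hD' := restrict_operatorClasses hDl hD
  have hP := h.restrict_eq
  obtain ⟨h1, h2⟩ := apply_prod_exp (w := weight Λ) (w' := dualWeight Λ)
    (fun x y => congrArg (1 / 2 * ·) (h.symm.apply y x)) (dualWeight_symm h.symm)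
    (sum_weight_mul_dualWeight h.nondegenerate _) hD' hP
  exact ⟨_, _, mk_of_restrict h.symm h.nondegenerate
      (restrict_eq_self fun c hc => mem_of_restrict_ne_zero hc)
      (by rw [h1]; exact eqMod_apply hD' h.eqMod),
    mk_of_restrict h.symm h.nondegenerate (restrict_prod_divergence hD' hP)
      (by rw [prod_assoc]; exact eqMod_prod _ h.eqMod), h2⟩

end IsGaussianWith

end FormalSum

end FormalDiagram

end

/-! ### The proposition -/

theorem mainTheorem2 {k : Type*} [Field k] [CharZero k] (𝒱 : FormalDiagram.VertexKinds)
    (ℛ : Set (FormalDiagram.InternalRelation k 𝒱)) {Var : Type*} (X : Finset Var)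
    (z : Var) (hz : z ∈ X)
    (G : FormalDiagram.FormalSum k 𝒱 (FormalDiagram.LegLabel Var))
    (hG : G.IsNondegenerateGaussian ℛ X)
    (l : ℕ) (D : FormalDiagram.FormalSum k 𝒱 (FormalDiagram.LegLabel Var))
    (hDl : D.IsOperator z l) (hD : D.IsSubstantial X) :
    (∃ I, (D.apply G).HasGaussianIntegral ℛ X I) ∧
    (∃ J, ((D.divergence z).prod G).HasGaussianIntegral ℛ X J) ∧
    ∀ I J, (D.apply G).HasGaussianIntegral ℛ X I →
      ((D.divergence z).prod G).HasGaussianIntegral ℛ X J →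
      FormalDiagram.EqMod ℛ I ((-1 : k) ^ l • J) := by
  obtain ⟨P, Λ, h⟩ := hG
  obtain ⟨A, B, hA, hB, hAB⟩ := h.exists_apply_divergence (z := ⟨z, hz⟩) hDl hD
  refine ⟨⟨_, A, Λ, hA, .refl _⟩, ⟨_, B, Λ, hB, .refl _⟩, ?_⟩
  -- The given presentations need not be those with factors `A`, `B` and matrix `Λ`, but
  -- `eqMod_integral` shows that they lead to the same integrals modulo the relations.
  rintro I J ⟨P₁, Λ₁, h₁, hI⟩ ⟨P₂, Λ₂, h₂, hJ⟩
  rw [h₁.pairing_eq] at hI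
  rw [h₂.pairing_eq] at hJ
  have h3 := hI.trans (h₁.eqMod_integral hA)
  rw [hAB] at h3
  exact h3.trans (((h₂.eqMod_integral hB).symm.trans hJ.symm).smul _)
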